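/- Let $n\ge 2$, let $G=SO_o(n+1,1,\mathbb R)$, and let $P=MAN$ be its conformal parabolic subgroup, i.e. the stabilizer of a null ray $\mathbb R_{>0}e_+$ in $\mathbb R^{n+1,1}$, so that $G/P\simeq S^n$. For $w\in\mathbb C$ let $\chi_w(p)=a^w$, where $p\,e_+=a\,e_+$, $a>0$ (then $a$ acts on $\mathfrak n$ by $a$ and on $\mathfrak n_-$ by $a^{-1}$), and let $\mathcal L_w\to G/P$ be the homogeneous line bundle induced from $\chi_w$: its smooth sections are the smooth functions $f:G\to\mathbb C$ with $f(gp)=\chi_w(p)^{-1}f(g)$, on which $G$ acts by $(g\cdot f)(x)=f(g^{-1}x)$. A bilinear map $B$ from sections of $\mathcal L_{w_1}$ and $\mathcal L_{w_2}$ to sections of $\mathcal L_{w_3}$ is a bilinear differential operator if, for some $k$, $B(f,h)$ at each point depends only on the $k$-jets of $f$ and $h$ at that point; it is conformally invariant if it commutes with the action of $G$. In the non-compact picture, sections are restricted to $N_-=\exp(\mathfrak n_-)\simeq\mathbb R^n$, where $\exp(x)e_+=e_++x+\tfrac12|x|^2e_-$. A bilinear operator is said to be given by coefficients $(a_{i,j})_{i+j\le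 N}$ if in this picture $$B(f,h)(x)=\Big(\sum_{i+j\le N}a_{i,j}\,\Delta_x^i\,\Delta_y^j\,\Big(\sum_{k=1}^n\partial_{x_k}\partial_{y_k}\Big)^{N-i-j}f(x)h(y)\Big)\Big|_{y=x}.$$ Write $(x)_l=x(x+1)\cdots(x+l-1)$. For $N\in\mathbb N=\{0,1,2,\dots\}$ and $\lambda,\mu\in\mathbb C$ put, for $i\le j$, $$A_{i,j}(\lambda,\mu)=\frac{(-N)_{i+j}\,(1-N+\lambda)_{j-i}}{2^{i+j}(-1)^{i+j}\,i!\,j!\,(1-\frac n2-\mu)_j\,(\lambda+\frac n2-i)_i}\sum_{k=0}^i(-1)^k\binom ik(j-i+1+k)_{i-k}(\lambda+\tfrac n2-i)_{i-k}(\mu-N+1)_k(\lambda-N+1-k)_k,$$ and $A_{i,j}(\lambda,\mu)=A_{j,i}(\mu,\lambda)$ for $i>j$. Let $D(\lambda,\mu)=\prod_{m=1}^N(\lambda+\frac n2-m)(m-\frac n2-\mu)$. 1. Let $\lambda,\mu\in\mathbb C\setminus\{m-\frac n2\mid m\in\mathbb N\}$ and $N\in\mathbb N$. Then $A_{i,j}(\lambda,\mu)=A_{j,i}(\mu,\lambda)$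 for all $i+j\le N$, and there is a nonzero bilinear conformally invariant differential operator $$B_N:C^\infty(G/P,\mathcal L_{-\lambda})\times C^\infty(G/P,\mathcal L_{-\mu})\to C^\infty(G/P,\mathcal L_{-\lambda-\mu+2N})$$ given by the coefficients $A_{i,j}(\lambda,\mu)$. Every bilinear conformally invariant differential operator between these bundles is a multiple of $B_N$. 2. For all $N$ and all $\lambda,\mu\in\mathbb C$ the operator $B_N$ is still invariant, in the following sense. If $D(\lambda,\mu)\neq0$ (so that no denominator in $A_{i,j}$ vanishes), there is a nonzero bilinear conformally invariant differential operator between the bundles of part 1 given by the coefficients $A_{i,j}(\lambda,\mu)$. The products $D\cdot A_{i,j}$ $(i+j\le N)$, in which all denominators cancel, are polynomials in $\lambda,\mu$, and for all $\lambda,\mu\in\mathbb C$ there is a (possibly zero) bilinear conformally invariant differential operator given by the coefficients $(D\cdot A_{i,j})(\lambda,\mu)$. Moreover, for all $N,\lambda,\mu$ there is a nonzero bilinear conformally invariant differential operator between these bundles given by some coefficients $(a_{i,j})$. 3. Outside the range of part 1 uniqueness may fail: there are $N\in\mathbb N$ and $\lambda,\mu\in\{m-\frac n2\mid m\in\mathbb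 N\}$ for which two linearly independent bilinear conformally invariant differential operators between these bundles exist. -/

import Mathlib

open scoped ContDiff Matrix

noncomputable section

namespace ConformalBilinear

/-! ### The group `SO_o(n+1,1)`, its conformal parabolic subgroup and the opposite nilradical

We use coordinates `(v₊, v', v₋)` on `ℝ × ℝⁿ × ℝ`, in which the quadratic form of
signature `(n+1,1)` is `|v'|² - 2 v₊ v₋`. -/

/-- Indices of the coordinates `(v₊, v', v₋)` of `ℝ × ℝⁿ × ℝ`. -/
abbrev Idx (n : ℕ) : Type := Unit ⊕ Fin n ⊕ Unit

/-- The index of the coordinate `v₊`. -/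
abbrev iPlus (n : ℕ) : Idx n := Sum.inl ()

/-- The index of the coordinate `v₋`. -/
abbrev iMinus (n : ℕ) : Idx n := Sum.inr (Sum.inr ())

/-- The quadratic form of signature `(n+1,1)`. -/
def quad (n : ℕ) (v : Idx n → ℝ) : ℝ :=
  ∑ k : Fin n, v (Sum.inr (Sum.inl k)) ^ 2 - 2 * v (iPlus n) * v (iMinus n)

/-- The future light cone (without its vertex). -/
def futureCone (n : ℕ) : Set (Idx n → ℝ) :=
  {v | quad n v = 0 ∧ 0 < v (iPlus n) + v (iMinus n)}

/-- `SO_o(n+1,1)`: the linear isometries of the form of signature `(n+1,1)` with determinant one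
that preserve the future light cone. -/
def SOo (n : ℕ) : Subgroup (Matrix.SpecialLinearGroup (Idx n) ℝ) where
  carrier := {g | (∀ v, quad n ((g : Matrix (Idx n) (Idx n) ℝ) *ᵥ v) = quad n v) ∧
    ∀ v, (g : Matrix (Idx n) (Idx n) ℝ) *ᵥ v ∈ futureCone n ↔ v ∈ futureCone n}
  one_mem' := by simp
  mul_mem' := by
    rintro a b ⟨ha, ha'⟩ ⟨hb, hb'⟩
    refine ⟨fun v => ?_, fun v => ?_⟩
    · rw [Matrix.SpecialLinearGroup.coe_mul, ← Matrix.mulVec_mulVec, ha, hb]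
    · rw [Matrix.SpecialLinearGroup.coe_mul, ← Matrix.mulVec_mulVec, ha', hb']
  inv_mem' := by
    rintro a ⟨ha, ha'⟩
    have key : ∀ v, (a : Matrix (Idx n) (Idx n) ℝ) *ᵥ
        (((a⁻¹ : Matrix.SpecialLinearGroup (Idx n) ℝ) : Matrix (Idx n) (Idx n) ℝ) *ᵥ v) = v := by
      intro v
      rw [Matrix.mulVec_mulVec, ← Matrix.SpecialLinearGroup.coe_mul, mul_inv_cancel,
        Matrix.SpecialLinearGroup.coe_one, Matrix.one_mulVec]
    refine ⟨fun v => ?_, fun v => ?_⟩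
    · rw [← ha, key]
    · rw [← ha', key]

/-- The matrix of an element of `SO_o(n+1,1)`. -/
def mat {n : ℕ} (g : SOo n) : Matrix (Idx n) (Idx n) ℝ :=
  ((g : Matrix.SpecialLinearGroup (Idx n) ℝ) : Matrix (Idx n) (Idx n) ℝ)

theorem mat_mul {n : ℕ} (g h : SOo n) : mat (g * h) = mat g * mat h := by
  simp [mat]

theorem mat_one {n : ℕ} : mat (1 : SOo n) = 1 := by
  simp [mat]

/-- The null vector `e₊`. -/
def ePlus (n : ℕ) : Idx n → ℝ := Pi.single (iPlus n) 1

/-- The conformal parabolic subgroup `P = M A N`: the stabilizer of the null ray `ℝ_{>0} e₊`.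
The orbit of this ray is the space of future null rays, that is `G / P ≅ Sⁿ`. -/
def Par (n : ℕ) : Subgroup (SOo n) where
  carrier := {p | ∃ a : ℝ, 0 < a ∧ mat p *ᵥ ePlus n = a • ePlus n}
  one_mem' := ⟨1, one_pos, by simp [mat_one]⟩
  mul_mem' := by
    rintro p q ⟨a, ha, hp⟩ ⟨b, hb, hq⟩
    refine ⟨b * a, mul_pos hb ha, ?_⟩
    rw [mat_mul, ← Matrix.mulVec_mulVec, hq, Matrix.mulVec_smul, hp, smul_smul]
  inv_mem' := by
    rintro p ⟨a, ha, hp⟩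
    refine ⟨a⁻¹, inv_pos.mpr ha, ?_⟩
    have h : mat p⁻¹ *ᵥ (mat p *ᵥ ePlus n) = ePlus n := by
      rw [Matrix.mulVec_mulVec, ← mat_mul, inv_mul_cancel, mat_one, Matrix.one_mulVec]
    rw [hp, Matrix.mulVec_smul] at h
    rw [eq_inv_smul_iff₀ ha.ne', h]

/-- The character `χ_w : m a n ↦ a ^ w` of `P`. Here `a > 0` is the factor by which `p` scales
`e₊`, that is the upper left entry of `p`; the element `a` acts on the nilradical `𝔫` by `a` and on
the opposite nilradical `𝔫₋` by `a⁻¹`. -/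
def chi (n : ℕ) (w : ℂ) (p : SOo n) : ℂ := ((mat p (iPlus n) (iPlus n) : ℝ) : ℂ) ^ w

/-- The matrix of `exp x`, `x ∈ 𝔫₋ = ℝⁿ`: it sends `e₊` to `e₊ + x + (|x|²/2) e₋`, a vector
`y ∈ ℝⁿ` to `y + ⟨x, y⟩ e₋`, and fixes `e₋`. -/
def nbarMat (n : ℕ) (x : EuclideanSpace ℝ (Fin n)) : Matrix (Idx n) (Idx n) ℝ :=
  Matrix.fromBlocks 1 0
    (Matrix.of fun s _ => Sum.elim (fun k => x k) (fun _ => (∑ k, x k ^ 2) / 2) s)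
    (Matrix.fromBlocks 1 0 (Matrix.of fun _ k => x k) 1)

theorem nbarMat_det (n : ℕ) (x : EuclideanSpace ℝ (Fin n)) : (nbarMat n x).det = 1 := by
  rw [nbarMat, Matrix.det_fromBlocks_zero₁₂, Matrix.det_fromBlocks_zero₁₂]
  simp

theorem nbarMat_plus (n : ℕ) (x : EuclideanSpace ℝ (Fin n)) (v : Idx n → ℝ) :
    (nbarMat n x *ᵥ v) (iPlus n) = v (iPlus n) := by
  simp [nbarMat, Matrix.mulVec, dotProduct, Fintype.sum_sum_type]

theorem nbarMat_mid (n : ℕ) (x : EuclideanSpace ℝ (Fin n)) (v : Idx n → ℝ) (k : Fin n) :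
    (nbarMat n x *ᵥ v) (Sum.inr (Sum.inl k)) =
      v (Sum.inr (Sum.inl k)) + x k * v (iPlus n) := by
  simp [nbarMat, Matrix.mulVec, dotProduct, Fintype.sum_sum_type, Matrix.one_apply]
  ring

theorem nbarMat_minus (n : ℕ) (x : EuclideanSpace ℝ (Fin n)) (v : Idx n → ℝ) :
    (nbarMat n x *ᵥ v) (iMinus n) = v (iMinus n) +
      ∑ k, x k * v (Sum.inr (Sum.inl k)) + (∑ k, x k ^ 2) / 2 * v (iPlus n) := by
  simp [nbarMat, Matrix.mulVec, dotProduct, Fintype.sum_sum_type]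
  ring

theorem quad_nbarMat (n : ℕ) (x : EuclideanSpace ℝ (Fin n)) (v : Idx n → ℝ) :
    quad n (nbarMat n x *ᵥ v) = quad n v := by
  have h : ∑ k, (v (Sum.inr (Sum.inl k)) + x k * v (iPlus n)) ^ 2 =
      ∑ k, v (Sum.inr (Sum.inl k)) ^ 2 +
      2 * v (iPlus n) * ∑ k, x k * v (Sum.inr (Sum.inl k)) +
      v (iPlus n) ^ 2 * ∑ k, x k ^ 2 := by
    rw [Finset.mul_sum, Finset.mul_sum, ← Finset.sum_add_distrib, ← Finset.sum_add_distrib]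
    exact Finset.sum_congr rfl fun k _ => by ring
  simp only [quad, nbarMat_plus, nbarMat_mid, nbarMat_minus, h]
  ring

/-- A null vector is future-directed iff its light-cone coordinates are nonnegative and not both
zero. -/
theorem mem_futureCone_iff (n : ℕ) (v : Idx n → ℝ) : v ∈ futureCone n ↔
    quad n v = 0 ∧ 0 ≤ v (iPlus n) ∧ (v (iPlus n) = 0 → 0 < v (iMinus n)) := by
  have hs : 0 ≤ ∑ k : Fin n, v (Sum.inr (Sum.inl k)) ^ 2 :=
    Finset.sum_nonneg fun k _ => sq_nonneg _
  constructor
  · rintro ⟨h, h'⟩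
    refine ⟨h, ?_, fun h0 => by linarith⟩
    unfold quad at h
    by_contra hc
    nlinarith
  · rintro ⟨h, h1, h2⟩
    refine ⟨h, ?_⟩
    unfold quad at h
    rcases h1.eq_or_lt with h0 | h0
    · have := h2 h0.symm
      linarith
    · by_contra hc
      nlinarith

theorem nbarMat_cone (n : ℕ) (x : EuclideanSpace ℝ (Fin n)) (v : Idx n → ℝ) :
    nbarMat n x *ᵥ v ∈ futureCone n ↔ v ∈ futureCone n := by
  rw [mem_futureCone_iff, mem_futureCone_iff, quad_nbarMat, nbarMat_plus]
  refine and_congr_right fun h => and_congr_right fun _ => ?_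
  refine forall_congr' fun h0 => ?_
  have hz : ∀ k : Fin n, v (Sum.inr (Sum.inl k)) = 0 := by
    have h1 : ∑ k : Fin n, v (Sum.inr (Sum.inl k)) ^ 2 = 0 := by
      simpa [quad, h0] using h
    intro k
    have := (Finset.sum_eq_zero_iff_of_nonneg (fun k _ => sq_nonneg _)).mp h1 k (Finset.mem_univ k)
    exact pow_eq_zero_iff two_ne_zero |>.mp this
  rw [nbarMat_minus]
  simp [hz, h0]

/-- The element `exp x` of `N₋ ⊆ SO_o(n+1,1)`, for `x ∈ 𝔫₋ = ℝⁿ`. -/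
def nbar (n : ℕ) (x : EuclideanSpace ℝ (Fin n)) : SOo n :=
  ⟨⟨nbarMat n x, nbarMat_det n x⟩, quad_nbarMat n x, nbarMat_cone n x⟩

/-! ### Sections of homogeneous line bundles and invariant bilinear differential operators -/

/-- The space `C^∞(G/P, L_w)` of smooth sections of the line bundle induced from the character
`χ_w` of `P`: functions on `G` with `f (g p) = χ_w(p)⁻¹ f(g)`. Smoothness is smoothness in the
local charts `x ↦ g exp(x) P` of `G/P`, with the local trivializations given by the
sections `g exp(x) P ↦ g exp(x)` of `G → G/P`. -/
def Sections (n : ℕ) (w : ℂ) : Submodule ℂ (SOo n → ℂ) where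
  carrier := {f | (∀ g, ∀ p ∈ Par n, f (g * p) = (chi n w p)⁻¹ * f g) ∧
    ∀ g, ContDiff ℝ ∞ fun x => f (g * nbar n x)}
  zero_mem' := ⟨fun _ _ _ => by simp, fun _ => by simpa using contDiff_const⟩
  add_mem' := by
    rintro a b ⟨ha, ha'⟩ ⟨hb, hb'⟩
    refine ⟨fun g p hp => ?_, fun g => (ha' g).add (hb' g)⟩
    simp only [Pi.add_apply, ha g p hp, hb g p hp]
    ring
  smul_mem' := by
    rintro c a ⟨ha, ha'⟩
    refine ⟨fun g p hp => ?_, fun g => contDiff_const.mul (ha' g)⟩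
    simp only [Pi.smul_apply, smul_eq_mul, ha g p hp]
    ring

/-- The left regular representation of `G` on the sections of `L_w`. -/
def act {n : ℕ} {w : ℂ} (g : SOo n) (f : Sections n w) : Sections n w :=
  ⟨fun x => (f : SOo n → ℂ) (g⁻¹ * x),
    fun x p hp => by simpa only [mul_assoc] using f.2.1 (g⁻¹ * x) p hp,
    fun x => by simpa only [mul_assoc] using f.2.2 (g⁻¹ * x)⟩

/-- The `k`-jet at the point `gP` of a section vanishes. -/
def JetVanishes {n : ℕ} {w : ℂ} (k : ℕ) (g : SOo n) (f : Sections n w) : Prop :=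
  ∀ m ≤ k, iteratedFDeriv ℝ m (fun x => (f : SOo n → ℂ) (g * nbar n x)) 0 = 0

/-- Complex bilinear maps from sections of `L_{w₁}` and of `L_{w₂}` to sections of `L_{w₃}`. -/
abbrev BilinMap (n : ℕ) (w₁ w₂ w₃ : ℂ) : Type :=
  Sections n w₁ →ₗ[ℂ] Sections n w₂ →ₗ[ℂ] Sections n w₃

/-- A bilinear map is a bilinear differential operator if, for some `k`, the value of `B(f,h)` at
any point depends only on the `k`-jets of `f` and of `h` at this point, i.e. if `B` is induced by a
bundle map `J^k L_{w₁} ⊗ J^k L_{w₂} → L_{w₃}`. -/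
def IsDifferential {n : ℕ} {w₁ w₂ w₃ : ℂ} (B : BilinMap n w₁ w₂ w₃) : Prop :=
  ∃ k : ℕ, ∀ g f h, JetVanishes k g f ∨ JetVanishes k g h → (B f h : SOo n → ℂ) g = 0

/-- Bilinear conformally invariant differential operators. -/
structure IsConformallyInvariant {n : ℕ} {w₁ w₂ w₃ : ℂ} (B : BilinMap n w₁ w₂ w₃) : Prop where
  differential : IsDifferential B
  equivariant : ∀ g f h, B (act g f) (act g h) = act g (B f h)

/-! ### The explicit operators in the non-compact picture -/

/-- Functions of two variables `x, y ∈ ℝⁿ`. -/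
abbrev Fun2 (n : ℕ) : Type := EuclideanSpace ℝ (Fin n) → EuclideanSpace ℝ (Fin n) → ℂ

/-- `∂/∂x_k`. -/
def dx {n : ℕ} (k : Fin n) (u : Fun2 n) : Fun2 n :=
  fun x y => fderiv ℝ (fun z => u z y) x (EuclideanSpace.single k 1)

/-- `∂/∂y_k`. -/
def dy {n : ℕ} (k : Fin n) (u : Fun2 n) : Fun2 n :=
  fun x y => fderiv ℝ (fun z => u x z) y (EuclideanSpace.single k 1)

/-- The Laplacian in `x`. -/
def lapX {n : ℕ} (u : Fun2 n) : Fun2 n := ∑ k, dx k (dx k u)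

/-- The Laplacian in `y`. -/
def lapY {n : ℕ} (u : Fun2 n) : Fun2 n := ∑ k, dy k (dy k u)

/-- The operator `∑_k ∂_{x_k} ∂_{y_k}`. -/
def mixed {n : ℕ} (u : Fun2 n) : Fun2 n := ∑ k, dx k (dy k u)

/-- In the non-compact picture `B` is
`∑_{i+j≤N} a_{i,j} Δ_x^i Δ_y^j (∑_k ∂_{x_k} ∂_{y_k})^(N-i-j)`, applied to `f(exp x) h(exp y)` and
restricted to the diagonal `x = y`. -/
def HasForm {n : ℕ} {w₁ w₂ w₃ : ℂ} (N : ℕ) (a : ℕ → ℕ → ℂ) (B : BilinMap n w₁ w₂ w₃) : Prop :=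
  ∀ (f : Sections n w₁) (h : Sections n w₂) (x : EuclideanSpace ℝ (Fin n)),
    (B f h : SOo n → ℂ) (nbar n x) =
      ∑ i ∈ Finset.range (N + 1), ∑ j ∈ Finset.range (N + 1 - i),
        a i j * (lapX^[i] (lapY^[j] (mixed^[N - i - j]
          (fun y z => (f : SOo n → ℂ) (nbar n y) * (h : SOo n → ℂ) (nbar n z))))) x x

/-- The Pochhammer symbol `(x)_l = x (x+1) ⋯ (x+l-1)`. -/
def poch (x : ℂ) (l : ℕ) : ℂ := ∏ m ∈ Finset.range l, (x + m)

/-- The sum over `k` in the coefficient `A_{i,j}(λ,μ)`. -/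
def coeffSum (n N : ℕ) (lam mu : ℂ) (i j : ℕ) : ℂ :=
  ∑ k ∈ Finset.range (i + 1), (-1) ^ k * (i.choose k : ℂ) *
    poch ((j : ℂ) - i + 1 + k) (i - k) * poch (lam + n / 2 - i) (i - k) *
    poch (mu - N + 1) k * poch (lam - N + 1 - k) k

/-- The formula for `A_{i,j}(λ,μ)` in the range `i ≤ j`. The quotients of Gamma functions are
written as `Γ(i+j-N)/Γ(-N) = (-N)_{i+j}`, `Γ(1-i+j-N+λ)/Γ(1-N+λ) = (1-N+λ)_{j-i}`,
`Γ(1+j-n/2-μ)/Γ(1-n/2-μ) = (1-n/2-μ)_j` and `Γ(λ+n/2)/Γ(λ+n/2-i) = (λ+n/2-i)_i`. -/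
def coeffUpper (n N : ℕ) (lam mu : ℂ) (i j : ℕ) : ℂ :=
  poch (-(N : ℂ)) (i + j) * poch (1 - N + lam) (j - i) /
    (2 ^ (i + j) * (-1) ^ (i + j) * (i.factorial : ℂ) * (j.factorial : ℂ) *
      poch (1 - (n : ℂ) / 2 - mu) j * poch (lam + (n : ℂ) / 2 - i) i) *
    coeffSum n N lam mu i j

/-- The coefficients `A_{i,j}(λ,μ)`, extended to `j < i` by `A_{i,j}(λ,μ) = A_{j,i}(μ,λ)`. -/
def coeff (n N : ℕ) (lam mu : ℂ) (i j : ℕ) : ℂ :=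
  if i ≤ j then coeffUpper n N lam mu i j else coeffUpper n N mu lam j i

/-- The common denominator `∏_{m=1}^N (λ + n/2 - m) (m - n/2 - μ)` of the coefficients. -/
def commonDenom (n N : ℕ) (lam mu : ℂ) : ℂ :=
  ∏ m ∈ Finset.Icc 1 N, ((lam + (n : ℂ) / 2 - m) * (m - (n : ℂ) / 2 - mu))

/-- The formula for `A_{i,j}(λ,μ)`, `i ≤ j`, multiplied by the common denominator. -/
def polyCoeffUpper (n N : ℕ) (lam mu : ℂ) (i j : ℕ) : ℂ :=
  poch (-(N : ℂ)) (i + j) * poch (1 - N + lam) (j - i) /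
    (2 ^ (i + j) * (-1) ^ (i + j) * (i.factorial : ℂ) * (j.factorial : ℂ)) *
    (∏ m ∈ Finset.Icc (i + 1) N, (lam + (n : ℂ) / 2 - m)) *
    (∏ m ∈ Finset.Icc (j + 1) N, (m - (n : ℂ) / 2 - mu)) *
    coeffSum n N lam mu i j

/-- The coefficients multiplied by the common denominator; these are polynomials in `λ, μ`. -/
def polyCoeff (n N : ℕ) (lam mu : ℂ) (i j : ℕ) : ℂ :=
  if i ≤ j then polyCoeffUpper n N lam mu i j else polyCoeffUpper n N mu lam j i

/-- The exceptional set `{m - n/2 | m ∈ ℕ}`. -/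
def exceptional (n : ℕ) : Set ℂ := {z | ∃ m : ℕ, z = m - (n : ℂ) / 2}

end ConformalBilinear

end

/-!
An invariant bilinear differential operator is the same thing as an invariant symbol, a polynomial
`P(ξ, η)` in two covectors. Indeed such an operator is determined by its value at the base point,
which factors through the jets of the two sections there and so has the form
`P(∂_x, ∂_y) f(x) h(y)` at `x = y = 0` (`exists_symbol_of_isConformallyInvariant`). By equivariance
the value at any `g` is obtained in the same way from the translated functions
`x ↦ f(g exp x)`, `y ↦ h(g exp y)`. Conversely, this formula defines a section for all `f` and `h`
as soon as the result transforms correctly under the right action of `P = M A N`: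

* under `A` and `M` this says that `P` is homogeneous of degree `2 N` and invariant under
  rotations;
* `N` acts on functions on `ℝⁿ` by quadratic vector fields plus multiplication operators. The
  transpose of this action is a second order differential operator in `ξ` and `η`, here `nilOp₂`
  (`symOp_confOp`, `hasDerivAt_symOp_nu`), and `P` has to be annihilated by it.

These conditions suffice by `symOp_section`. They are necessary
(`isInvariantSymbol_of_isConformallyInvariant`) because a differential operator that kills all
products of sections is zero: products of exponentials, cut off, detect every coefficient
(`symbol_eq_zero_of_forall_sections`).

On a symbol `∑ a_{i,j} |ξ|^{2i} |η|^{2j} (ξ·η)^{N-i-j}` the condition under `N` is a pair of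
recursions for the `a_{i,j}`, collected in `IsSol` (`nilOp₂_symbol`, `isSol_of_nilOp₂_eq_zero`).
The relation of the first family at `(i, j)` gives `a_{i+1,j}`, that of the second one gives
`a_{i,j+1}`. Where the common denominator does not vanish, a solution is therefore determined by
`a_{0,0}`. For generic parameters, defining `a_{0,j}` by the second family and all other
coefficients by the first one gives a solution. Since `𝔫` is abelian, the two families are
compatible, and the second one propagates from `i = 0` to all `i` (`defect_compat`). A
contiguity relation for the sum over `k` (`coeffSum_succ`) identifies this solution with the
explicit formula for `i ≤ j`; symmetry under exchange of `(λ, i)` and `(μ, j)` follows from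
uniqueness. After multiplication with the common denominator the coefficients are polynomials in
the parameters, so they satisfy the recursions for all parameters, by density
(`polyCoeff_isSol`). Nonzero solutions exist for all parameters as limits of normalized generic
ones (`exists_isSol_ne_zero`).

For uniqueness with `n ≥ 3`, every rotation invariant polynomial in two vectors is a polynomial in
the three scalar products (`IsInvariantSymbol.exists_eq_symbol`), so that the recursions apply. For
`n = 2` the determinant of `ξ` and `η` is a further invariant. There the coordinates `ξ₁ ± i ξ₂`
split the condition under `𝔫` into two independent ones (`nilOp_nullSubst`), which, for
`λ` not a natural number, determine all coefficients of an invariant symbol by a single one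
(`IsInvariantSymbol.eq_zero_of_coeff`). Finally, for `λ = μ = 1 - n/2` both `Δ_x` and `Δ_y` are
invariant, and uniqueness fails (`exists_linearIndependent`).
-/

noncomputable section

namespace ConformalBilinear

/-! ### The finite sums in the explicit coefficients -/

theorem poch_succ_right (x : ℂ) (l : ℕ) : poch x (l + 1) = poch x l * (x + l) := by
  simp [poch, Finset.prod_range_succ]

theorem poch_succ_left (x : ℂ) (l : ℕ) : poch x (l + 1) = x * poch (x + 1) l := by
  simp only [poch, Finset.prod_range_succ']
  rw [mul_comm]
  congr 1
  · simp
  · exact Finset.prod_congr rfl fun k _ => by push_cast; ring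

@[simp] theorem poch_zero (x : ℂ) : poch x 0 = 1 := by simp [poch]

/-- The coefficient of the falling factorial `j (j-1) ⋯ (j-p+1)` in `coeffSum n N lam mu i j`. -/
def coeffSumCoord (n N : ℕ) (lam mu : ℂ) (i p : ℕ) : ℂ :=
  (i.choose p : ℂ) * poch (lam + n / 2 - i) p *
    ((-1) ^ (i - p) * poch (mu - N + 1) (i - p) * poch (lam - N + 1 - (i - p : ℕ)) (i - p))

theorem coeffSum_eq (n N : ℕ) (lam mu : ℂ) (i j : ℕ) :
    coeffSum n N lam mu i j =
      ∑ p ∈ Finset.range (i + 1), coeffSumCoord n N lam mu i p * poch ((j : ℂ) - p + 1) p := by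
  rw [coeffSum, ← Finset.sum_range_reflect]
  refine Finset.sum_congr rfl fun p hp => ?_
  have hp' : p ≤ i := Nat.lt_succ_iff.mp (Finset.mem_range.mp hp)
  have e1 : i + 1 - 1 - p = i - p := by omega
  have e2 : i - (i - p) = p := by omega
  have e3 : (j : ℂ) - i + 1 + ((i - p : ℕ) : ℂ) = j - p + 1 := by
    rw [Nat.cast_sub hp']; ring
  rw [e1, e2, e3, Nat.choose_symm hp', coeffSumCoord]
  ring

theorem coeffSumCoord_succ_zero (n N : ℕ) (lam mu : ℂ) (i : ℕ) :
    coeffSumCoord n N lam mu (i + 1) 0 =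
      (lam - N - i) * (N - 1 - mu - i) * coeffSumCoord n N lam mu i 0 := by
  simp only [coeffSumCoord, Nat.sub_zero, poch_succ_right (mu - N + 1),
    poch_succ_left (lam - N + 1 - ((i + 1 : ℕ) : ℂ)), pow_succ]
  rw [show lam - (N : ℂ) + 1 - ((i + 1 : ℕ) : ℂ) + 1 = lam - N + 1 - i by push_cast; ring]
  simp
  ring

theorem coeffSumCoord_succ_succ (n N : ℕ) (lam mu : ℂ) (i p : ℕ) (hp : p ≤ i) :
    coeffSumCoord n N lam mu (i + 1) (p + 1) =
      (lam - N - i + (p + 1)) * (N - 1 - mu - i + (p + 1)) * coeffSumCoord n N lam mu i (p + 1) +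
      (lam + n / 2 - 1 - 2 * i + p) * coeffSumCoord n N lam mu i p := by
  rcases hp.eq_or_lt with rfl | hp
  · simp only [coeffSumCoord, Nat.choose_self, Nat.choose_succ_self, Nat.sub_self, poch_zero,
      poch_succ_left (lam + n / 2 - ((p + 1 : ℕ) : ℂ))]
    rw [show lam + (n : ℂ) / 2 - ((p + 1 : ℕ) : ℂ) + 1 = lam + n / 2 - p by push_cast; ring]
    push_cast
    ring
  · obtain ⟨q, rfl⟩ : ∃ q, i = p + 1 + q := ⟨i - (p + 1), by omega⟩
    have e1 : p + 1 + q + 1 - (p + 1) = q + 1 := by omega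
    have e2 : p + 1 + q - (p + 1) = q := by omega
    have e3 : p + 1 + q - p = q + 1 := by omega
    -- all Pochhammer symbols are reduced to the common factors of the three terms
    have h1 : poch (lam + n / 2 - ((p + 1 + q + 1 : ℕ) : ℂ)) (p + 1) =
        (lam + n / 2 - (p + 1 + q + 1)) * poch (lam + n / 2 - (p + 1 + q)) p := by
      rw [poch_succ_left]; push_cast
      rw [show lam + (n : ℂ) / 2 - (p + 1 + q + 1) + 1 = lam + n / 2 - (p + 1 + q) by ring]
    have h2 : poch (lam + n / 2 - ((p + 1 + q : ℕ) : ℂ)) (p + 1) =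
        (lam + n / 2 - 1 - q) * poch (lam + n / 2 - (p + 1 + q)) p := by
      rw [poch_succ_right]; push_cast; ring
    have h3 : poch (lam - N + 1 - ((q + 1 : ℕ) : ℂ)) (q + 1) =
        (lam - N - q) * poch (lam - N + 1 - q) q := by
      rw [poch_succ_left]; push_cast
      rw [show lam - (N : ℂ) + 1 - (q + 1) + 1 = lam - N + 1 - q by ring]
      ring
    have h4 := Nat.choose_succ_succ (p + 1 + q) p
    have h5 : ((p + 1 + q).choose (p + 1) : ℂ) * (p + 1) = (p + 1 + q).choose p * (q + 1) := by
      have := Nat.choose_succ_right_eq (p + 1 + q) p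
      rw [e3] at this
      exact_mod_cast this
    simp only [coeffSumCoord, e1, e2, e3, h1, h2, h3, h4, poch_succ_right (mu - N + 1), pow_succ]
    push_cast
    linear_combination (-(lam - N - q) * (mu - N + 1 + q) * poch (lam + n / 2 - (p + 1 + q)) p *
      ((-1) ^ q * poch (mu - N + 1) q * poch (lam - N + 1 - q) q)) * (-1) * h5

/-- The recursion in `i` for the sum over `k` in the coefficients. -/
theorem coeffSum_succ (n N : ℕ) (lam mu : ℂ) (i j : ℕ) :
    coeffSum n N lam mu (i + 1) (j + 1) =
      (lam - N - i + (j + 1)) * (N - 1 - mu - i + (j + 1)) * coeffSum n N lam mu i (j + 1) -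
      (j + 1) * (j + 1 - n / 2 - mu) * coeffSum n N lam mu i j := by
  simp only [coeffSum_eq]
  set c := coeffSumCoord n N lam mu with hc
  have key : ∀ p : ℕ, (lam - N - i + (j + 1)) * (N - 1 - mu - i + (j + 1)) *
        (c i p * poch (((j + 1 : ℕ) : ℂ) - p + 1) p) -
      (j + 1) * (j + 1 - n / 2 - mu) * (c i p * poch ((j : ℂ) - p + 1) p) =
      (lam - N - i + p) * (N - 1 - mu - i + p) * (c i p * poch (((j + 1 : ℕ) : ℂ) - p + 1) p) +
      (lam + n / 2 - 1 - 2 * i + p) *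
        (c i p * poch (((j + 1 : ℕ) : ℂ) - ((p + 1 : ℕ) : ℂ) + 1) (p + 1)) := by
    intro p
    have h1 : poch (((j + 1 : ℕ) : ℂ) - ((p + 1 : ℕ) : ℂ) + 1) (p + 1) =
        (j + 1 - p) * poch (((j + 1 : ℕ) : ℂ) - p + 1) p := by
      rw [poch_succ_left]; push_cast
      rw [show (j : ℂ) + 1 - (p + 1) + 1 + 1 = j + 1 - p + 1 by ring]
      ring
    have h2 : (j + 1) * poch ((j : ℂ) - p + 1) p =
        (j + 1 - p) * poch (((j + 1 : ℕ) : ℂ) - p + 1) p := by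
      rw [← h1, poch_succ_right]; push_cast
      rw [show (j : ℂ) + 1 - (p + 1) + 1 = j - p + 1 by ring]
      ring
    rw [h1]
    linear_combination (-(j + 1 - n / 2 - mu) * c i p) * h2
  have hR : (lam - N - i + (j + 1)) * (N - 1 - mu - i + (j + 1)) *
        (∑ p ∈ Finset.range (i + 1), c i p * poch (((j + 1 : ℕ) : ℂ) - p + 1) p) -
      (j + 1) * (j + 1 - n / 2 - mu) *
        (∑ p ∈ Finset.range (i + 1), c i p * poch ((j : ℂ) - p + 1) p) =
      ∑ p ∈ Finset.range (i + 1), (lam - N - i + p) * (N - 1 - mu - i + p) *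
        (c i p * poch (((j + 1 : ℕ) : ℂ) - p + 1) p) +
      ∑ p ∈ Finset.range (i + 1), (lam + n / 2 - 1 - 2 * i + p) *
        (c i p * poch (((j + 1 : ℕ) : ℂ) - ((p + 1 : ℕ) : ℂ) + 1) (p + 1)) := by
    rw [Finset.mul_sum, Finset.mul_sum, ← Finset.sum_sub_distrib, ← Finset.sum_add_distrib]
    exact Finset.sum_congr rfl fun p _ => key p
  have hz : c i (i + 1) = 0 := by simp [hc, coeffSumCoord]
  have hL : ∑ p ∈ Finset.range (i + 1), (lam - N - i + p) * (N - 1 - mu - i + p) *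
        (c i p * poch (((j + 1 : ℕ) : ℂ) - p + 1) p) =
      ∑ p ∈ Finset.range (i + 1 + 1), (lam - N - i + p) * (N - 1 - mu - i + p) *
        (c i p * poch (((j + 1 : ℕ) : ℂ) - p + 1) p) := by
    rw [Finset.sum_range_succ _ (i + 1), hz]
    ring
  rw [hR, hL, Finset.sum_range_succ', Finset.sum_range_succ' _ (i + 1), add_right_comm,
    ← Finset.sum_add_distrib]
  congr 1
  · refine Finset.sum_congr rfl fun p hp => ?_
    rw [hc, coeffSumCoord_succ_succ _ _ _ _ _ _ (Nat.lt_succ_iff.mp (Finset.mem_range.mp hp))]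
    push_cast
    ring
  · rw [hc, coeffSumCoord_succ_zero]
    push_cast
    simp

/-! ### The recursion for the coefficients -/

/-- The shifted sequence `0, b 0, b 1, …`. -/
def shiftSeq (b : ℕ → ℂ) : ℕ → ℂ
  | 0 => 0
  | j + 1 => b j

@[simp] theorem shiftSeq_zero (b : ℕ → ℂ) : shiftSeq b 0 = 0 := rfl

@[simp] theorem shiftSeq_succ (b : ℕ → ℂ) (j : ℕ) : shiftSeq b (j + 1) = b j := rfl

/-- The coefficient of `ξ_k |ξ|^{2i} |η|^{2j} (ξ·η)^{N-1-i-j}` in the image of the symbol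
`∑ a_{i,j} |ξ|^{2i} |η|^{2j} (ξ·η)^{N-i-j}` under the `k`-th generator of `𝔫`. The coefficient with
`η_k` in place of `ξ_k` is obtained by exchanging the roles of `ξ, λ, i` and `η, μ, j`. -/
def defect (n N : ℕ) (lam mu : ℂ) (a : ℕ → ℕ → ℂ) (i j : ℕ) : ℂ :=
  (i + 1) * (2 * i + 2 - 2 * lam - n) * a (i + 1) j +
    (N - i - j) * (N - 1 - i + j - mu) * a i j -
    1 / 2 * (N - i - j + 1) * (N - i - j) * shiftSeq (a i) j

/-- The recursion relations expressing that the bilinear operator with coefficients `a` is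
invariant. -/
structure IsSol (n N : ℕ) (lam mu : ℂ) (a : ℕ → ℕ → ℂ) : Prop where
  left : ∀ i j, i + j < N → defect n N lam mu a i j = 0
  right : ∀ i j, i + j < N → defect n N mu lam (fun i j => a j i) j i = 0

theorem IsSol.swap {n N : ℕ} {lam mu : ℂ} {a : ℕ → ℕ → ℂ} (h : IsSol n N lam mu a) :
    IsSol n N mu lam fun i j => a j i :=
  ⟨fun i j hij => h.right j i (by omega), fun i j hij => h.left j i (by omega)⟩

theorem defect_congr {n N : ℕ} {lam mu : ℂ} {a b : ℕ → ℕ → ℂ} {i j : ℕ}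
    (h : ∀ i j, i + j ≤ N → a i j = b i j) (hij : i + j < N) :
    defect n N lam mu a i j = defect n N lam mu b i j := by
  have h3 : shiftSeq (a i) j = shiftSeq (b i) j := by
    cases j with
    | zero => rfl
    | succ j => exact h i j (by omega)
  rw [defect, defect, h (i + 1) j (by omega), h i j (by omega), h3]

theorem IsSol.congr {n N : ℕ} {lam mu : ℂ} {a b : ℕ → ℕ → ℂ} (ha : IsSol n N lam mu a)
    (h : ∀ i j, i + j ≤ N → a i j = b i j) : IsSol n N lam mu b :=
  ⟨fun i j hij => by rw [← ha.left i j hij, defect_congr h hij],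
    fun i j hij => by
      rw [← ha.right i j hij]
      exact (defect_congr (fun i j hij => h j i (by omega)) (by omega)).symm⟩

theorem defect_linear {n N : ℕ} {lam mu : ℂ} (a b : ℕ → ℕ → ℂ) (c : ℂ) (i j : ℕ) :
    defect n N lam mu (fun i j => a i j + c * b i j) i j =
      defect n N lam mu a i j + c * defect n N lam mu b i j := by
  cases j <;> simp [defect] <;> ring

theorem IsSol.add_mul {n N : ℕ} {lam mu : ℂ} {a b : ℕ → ℕ → ℂ} (ha : IsSol n N lam mu a)
    (hb : IsSol n N lam mu b) (c : ℂ) : IsSol n N lam mu fun i j => a i j + c * b i j :=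
  ⟨fun i j hij => by rw [defect_linear, ha.left i j hij, hb.left i j hij]; ring,
    fun i j hij => by
      have := defect_linear (n := n) (N := N) (lam := mu) (mu := lam)
        (fun i j => a j i) (fun i j => b j i) c j i
      rw [this, ha.right i j hij, hb.right i j hij]; ring⟩

theorem isSol_zero (n N : ℕ) (lam mu : ℂ) : IsSol n N lam mu fun _ _ => 0 := by
  constructor <;> intro i j _ <;> cases j <;> cases i <;> simp [defect]

theorem IsSol.const_mul {n N : ℕ} {lam mu : ℂ} {a : ℕ → ℕ → ℂ} (ha : IsSol n N lam mu a)
    (c : ℂ) : IsSol n N lam mu fun i j => c * a i j := by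
  simpa using (isSol_zero n N lam mu).add_mul ha c

/-- Away from the zeros of the denominators the recursion determines all coefficients from the one
with index `(0,0)`. -/
theorem IsSol.eq_zero {n N : ℕ} {lam mu : ℂ} {a : ℕ → ℕ → ℂ} (ha : IsSol n N lam mu a)
    (hl : ∀ i : ℕ, i < N → 2 * (i : ℂ) + 2 - 2 * lam - n ≠ 0)
    (hm : ∀ i : ℕ, i < N → 2 * (i : ℂ) + 2 - 2 * mu - n ≠ 0) (h0 : a 0 0 = 0) :
    ∀ i j, i + j ≤ N → a i j = 0 := by
  have row : ∀ j, j ≤ N → a 0 j = 0 := by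
    intro j
    induction j with
    | zero => exact fun _ => h0
    | succ j ih =>
      intro hj
      have h := ha.right 0 j (by omega)
      simp only [defect, shiftSeq_zero, ih (by omega), mul_zero, sub_zero, add_zero] at h
      rcases mul_eq_zero.mp h with h | h
      · rcases mul_eq_zero.mp h with h | h
        · exact absurd h (Nat.cast_add_one_ne_zero j)
        · exact absurd h (hm j (by omega))
      · exact h
  intro i
  induction i with
  | zero => exact fun j hj => row j (by omega)
  | succ i ih =>
    intro j hj
    have h := ha.left i j (by omega)
    have h3 : shiftSeq (a i) j = 0 := by
      cases j with
      | zero => rfl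
      | succ j => exact ih j (by omega)
    simp only [defect, h3, ih j (by omega), mul_zero, sub_zero, add_zero] at h
    rcases mul_eq_zero.mp h with h | h
    · rcases mul_eq_zero.mp h with h | h
      · exact absurd h (Nat.cast_add_one_ne_zero i)
      · exact absurd h (hl i (by omega))
    · exact h

theorem factor_ne_zero {n N : ℕ} {lam mu : ℂ} (h : commonDenom n N lam mu ≠ 0) {m : ℕ}
    (h1 : 1 ≤ m) (h2 : m ≤ N) :
    lam + (n : ℂ) / 2 - m ≠ 0 ∧ (m : ℂ) - (n : ℂ) / 2 - mu ≠ 0 :=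
  mul_ne_zero_iff.mp (Finset.prod_ne_zero_iff.mp h m (Finset.mem_Icc.mpr ⟨h1, h2⟩))

theorem IsSol.eq_zero_of_commonDenom {n N : ℕ} {lam mu : ℂ} {a : ℕ → ℕ → ℂ}
    (ha : IsSol n N lam mu a) (h : commonDenom n N lam mu ≠ 0) (h0 : a 0 0 = 0) :
    ∀ i j, i + j ≤ N → a i j = 0 := by
  refine ha.eq_zero (fun i hi hc => ?_) (fun i hi hc => ?_) h0
  · refine (factor_ne_zero h (m := i + 1) (by omega) (by omega)).1 ?_
    push_cast
    linear_combination -(1 / 2) * hc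
  · refine (factor_ne_zero h (m := i + 1) (by omega) (by omega)).2 ?_
    push_cast
    linear_combination (1 / 2) * hc

/-! ### Solution of the recursion for generic parameters -/

/-- The solution of the recursion for generic parameters, normalized to be `1` at `(0,0)`. -/
def genericSol (n N : ℕ) (lam mu : ℂ) : ℕ → ℕ → ℂ
  | 0 => coeffUpper n N lam mu 0
  | i + 1 => fun j =>
      (1 / 2 * (N - i - j + 1) * (N - i - j) * shiftSeq (genericSol n N lam mu i) j -
        (N - i - j) * (N - 1 - i + j - mu) * genericSol n N lam mu i j) /
      ((i + 1) * (2 * i + 2 - 2 * lam - n))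

theorem poch_ne_zero {x : ℂ} {l : ℕ} (h : ∀ m < l, x + (m : ℂ) ≠ 0) : poch x l ≠ 0 :=
  Finset.prod_ne_zero_iff.mpr fun m hm => h m (Finset.mem_range.mp hm)

theorem coeffUpper_zero_succ (n N : ℕ) (lam mu : ℂ) (j : ℕ)
    (hm : ∀ m : ℕ, (m : ℂ) + 1 - n / 2 - mu ≠ 0) :
    (j + 1) * (2 * j + 2 - 2 * mu - n) * coeffUpper n N lam mu 0 (j + 1) +
      (N - j) * (N - 1 - j - lam) * coeffUpper n N lam mu 0 j = 0 := by
  have hs : ∀ j, coeffSum n N lam mu 0 j = 1 := fun j => by simp [coeffSum]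
  have h1 : poch (1 - (n : ℂ) / 2 - mu) j ≠ 0 := poch_ne_zero fun m _ => by
    have := hm m
    intro h
    exact this (by linear_combination h)
  have h2 := hm j
  have h2' : 1 - (n : ℂ) / 2 - mu + j ≠ 0 := fun h => h2 (by linear_combination h)
  have h3 : (j.factorial : ℂ) ≠ 0 := Nat.cast_ne_zero.mpr j.factorial_ne_zero
  have h4 : ((j : ℂ) + 1) ≠ 0 := Nat.cast_add_one_ne_zero j
  have h5 : ((-1 : ℂ)) ^ j ≠ 0 := pow_ne_zero _ (by norm_num)
  simp only [coeffUpper, hs, zero_add, Nat.sub_zero, poch_succ_right, Nat.factorial_succ, pow_succ,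
    poch_zero]
  have h6 : (2 * j + 2 - 2 * mu - n : ℂ) ≠ 0 := fun h => h2' (by linear_combination (1 / 2) * h)
  rw [show (1 - (n : ℂ) / 2 - mu + j) = (2 * j + 2 - 2 * mu - n) / 2 by ring]
  generalize poch (1 - (n : ℂ) / 2 - mu) j = u at *
  generalize (2 * j + 2 - 2 * mu - n : ℂ) = w at *
  push_cast
  field_simp
  ring

/-- The explicit coefficients above the diagonal satisfy the first recursion: this is
`coeffSum_succ`, up to the prefactors. -/
theorem coeffUpper_rel (n N : ℕ) (lam mu : ℂ) (i j : ℕ) (hij : i ≤ j)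
    (hl : ∀ m : ℕ, lam + (n : ℂ) / 2 - (m + 1) ≠ 0)
    (hm : ∀ m : ℕ, (m : ℂ) + 1 - n / 2 - mu ≠ 0) :
    (i + 1) * (2 * i + 2 - 2 * lam - n) * coeffUpper n N lam mu (i + 1) (j + 1) +
      (N - i - (j + 1)) * (N - 1 - i + (j + 1) - mu) * coeffUpper n N lam mu i (j + 1) -
      1 / 2 * (N - i - (j + 1) + 1) * (N - i - (j + 1)) * coeffUpper n N lam mu i j = 0 := by
  obtain ⟨d, rfl⟩ : ∃ d, j = i + d := ⟨j - i, by omega⟩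
  have h1 : poch (1 - (n : ℂ) / 2 - mu) (i + d) ≠ 0 := poch_ne_zero fun m _ h =>
    hm m (by linear_combination h)
  have h2 : 1 - (n : ℂ) / 2 - mu + ((i + d : ℕ) : ℂ) ≠ 0 := fun h =>
    hm (i + d) (by push_cast at h ⊢; linear_combination h)
  have h3 : ((i + d).factorial : ℂ) ≠ 0 := Nat.cast_ne_zero.mpr (i + d).factorial_ne_zero
  have h3' : (i.factorial : ℂ) ≠ 0 := Nat.cast_ne_zero.mpr i.factorial_ne_zero
  have h4 : ((i : ℂ) + d + 1) ≠ 0 := by exact_mod_cast Nat.succ_ne_zero (i + d)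
  have h4' : ((i : ℂ) + 1) ≠ 0 := Nat.cast_add_one_ne_zero i
  have h6 : poch (lam + (n : ℂ) / 2 - i) i ≠ 0 := poch_ne_zero fun m hm' h => by
    refine hl (i - m - 1) ?_
    have : ((i - m - 1 : ℕ) : ℂ) = i - m - 1 := by
      rw [Nat.sub_sub, Nat.cast_sub (by omega)]; push_cast; ring
    rw [this]
    linear_combination h
  have h7 := hl i
  have e1 : i + d + 1 - (i + 1) = d := by omega
  have e2 : i + d + 1 - i = d + 1 := by omega
  have e3 : i + d - i = d := by omega
  have e4 : i + 1 + (i + d + 1) = i + (i + d) + 1 + 1 := by omega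
  have e5 : i + (i + d + 1) = i + (i + d) + 1 := by omega
  have h8 : poch (lam + (n : ℂ) / 2 - ((i + 1 : ℕ) : ℂ)) (i + 1) =
      (lam + n / 2 - (i + 1)) * poch (lam + (n : ℂ) / 2 - i) i := by
    rw [poch_succ_left]; push_cast
    rw [show lam + (n : ℂ) / 2 - (i + 1) + 1 = lam + n / 2 - i by ring]
  have hk : (2 * i + 2 - 2 * lam - n : ℂ) = -2 * (lam + n / 2 - (i + 1)) := by ring
  simp only [coeffUpper, e1, e2, e3, e4, e5, h8, coeffSum_succ, poch_succ_right,
    Nat.factorial_succ, pow_succ, hk]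
  set u := poch (1 - (n : ℂ) / 2 - mu) (i + d)
  set v := poch (lam + (n : ℂ) / 2 - i) i
  set w := lam + (n : ℂ) / 2 - (i + 1) with hw
  set S := coeffSum n N lam mu i (i + d + 1)
  set T := coeffSum n N lam mu i (i + d)
  set q := poch (-(N : ℂ)) (i + (i + d))
  set r := poch (1 - (N : ℂ) + lam) d
  have h5 : ((-1 : ℂ)) ^ (i + (i + d)) ≠ 0 := pow_ne_zero _ (by norm_num)
  push_cast at h2 ⊢
  have h2'' : (2 : ℂ) - n - 2 * mu + 2 * (i + d) ≠ 0 := fun h =>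
    h2 (by linear_combination (1 / 2) * h)
  have h2' : (1 - (n : ℂ) / 2 - mu + (i + d)) = (2 - n - 2 * mu + 2 * (i + d)) / 2 := by ring
  rw [h2']
  clear_value u v w S T q r
  field_simp
  ring

/-- Parameters `z` such that `2 z` is not an integer; none of the linear factors that occur in the
recursion vanishes there. -/
def genericSet : Set ℂ := {z | ∀ k : ℤ, 2 * z ≠ k}

theorem genericSet_left {n : ℕ} {lam : ℂ} (h : lam ∈ genericSet) (i : ℕ) :
    2 * (i : ℂ) + 2 - 2 * lam - n ≠ 0 := fun hc =>
  h (2 * i + 2 - n) (by push_cast; linear_combination -hc)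

theorem genericSet_commonDenom {n N : ℕ} {lam mu : ℂ} (hl : lam ∈ genericSet)
    (hm : mu ∈ genericSet) : commonDenom n N lam mu ≠ 0 := by
  refine Finset.prod_ne_zero_iff.mpr fun m _ => mul_ne_zero (fun hc => ?_) fun hc => ?_
  · exact hl (2 * m - n) (by push_cast; linear_combination 2 * hc)
  · exact hm (2 * m - n) (by push_cast; linear_combination -2 * hc)

theorem genericSol_left {n N : ℕ} {lam mu : ℂ} (hl : lam ∈ genericSet) (i j : ℕ) :
    defect n N lam mu (genericSol n N lam mu) i j = 0 := by
  have h1 := genericSet_left (n := n) hl i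
  have h2 : (i : ℂ) + 1 ≠ 0 := Nat.cast_add_one_ne_zero i
  rw [defect]
  conv_lhs => enter [1, 1, 2]; rw [genericSol]
  rw [mul_div_cancel₀ _ (mul_ne_zero h2 h1)]
  ring

/-- The two families of recursion relations are compatible: if the first family holds, then the
defects of the second one satisfy a recursion of the same kind. This reflects that `𝔫` is
abelian. -/
theorem defect_compat {n N : ℕ} {lam mu : ℂ} {a : ℕ → ℕ → ℂ}
    (h : ∀ i j, defect n N lam mu a i j = 0) (i j : ℕ) :
    (i + 1) * (2 * i + 2 - 2 * lam - n) * defect n N mu lam (fun i j => a j i) j (i + 1) =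
      -(N - i - j - 1) * (N - i + j - mu) * defect n N mu lam (fun i j => a j i) j i +
      1 / 2 * (N - i - j - 1) * (N - i - j) *
        shiftSeq (fun j => defect n N mu lam (fun i j => a j i) j i) j := by
  have h1 := h i (j + 1)
  have h2 := h i j
  rcases i with _ | i <;> rcases j with _ | j <;>
    simp only [defect, shiftSeq_zero, shiftSeq_succ] at h1 h2 ⊢ <;> push_cast at h1 h2 ⊢
  · linear_combination (2 - 2 * mu - n) * h1 + (N - 1) * (N - lam) * h2
  · linear_combination (j + 2) * (2 * (j + 1) + 2 - 2 * mu - n) * h1 +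
      (N - 2 - j) * (N - j - 1 - lam) * h2
  · have h3 := h i 0
    simp only [defect, shiftSeq_zero] at h3
    push_cast at h3
    linear_combination (2 - 2 * mu - n) * h1 + (N - 2 - i) * (N + i + 1 - lam) * h2 -
      1 / 2 * (N - i - 2) * (N - i - 1) * h3
  · have h3 := h i (j + 1)
    simp only [defect, shiftSeq_succ] at h3
    push_cast at h3
    linear_combination (j + 2) * (2 * (j + 1) + 2 - 2 * mu - n) * h1 +
      (N - 3 - j - i) * (N - j + i - lam) * h2 -
      1 / 2 * (N - i - j - 3) * (N - i - j - 2) * h3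

theorem genericSol_isSol {n N : ℕ} {lam mu : ℂ} (hl : lam ∈ genericSet) (hm : mu ∈ genericSet) :
    IsSol n N lam mu (genericSol n N lam mu) := by
  suffices H : ∀ i j, defect n N mu lam (fun i j => genericSol n N lam mu j i) j i = 0 from
    ⟨fun i j _ => genericSol_left hl i j, fun i j _ => H i j⟩
  intro i
  induction i with
  | zero =>
    intro j
    have := coeffUpper_zero_succ n N lam mu j fun m hc =>
      genericSet_left (n := n) hm m (by linear_combination 2 * hc)
    simp only [defect, genericSol, shiftSeq_zero]
    push_cast
    linear_combination this
  | succ i ih =>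
    intro j
    have h := defect_compat (n := n) (N := N) (lam := lam) (mu := mu) (genericSol_left hl) i j
    have h3 : shiftSeq (fun j =>
        defect n N mu lam (fun i j => genericSol n N lam mu j i) j i) j = 0 := by
      cases j with
      | zero => rfl
      | succ j => exact ih j
    rw [ih j, h3, mul_zero, mul_zero, add_zero] at h
    exact (mul_eq_zero.mp h).resolve_left
      (mul_ne_zero (Nat.cast_add_one_ne_zero i) (genericSet_left hl i))

theorem coeffUpper_zero_zero (n N : ℕ) (lam mu : ℂ) : coeffUpper n N lam mu 0 0 = 1 := by
  simp [coeffUpper, coeffSum]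

theorem genericSol_swap {n N : ℕ} {lam mu : ℂ} (hl : lam ∈ genericSet) (hm : mu ∈ genericSet)
    (i j : ℕ) (hij : i + j ≤ N) : genericSol n N lam mu i j = genericSol n N mu lam j i := by
  have h := ((genericSol_isSol (n := n) (N := N) hl hm).add_mul
    (genericSol_isSol hm hl).swap (-1)).eq_zero_of_commonDenom (genericSet_commonDenom hl hm)
    (by simp [genericSol, coeffUpper_zero_zero]) i j hij
  linear_combination h

/-- Both sides satisfy the first recursion, which expresses row `i + 1` through row `i`; in the
region `i ≤ j` it never leaves that region. -/
theorem genericSol_eq_coeffUpper {n N : ℕ} {lam mu : ℂ} (hl : lam ∈ genericSet)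
    (hm : mu ∈ genericSet) (i j : ℕ) (hij : i ≤ j) :
    genericSol n N lam mu i j = coeffUpper n N lam mu i j := by
  induction i generalizing j with
  | zero => rfl
  | succ i ih =>
    obtain ⟨j, rfl⟩ : ∃ k, j = k + 1 := ⟨j - 1, by omega⟩
    have h := genericSol_left (n := n) (N := N) (mu := mu) hl i (j + 1)
    have h' := coeffUpper_rel n N lam mu i j (by omega)
      (fun m hc => genericSet_left (n := n) hl m (by linear_combination -2 * hc))
      (fun m hc => genericSet_left (n := n) hm m (by linear_combination 2 * hc))
    rw [defect, shiftSeq_succ, ih _ (by omega), ih _ (by omega)] at h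
    push_cast at h
    refine mul_left_cancel₀
      (mul_ne_zero (Nat.cast_add_one_ne_zero i) (genericSet_left (n := n) hl i)) ?_
    linear_combination h - h'

theorem coeff_isSol_of_generic {n N : ℕ} {lam mu : ℂ} (hl : lam ∈ genericSet)
    (hm : mu ∈ genericSet) : IsSol n N lam mu (coeff n N lam mu) := by
  refine (genericSol_isSol hl hm).congr fun i j hij => ?_
  rw [coeff]
  split_ifs with h
  · exact genericSol_eq_coeffUpper hl hm i j h
  · rw [genericSol_swap hl hm i j hij, genericSol_eq_coeffUpper hm hl j i (by omega)]

/-! ### The explicit coefficients for arbitrary parameters -/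

theorem poch_eq_prod_sub (c : ℂ) (i : ℕ) :
    poch (c - i) i = ∏ m ∈ Finset.Icc 1 i, (c - m) := by
  induction i with
  | zero => simp
  | succ i ih =>
    rw [poch_succ_left, Finset.prod_Icc_succ_top (by omega), ← ih]
    push_cast
    rw [show c - (i + 1) + 1 = c - i by ring, mul_comm]

theorem poch_eq_prod_add (c : ℂ) (j : ℕ) :
    poch (1 - c) j = ∏ m ∈ Finset.Icc 1 j, ((m : ℂ) - c) := by
  induction j with
  | zero => simp
  | succ j ih =>
    rw [poch_succ_right, Finset.prod_Icc_succ_top (by omega), ← ih]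
    push_cast
    ring

theorem prod_Icc_split {f : ℕ → ℂ} {i N : ℕ} (h : i ≤ N) :
    (∏ m ∈ Finset.Icc 1 i, f m) * ∏ m ∈ Finset.Icc (i + 1) N, f m = ∏ m ∈ Finset.Icc 1 N, f m := by
  have e : ∀ a b : ℕ, Finset.Icc a b = Finset.Ico a (b + 1) := fun a b => by ext; simp
  rw [e, e, e]
  exact Finset.prod_Ico_consecutive f (by omega) (by omega)

theorem commonDenom_swap (n N : ℕ) (lam mu : ℂ) :
    commonDenom n N mu lam = commonDenom n N lam mu :=
  Finset.prod_congr rfl fun m _ => by ring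

theorem polyCoeffUpper_eq {n N : ℕ} {lam mu : ℂ} (h : commonDenom n N lam mu ≠ 0) {i j : ℕ}
    (hi : i ≤ N) (hj : j ≤ N) :
    polyCoeffUpper n N lam mu i j = commonDenom n N lam mu * coeffUpper n N lam mu i j := by
  have h1 := prod_Icc_split (f := fun m => lam + (n : ℂ) / 2 - m) hi
  have h2 := prod_Icc_split (f := fun m => (m : ℂ) - (n : ℂ) / 2 - mu) hj
  have h3 : poch (lam + (n : ℂ) / 2 - i) i ≠ 0 := by
    rw [poch_eq_prod_sub]
    refine Finset.prod_ne_zero_iff.mpr fun m hm => ?_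
    rw [Finset.mem_Icc] at hm
    exact (factor_ne_zero h hm.1 (hm.2.trans hi)).1
  have h4 : poch (1 - (n : ℂ) / 2 - mu) j ≠ 0 := by
    rw [sub_sub, poch_eq_prod_add]
    refine Finset.prod_ne_zero_iff.mpr fun m hm => ?_
    rw [Finset.mem_Icc] at hm
    rw [← sub_sub]
    exact (factor_ne_zero h hm.1 (hm.2.trans hj)).2
  have h5 : poch (1 - (n : ℂ) / 2 - mu) j = ∏ m ∈ Finset.Icc 1 j, ((m : ℂ) - (n : ℂ) / 2 - mu) := by
    rw [sub_sub, poch_eq_prod_add]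
    simp only [sub_sub]
  have hD : commonDenom n N lam mu =
      (poch (lam + (n : ℂ) / 2 - i) i * ∏ m ∈ Finset.Icc (i + 1) N, (lam + (n : ℂ) / 2 - m)) *
      (poch (1 - (n : ℂ) / 2 - mu) j *
        ∏ m ∈ Finset.Icc (j + 1) N, ((m : ℂ) - (n : ℂ) / 2 - mu)) := by
    rw [poch_eq_prod_sub, h5, h1, h2, commonDenom, Finset.prod_mul_distrib]
  have h6 : (i.factorial : ℂ) ≠ 0 := Nat.cast_ne_zero.mpr i.factorial_ne_zero
  have h7 : (j.factorial : ℂ) ≠ 0 := Nat.cast_ne_zero.mpr j.factorial_ne_zero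
  have h8 : ((-1 : ℂ)) ^ (i + j) ≠ 0 := pow_ne_zero _ (by norm_num)
  rw [hD, polyCoeffUpper, coeffUpper]
  generalize poch (lam + (n : ℂ) / 2 - i) i = u at *
  generalize poch (1 - (n : ℂ) / 2 - mu) j = v at *
  generalize ∏ m ∈ Finset.Icc (i + 1) N, (lam + (n : ℂ) / 2 - m) = u'
  generalize ∏ m ∈ Finset.Icc (j + 1) N, ((m : ℂ) - (n : ℂ) / 2 - mu) = v'
  field_simp

theorem polyCoeff_eq {n N : ℕ} {lam mu : ℂ} (h : commonDenom n N lam mu ≠ 0) {i j : ℕ}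
    (hij : i + j ≤ N) :
    polyCoeff n N lam mu i j = commonDenom n N lam mu * coeff n N lam mu i j := by
  rw [polyCoeff, coeff]
  split_ifs
  · exact polyCoeffUpper_eq h (by omega) (by omega)
  · rw [← commonDenom_swap, polyCoeffUpper_eq (by rwa [commonDenom_swap]) (by omega) (by omega)]

theorem continuous_poch {X : Type*} [TopologicalSpace X] {f : X → ℂ} (hf : Continuous f) (l : ℕ) :
    Continuous fun x => poch (f x) l :=
  continuous_finsetProd _ fun _ _ => hf.add continuous_const

theorem continuous_polyCoeffUpper (n N i j : ℕ) :
    Continuous fun p : ℂ × ℂ => polyCoeffUpper n N p.1 p.2 i j := by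
  have h1 : Continuous fun p : ℂ × ℂ => coeffSum n N p.1 p.2 i j := by
    unfold coeffSum
    refine continuous_finsetSum _ fun k _ => ?_
    refine ((continuous_const.mul (continuous_poch ?_ _)).mul (continuous_poch ?_ _)).mul
      (continuous_poch ?_ _) <;> fun_prop
  unfold polyCoeffUpper
  refine ((((continuous_const.mul (continuous_poch ?_ _)).div_const _).mul
    (continuous_finsetProd _ fun m _ => ?_)).mul
    (continuous_finsetProd _ fun m _ => ?_)).mul h1 <;> fun_prop

theorem continuous_polyCoeff (n N i j : ℕ) :
    Continuous fun p : ℂ × ℂ => polyCoeff n N p.1 p.2 i j := by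
  unfold polyCoeff
  split_ifs
  · exact continuous_polyCoeffUpper n N i j
  · have h := (continuous_polyCoeffUpper n N j i).comp
      (continuous_snd.prodMk continuous_fst : Continuous fun p : ℂ × ℂ => (p.2, p.1))
    simpa only [Function.comp_def] using h

theorem continuous_defect {X : Type*} [TopologicalSpace X] (n N : ℕ) {lam mu : X → ℂ}
    {a : X → ℕ → ℕ → ℂ} (hl : Continuous lam) (hm : Continuous mu)
    (ha : ∀ i j, Continuous fun x => a x i j) (i j : ℕ) :
    Continuous fun x => defect n N (lam x) (mu x) (a x) i j := by
  have h1 := ha (i + 1) j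
  have h2 := ha i j
  have h3 : Continuous fun x => shiftSeq (a x i) j := by
    cases j with
    | zero => exact continuous_const
    | succ j => exact ha i j
  unfold defect
  fun_prop

theorem isClosed_isSol {X : Type*} [TopologicalSpace X] (n N : ℕ) {lam mu : X → ℂ}
    {a : X → ℕ → ℕ → ℂ} (hl : Continuous lam) (hm : Continuous mu)
    (ha : ∀ i j, Continuous fun x => a x i j) :
    IsClosed {x | IsSol n N (lam x) (mu x) (a x)} := by
  have h : {x | IsSol n N (lam x) (mu x) (a x)} = ⋂ (i : ℕ) (j : ℕ) (_ : i + j < N),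
      {x | defect n N (lam x) (mu x) (a x) i j = 0} ∩
      {x | defect n N (mu x) (lam x) (fun i j => a x j i) j i = 0} := by
    ext x
    simp only [Set.mem_iInter]
    exact ⟨fun h i j hij => ⟨h.left i j hij, h.right i j hij⟩,
      fun h => ⟨fun i j hij => (h i j hij).1, fun i j hij => (h i j hij).2⟩⟩
  rw [h]
  exact isClosed_iInter fun i => isClosed_iInter fun j => isClosed_iInter fun _ =>
    (isClosed_eq (continuous_defect n N hl hm ha i j) continuous_const).inter
      (isClosed_eq (continuous_defect n N hm hl (fun i j => ha j i) j i) continuous_const)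

theorem dense_genericSet : Dense genericSet := by
  have h : genericSet = (Set.range fun k : ℤ => (k : ℂ) / 2)ᶜ := by
    ext z
    simp only [genericSet, Set.mem_ofPred_eq, Set.mem_compl_iff, Set.mem_range, not_exists]
    refine forall_congr' fun k => not_congr ?_
    constructor
    · intro h; linear_combination -(1 / 2) * h
    · intro h; linear_combination -2 * h
  rw [h]
  exact (Set.countable_range _).dense_compl ℝ

theorem dense_genericSet_prod : Dense (genericSet ×ˢ genericSet) :=
  dense_genericSet.prod dense_genericSet

/-- The recursion is a closed condition and the coefficients depend continuously on the parameters,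
so it is enough to check it on the dense set of generic parameters. -/
theorem polyCoeff_isSol (n N : ℕ) (lam mu : ℂ) : IsSol n N lam mu (polyCoeff n N lam mu) := by
  have hgen : ∀ p ∈ genericSet ×ˢ genericSet, IsSol n N p.1 p.2 (polyCoeff n N p.1 p.2) := by
    rintro p ⟨hl, hm⟩
    refine ((coeff_isSol_of_generic hl hm).const_mul (commonDenom n N p.1 p.2)).congr
      fun i j hij => ?_
    rw [polyCoeff_eq (genericSet_commonDenom hl hm) hij]
  exact (isClosed_isSol n N continuous_fst continuous_snd
    (continuous_polyCoeff n N)).closure_subset_iff.mpr hgen (dense_genericSet_prod (lam, mu))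

theorem coeff_isSol {n N : ℕ} {lam mu : ℂ} (h : commonDenom n N lam mu ≠ 0) :
    IsSol n N lam mu (coeff n N lam mu) :=
  ((polyCoeff_isSol n N lam mu).const_mul (commonDenom n N lam mu)⁻¹).congr fun i j hij => by
    rw [polyCoeff_eq h hij, inv_mul_cancel_left₀ h]

theorem coeff_zero_zero (n N : ℕ) (lam mu : ℂ) : coeff n N lam mu 0 0 = 1 := by
  simp [coeff, coeffUpper_zero_zero]

theorem coeff_swap {n N : ℕ} {lam mu : ℂ} (h : commonDenom n N lam mu ≠ 0) (i j : ℕ)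
    (hij : i + j ≤ N) : coeff n N lam mu i j = coeff n N mu lam j i := by
  have h' := ((coeff_isSol h).add_mul
    (coeff_isSol (n := n) (N := N) (lam := mu) (mu := lam) (by rwa [commonDenom_swap])).swap
    (-1)).eq_zero_of_commonDenom h (by simp [coeff_zero_zero]) i j hij
  linear_combination h'

theorem commonDenom_ne_zero {n N : ℕ} {lam mu : ℂ} (hl : lam ∉ exceptional n)
    (hm : mu ∉ exceptional n) : commonDenom n N lam mu ≠ 0 := by
  refine Finset.prod_ne_zero_iff.mpr fun m _ => mul_ne_zero (fun hc => ?_) fun hc => ?_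
  · exact hl ⟨m, by linear_combination hc⟩
  · exact hm ⟨m, by linear_combination -hc⟩

/-- For all parameters the recursion has a nonzero solution: normalized solutions for generic
parameters have a limit point. -/
theorem exists_isSol_ne_zero (n N : ℕ) (lam mu : ℂ) :
    ∃ a : ℕ → ℕ → ℂ, IsSol n N lam mu a ∧ ∃ i j, i + j ≤ N ∧ a i j ≠ 0 := by
  obtain ⟨p, hp, hlim⟩ := mem_closure_iff_seq_limit.mp (dense_genericSet_prod (lam, mu))
  -- square arrays of coefficients form a finite-dimensional space
  let ext : (Fin (N + 1) → Fin (N + 1) → ℂ) → ℕ → ℕ → ℂ := fun v i j =>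
    if h : i < N + 1 ∧ j < N + 1 then v ⟨i, h.1⟩ ⟨j, h.2⟩ else 0
  have hext : ∀ i j, Continuous fun v => ext v i j := by
    intro i j
    by_cases h : i < N + 1 ∧ j < N + 1
    · simp only [ext, h, dif_pos, and_self]
      fun_prop
    · simp only [ext, h, dif_neg, not_false_eq_true]
      fun_prop
  let v : ℕ → (Fin (N + 1) → Fin (N + 1) → ℂ) := fun k i j =>
    if (i : ℕ) + j ≤ N then coeff n N (p k).1 (p k).2 i j else 0
  have hv : ∀ k, v k ≠ 0 := fun k h => by
    have := congrFun (congrFun h 0) 0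
    simp [v, coeff_zero_zero] at this
  have hsol : ∀ k, IsSol n N (p k).1 (p k).2 (ext (((‖v k‖⁻¹ : ℝ) : ℂ) • v k)) := by
    intro k
    refine ((coeff_isSol_of_generic (hp k).1 (hp k).2).const_mul ((‖v k‖⁻¹ : ℝ) : ℂ)).congr
      fun i j hij => ?_
    have h : i < N + 1 ∧ j < N + 1 := ⟨by omega, by omega⟩
    simp only [ext, v, dif_pos h, Pi.smul_apply, if_pos hij, smul_eq_mul]
  have hsphere : ∀ k, ((‖v k‖⁻¹ : ℝ) : ℂ) • v k ∈ Metric.sphere (0 : Fin (N + 1) → Fin (N + 1) → ℂ) 1 := by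
    intro k
    rw [mem_sphere_zero_iff_norm, norm_smul]
    simp [hv k]
  obtain ⟨b, hb, s, hs, hsb⟩ := (isCompact_sphere _ _).tendsto_subseq hsphere
  have hcl : IsSol n N lam mu (ext b) :=
    (isClosed_isSol n N (X := (ℂ × ℂ) × (Fin (N + 1) → Fin (N + 1) → ℂ))
      (lam := fun x => x.1.1) (mu := fun x => x.1.2) (a := fun x => ext x.2)
      (by fun_prop) (by fun_prop) (fun i j => (hext i j).comp continuous_snd)).mem_of_tendsto
      ((hlim.comp hs.tendsto_atTop).prodMk_nhds hsb) (Filter.Eventually.of_forall fun k => hsol (s k))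
  refine ⟨ext b, hcl, ?_⟩
  -- the limit has norm one, and its entries outside the triangle `i + j ≤ N` vanish
  by_contra! hcon
  have hb0 : b = 0 := by
    ext i j
    by_cases h : (i : ℕ) + j ≤ N
    · have := hcon i j h
      simp only [ext, dif_pos (And.intro i.2 j.2)] at this
      exact this
    · have hc : Continuous fun x : Fin (N + 1) → Fin (N + 1) → ℂ => x i j := by fun_prop
      refine tendsto_nhds_unique ((hc.tendsto _).comp hsb) ?_
      exact tendsto_const_nhds.congr fun k => by
        simp only [Function.comp_apply, Pi.smul_apply, v, if_neg h, smul_zero, Pi.zero_apply]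
  rw [hb0] at hb
  simp at hb

/-! ### Symbols -/

/-- Polynomials in `ξ, η ∈ ℂⁿ`: symbols of bilinear differential operators with constant
coefficients. The variable `ξ_k` is `X (Sum.inl k)`, and `η_k` is `X (Sum.inr k)`. -/
abbrev Symb (n : ℕ) : Type := MvPolynomial (Fin n ⊕ Fin n) ℂ

open MvPolynomial in
/-- The polynomial `∑_k X_{ι k} X_{κ k}`; for `ι, κ ∈ {inl, inr}` these are `|ξ|²`, `|η|²` and
`ξ·η`. -/
def symDot {n : ℕ} (ι κ : Fin n → Fin n ⊕ Fin n) : Symb n := ∑ k, X (ι k) * X (κ k)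

theorem symDot_comm {n : ℕ} (ι κ : Fin n → Fin n ⊕ Fin n) : symDot ι κ = symDot κ ι :=
  Finset.sum_congr rfl fun _ _ => mul_comm _ _

/-- Sums over the triangle `i + j ≤ M - 1`. -/
def triSum {A : Type*} [AddCommMonoid A] (M : ℕ) (f : ℕ → ℕ → A) : A :=
  ∑ i ∈ Finset.range M, ∑ j ∈ Finset.range (M - i), f i j

theorem triSum_swap {A : Type*} [AddCommMonoid A] (M : ℕ) (f : ℕ → ℕ → A) :
    triSum M f = triSum M fun i j => f j i := by
  unfold triSum
  refine Finset.sum_comm' fun i j => ?_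
  simp only [Finset.mem_range]
  omega

theorem triSum_congr {A : Type*} [AddCommMonoid A] {M : ℕ} {f g : ℕ → ℕ → A}
    (h : ∀ i j, i + j < M → f i j = g i j) : triSum M f = triSum M g :=
  Finset.sum_congr rfl fun i _ => Finset.sum_congr rfl fun j hj =>
    h i j (by rw [Finset.mem_range] at hj; omega)

theorem triSum_add {A : Type*} [AddCommMonoid A] (M : ℕ) (f g : ℕ → ℕ → A) :
    triSum M (fun i j => f i j + g i j) = triSum M f + triSum M g := by
  simp only [triSum, Finset.sum_add_distrib]

theorem map_triSum {A B F : Type*} [AddCommMonoid A] [AddCommMonoid B] [FunLike F A B]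
    [AddMonoidHomClass F A B] (φ : F) (M : ℕ) (f : ℕ → ℕ → A) :
    φ (triSum M f) = triSum M fun i j => φ (f i j) := by
  simp only [triSum, map_sum]

theorem mul_triSum {A : Type*} [NonUnitalNonAssocSemiring A] (M : ℕ) (c : A) (f : ℕ → ℕ → A) :
    c * triSum M f = triSum M fun i j => c * f i j := by
  simp only [triSum, Finset.mul_sum]

/-- Terms with index `(i+1, j)` in place of `(i, j)`. -/
theorem triSum_shift_left {A : Type*} [AddCommMonoid A] (N : ℕ) (f : ℕ → ℕ → A)
    (h : ∀ j, f 0 j = 0) : triSum (N + 1) f = triSum N fun i j => f (i + 1) j := by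
  simp [triSum, Finset.sum_range_succ' _ N, h]

/-- Dropping terms on the outer diagonal. -/
theorem triSum_drop {A : Type*} [AddCommMonoid A] (N : ℕ) (f : ℕ → ℕ → A)
    (h : ∀ i j, i + j = N → f i j = 0) : triSum (N + 1) f = triSum N f := by
  unfold triSum
  rw [Finset.sum_range_succ]
  have : ∑ j ∈ Finset.range (N + 1 - N), f N j = 0 := by simp [h]
  rw [this, add_zero]
  refine Finset.sum_congr rfl fun i hi => ?_
  rw [Finset.mem_range] at hi
  rw [show N + 1 - i = N - i + 1 by omega, Finset.sum_range_succ, h i (N - i) (by omega), add_zero]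

/-- The symbol `∑_{i+j≤N} a_{i,j} |ξ|^{2i} |η|^{2j} (ξ·η)^{N-i-j}`. -/
def symbol (n N : ℕ) (a : ℕ → ℕ → ℂ) : Symb n :=
  triSum (N + 1) fun i j => MvPolynomial.C (a i j) *
    (symDot Sum.inl Sum.inl ^ i * symDot Sum.inr Sum.inr ^ j *
      symDot Sum.inl Sum.inr ^ (N - i - j))

/-- Rewriting the image of `∑ a_{i,j} x^i y^j z^{N-i-j}` under an element of `𝔫` in terms of
defects. -/
theorem triSum_defect {A : Type*} [CommRing A] [Algebra ℂ A] (n N : ℕ) (lam mu : ℂ)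
    (a : ℕ → ℕ → ℂ) (x y z : A) :
    (triSum (N + 1) fun i j => a i j •
      (((i : ℂ) * (2 * i - n - 2 * lam)) • (x ^ (i - 1) * y ^ j * z ^ (N - i - j)) -
        (1 / 2 * ((N - i - j : ℕ) : ℂ) * (((N - i - j : ℕ) : ℂ) - 1)) •
          (x ^ i * y ^ (j + 1) * z ^ (N - i - j - 2)) +
        (((N - i - j : ℕ) : ℂ) * (2 * j + ((N - i - j : ℕ) : ℂ) - 1 - mu)) •
          (x ^ i * y ^ j * z ^ (N - i - j - 1)))) =
    triSum N fun i j => defect n N lam mu a i j • (x ^ i * y ^ j * z ^ (N - 1 - i - j)) := by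
  have h1 : (triSum (N + 1) fun i j => a i j •
      (((i : ℂ) * (2 * i - n - 2 * lam)) • (x ^ (i - 1) * y ^ j * z ^ (N - i - j)))) =
      triSum N fun i j => ((i + 1) * (2 * i + 2 - 2 * lam - n) * a (i + 1) j) •
        (x ^ i * y ^ j * z ^ (N - 1 - i - j)) := by
    rw [triSum_shift_left _ _ (by simp)]
    refine triSum_congr fun i j hij => ?_
    rw [smul_smul, show N - (i + 1) - j = N - 1 - i - j by omega, Nat.add_sub_cancel]
    congr 1
    push_cast
    ring
  have h3 : (triSum (N + 1) fun i j => a i j •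
      (((N - i - j : ℕ) : ℂ) * (2 * j + ((N - i - j : ℕ) : ℂ) - 1 - mu)) •
          (x ^ i * y ^ j * z ^ (N - i - j - 1))) =
      triSum N fun i j => ((N - i - j) * (N - 1 - i + j - mu) * a i j) •
        (x ^ i * y ^ j * z ^ (N - 1 - i - j)) := by
    rw [triSum_drop]
    · refine triSum_congr fun i j hij => ?_
      rw [smul_smul, show N - i - j - 1 = N - 1 - i - j by omega, Nat.sub_sub,
        Nat.cast_sub (by omega)]
      congr 1
      push_cast
      ring
    · intro i j hij
      simp [Nat.sub_sub, hij]
  have h2 : (triSum (N + 1) fun i j => a i j •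
      (1 / 2 * ((N - i - j : ℕ) : ℂ) * (((N - i - j : ℕ) : ℂ) - 1)) •
          (x ^ i * y ^ (j + 1) * z ^ (N - i - j - 2))) =
      triSum N fun i j => (1 / 2 * (N - i - j + 1) * (N - i - j) * shiftSeq (a i) j) •
        (x ^ i * y ^ j * z ^ (N - 1 - i - j)) := by
    rw [triSum_drop _ _ fun i j hij => by simp [Nat.sub_sub, hij]]
    cases N with
    | zero => rfl
    | succ N =>
      rw [triSum_drop _ _ fun i j hij => by simp [show N + 1 - i - j = 1 by omega],
        triSum_swap, triSum_swap (N + 1), triSum_shift_left _ _ (by simp)]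
      refine triSum_congr fun j i hij => ?_
      rw [smul_smul, show N + 1 - i - j - 2 = N + 1 - 1 - i - (j + 1) by omega, Nat.sub_sub,
        Nat.cast_sub (by omega), shiftSeq_succ]
      congr 1
      push_cast
      ring
  simp only [smul_add, sub_eq_add_neg, triSum_add]
  simp only [← smul_neg, ← sub_eq_add_neg]
  rw [h1, h3]
  have h2' : (triSum (N + 1) fun i j => a i j •
      (1 / 2 * ((N - i - j : ℕ) : ℂ) * (((N - i - j : ℕ) : ℂ) - 1)) •
          -(x ^ i * y ^ (j + 1) * z ^ (N - i - j - 2))) =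
      triSum N fun i j => -((1 / 2 * (N - i - j + 1) * (N - i - j) * shiftSeq (a i) j) •
        (x ^ i * y ^ j * z ^ (N - 1 - i - j))) := by
    have := congrArg Neg.neg h2
    simpa only [triSum, ← Finset.sum_neg_distrib, smul_neg] using this
  rw [h2', ← triSum_add, ← triSum_add]
  refine triSum_congr fun i j _ => ?_
  rw [defect, sub_smul, add_smul]
  abel

/-! ### The action of `𝔫` on symbols -/

open MvPolynomial in
/-- The action on symbols of the `k`-th generator of `𝔫`, in the variables `X_{ι l}`: it is the
transpose of the action of the vector field `x_k ∑ x_l ∂_l - ½ |x|² ∂_k - λ x_k`. -/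
def nilOp {n : ℕ} (ι : Fin n → Fin n ⊕ Fin n) (lam : ℂ) (k : Fin n) (p : Symb n) : Symb n :=
  ∑ l, X (ι l) * pderiv (ι l) (pderiv (ι k) p) -
    (1 / 2 : ℂ) • (X (ι k) * ∑ l, pderiv (ι l) (pderiv (ι l) p)) - lam • pderiv (ι k) p

/-- The action of the `k`-th generator of `𝔫` on symbols in `ξ` and `η`. -/
def nilOp₂ {n : ℕ} (lam mu : ℂ) (k : Fin n) (p : Symb n) : Symb n :=
  nilOp Sum.inl lam k p + nilOp Sum.inr mu k p

theorem nilOp_add {n : ℕ} (ι : Fin n → Fin n ⊕ Fin n) (lam : ℂ) (k : Fin n) (p q : Symb n) :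
    nilOp ι lam k (p + q) = nilOp ι lam k p + nilOp ι lam k q := by
  simp only [nilOp, map_add, mul_add, Finset.sum_add_distrib, smul_add]
  abel

theorem nilOp_smul {n : ℕ} (ι : Fin n → Fin n ⊕ Fin n) (lam : ℂ) (k : Fin n) (c : ℂ)
    (p : Symb n) : nilOp ι lam k (c • p) = c • nilOp ι lam k p := by
  simp only [nilOp, Derivation.map_smul, mul_smul_comm, ← Finset.smul_sum, smul_sub]
  rw [smul_comm c (1 / 2 : ℂ), smul_comm c lam]

/-- `nilOp` as a linear map. -/
def nilOpLin {n : ℕ} (ι : Fin n → Fin n ⊕ Fin n) (lam : ℂ) (k : Fin n) : Symb n →ₗ[ℂ] Symb n where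
  toFun := nilOp ι lam k
  map_add' := nilOp_add ι lam k
  map_smul' := nilOp_smul ι lam k

open MvPolynomial in
theorem nilOp_monomial {n : ℕ} {ι κ : Fin n → Fin n ⊕ Fin n} (hι : Function.Injective ι)
    (hικ : ∀ k l, ι k ≠ κ l) (lam : ℂ) (k : Fin n) (i j m : ℕ) :
    nilOp ι lam k (symDot ι ι ^ i * symDot κ κ ^ j * symDot ι κ ^ m) =
      X (ι k) * (((i : ℂ) * (2 * i - n - 2 * lam)) •
          (symDot ι ι ^ (i - 1) * symDot κ κ ^ j * symDot ι κ ^ m) -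
        (1 / 2 * (m : ℂ) * ((m : ℂ) - 1)) •
          (symDot ι ι ^ i * symDot κ κ ^ (j + 1) * symDot ι κ ^ (m - 2))) +
      X (κ k) * (((m : ℂ) * (2 * i + m - 1 - lam)) •
          (symDot ι ι ^ i * symDot κ κ ^ j * symDot ι κ ^ (m - 1))) := by
  classical
  have hx : ∀ l, pderiv (ι l) (symDot ι ι) = (2 : ℂ) • X (ι l) := by
    intro l
    simp only [symDot, map_sum, Derivation.leibniz, pderiv_X, smul_eq_mul, Pi.single_apply,
      hι.eq_iff, mul_ite, mul_one, mul_zero, Finset.sum_add_distrib, Finset.sum_ite_eq',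
      Finset.mem_univ, if_true, two_smul]
  have hy : ∀ l, pderiv (ι l) (symDot κ κ) = 0 := by
    intro l
    simp [symDot, map_sum, Derivation.leibniz, pderiv_X_of_ne (hικ l _).symm]
  have hz : ∀ l, pderiv (ι l) (symDot ι κ) = X (κ l) := by
    intro l
    simp only [symDot, map_sum, Derivation.leibniz, pderiv_X_of_ne (hικ l _).symm, pderiv_X,
      smul_eq_mul, Pi.single_apply, hι.eq_iff]
    simp
  have hξ : ∀ l k, pderiv (ι l) (X (ι k) : Symb n) = if k = l then 1 else 0 := by
    intro l k
    simp [pderiv_X, Pi.single_apply, hι.eq_iff, eq_comm]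
  have hη : ∀ l k, pderiv (ι l) (X (κ k) : Symb n) = 0 := fun l k =>
    pderiv_X_of_ne (hικ l k).symm
  set x := symDot ι ι with hxd
  set y := symDot κ κ with hyd
  set z := symDot ι κ with hzd
  -- first and second derivatives of `x ^ i` and of `z ^ m`
  set x1 : Symb n := (i : ℂ) • x ^ (i - 1) with hx1
  set x2 : Symb n := ((i : ℂ) * (i - 1)) • x ^ (i - 2) with hx2
  set z1 : Symb n := (m : ℂ) • z ^ (m - 1) with hz1
  set z2 : Symb n := ((m : ℂ) * (m - 1)) • z ^ (m - 2) with hz2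
  have dpow : ∀ (l : Fin n) (f : Symb n) (r : ℕ),
      pderiv (ι l) (f ^ r) = ((r : ℂ) • f ^ (r - 1)) * pderiv (ι l) f := by
    intro l f r
    rw [Derivation.leibniz_pow, smul_eq_mul, smul_mul_assoc, Nat.cast_smul_eq_nsmul]
  have dpow' : ∀ (l : Fin n) (f : Symb n) (r : ℕ), pderiv (ι l) ((r : ℂ) • f ^ (r - 1)) =
      (((r : ℂ) * (r - 1)) • f ^ (r - 2)) * pderiv (ι l) f := by
    intro l f r
    rw [Derivation.map_smul, dpow, ← smul_mul_assoc, smul_smul, Nat.sub_sub]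
    rcases r with _ | r
    · simp
    · simp
  have hxi : ∀ l, pderiv (ι l) (x ^ i) = x1 * ((2 : ℂ) • X (ι l)) := fun l => by rw [dpow, hx]
  have hzm : ∀ l, pderiv (ι l) (z ^ m) = z1 * X (κ l) := fun l => by rw [dpow, hz]
  have hyj : ∀ l, pderiv (ι l) (y ^ j) = 0 := fun l => by rw [dpow, hy, mul_zero]
  have hx1' : ∀ l, pderiv (ι l) x1 = x2 * ((2 : ℂ) • X (ι l)) := fun l => by rw [dpow', hx]
  have hz1' : ∀ l, pderiv (ι l) z1 = z2 * X (κ l) := fun l => by rw [dpow', hz]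
  have hxx1 : x * x1 = (i : ℂ) • x ^ i := by
    rcases i with _ | i
    · simp [hx1]
    · simp only [hx1, Nat.add_sub_cancel, mul_smul_comm, pow_succ, mul_comm]
  have hxx2 : x * x2 = ((i : ℂ) - 1) • x1 := by
    rcases i with _ | _ | i
    · simp [hx1, hx2]
    · simp [hx1, hx2]
    · simp only [hx1, hx2, mul_smul_comm, smul_smul, ← pow_succ']
      congr 1
      push_cast; ring
  have hzz2 : z * z2 = ((m : ℂ) - 1) • z1 := by
    rcases m with _ | _ | i
    · simp [hz1, hz2]
    · simp [hz1, hz2]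
    · simp only [hz1, hz2, mul_smul_comm, smul_smul, ← pow_succ']
      congr 1
      push_cast; ring
  have hd : ∀ k, pderiv (ι k) (x ^ i * y ^ j * z ^ m) =
      y ^ j * (X (ι k) * ((2 : ℂ) • (x1 * z ^ m)) + X (κ k) * (x ^ i * z1)) := by
    intro k
    simp only [Derivation.leibniz, hxi, hzm, hyj, smul_eq_mul, smul_eq_C_mul]
    ring
  have hdd : ∀ l k, pderiv (ι l) (pderiv (ι k) (x ^ i * y ^ j * z ^ m)) =
      y ^ j * ((if k = l then 1 else 0) * ((2 : ℂ) • (x1 * z ^ m)) +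
        X (ι k) * ((2 : ℂ) • (x2 * ((2 : ℂ) • X (ι l)) * z ^ m + x1 * (z1 * X (κ l)))) +
        X (κ k) * (x1 * ((2 : ℂ) • X (ι l)) * z1 + x ^ i * (z2 * X (κ l)))) := by
    intro l k
    rw [hd]
    simp only [Derivation.leibniz, map_add, hyj, hxi, hzm, hx1', hz1', hξ, hη,
      smul_eq_mul, smul_eq_C_mul, pderiv_C]
    ring
  have hsum1 : ∑ l, X (ι l) * pderiv (ι l) (pderiv (ι k) (x ^ i * y ^ j * z ^ m)) =
      y ^ j * (X (ι k) * ((2 : ℂ) • (x1 * z ^ m)) +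
        X (ι k) * ((2 : ℂ) • (x2 * ((2 : ℂ) • x) * z ^ m + x1 * (z1 * z))) +
        X (κ k) * (x1 * ((2 : ℂ) • x) * z1 + x ^ i * (z2 * z))) := by
    have e : ∀ l, X (ι l) * pderiv (ι l) (pderiv (ι k) (x ^ i * y ^ j * z ^ m)) =
        y ^ j * ((2 : ℂ) • (x1 * z ^ m)) * (X (ι l) * (if k = l then 1 else 0)) +
        (y ^ j * (X (ι k) * ((2 : ℂ) • (x2 * z ^ m)) + X (κ k) * (x1 * z1)) * C 2) *
          (X (ι l) * X (ι l)) +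
        (y ^ j * (X (ι k) * ((2 : ℂ) • (x1 * z1)) + X (κ k) * (x ^ i * z2))) *
          (X (ι l) * X (κ l)) := by
      intro l
      rw [hdd]
      simp only [smul_eq_C_mul]
      ring
    rw [Finset.sum_congr rfl fun l _ => e l]
    simp only [Finset.sum_add_distrib, ← Finset.mul_sum]
    rw [← symDot, ← symDot, ← hxd, ← hzd]
    simp only [mul_ite, mul_one, mul_zero, Finset.sum_ite_eq, Finset.mem_univ, if_true,
      smul_eq_C_mul]
    ring
  have hsum2 : ∑ l, pderiv (ι l) (pderiv (ι l) (x ^ i * y ^ j * z ^ m)) =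
      y ^ j * ((2 * n : ℂ) • (x1 * z ^ m) + (4 : ℂ) • (x * x2 * z ^ m) +
        (4 : ℂ) • (z * z1 * x1) + y * x ^ i * z2) := by
    have e : ∀ l, pderiv (ι l) (pderiv (ι l) (x ^ i * y ^ j * z ^ m)) =
        y ^ j * ((2 : ℂ) • (x1 * z ^ m)) +
        (y ^ j * (x2 * z ^ m) * C 4) * (X (ι l) * X (ι l)) +
        (y ^ j * (x1 * z1) * C 4) * (X (ι l) * X (κ l)) +
        (y ^ j * (x ^ i * z2)) * (X (κ l) * X (κ l)) := by
      intro l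
      rw [hdd, if_pos rfl, show (4 : ℂ) = 2 * 2 by norm_num, map_mul]
      simp only [smul_eq_C_mul, show (C (2 : ℂ) : Symb n) = 2 from map_ofNat C 2]
      ring
    rw [Finset.sum_congr rfl fun l _ => e l]
    simp only [Finset.sum_add_distrib, ← Finset.mul_sum]
    rw [← symDot, ← symDot, ← symDot, ← hxd, ← hzd, ← hyd]
    simp only [Finset.sum_const, Finset.card_univ, Fintype.card_fin, smul_eq_C_mul, nsmul_eq_mul,
      map_mul, map_natCast]
    ring
  rw [nilOp, hsum1, hsum2, hd]
  have e1 : ((i : ℂ) * (2 * i - n - 2 * lam)) • (x ^ (i - 1) * y ^ j * z ^ m) =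
      (2 * i - n - 2 * lam : ℂ) • (x1 * y ^ j * z ^ m) := by
    rw [hx1, smul_mul_assoc, smul_mul_assoc, smul_smul, mul_comm]
  have e2 : (1 / 2 * (m : ℂ) * ((m : ℂ) - 1)) • (x ^ i * y ^ (j + 1) * z ^ (m - 2)) =
      (1 / 2 : ℂ) • (x ^ i * y ^ (j + 1) * z2) := by
    rw [hz2, mul_smul_comm, smul_smul, mul_assoc]
  have e3 : ((m : ℂ) * (2 * i + m - 1 - lam)) • (x ^ i * y ^ j * z ^ (m - 1)) =
      (2 * i + m - 1 - lam : ℂ) • (x ^ i * y ^ j * z1) := by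
    rw [hz1, mul_smul_comm, smul_smul, mul_comm]
  rw [e1, e2, e3]
  have h12 : (C (1 / 2 : ℂ) : Symb n) * C 2 = 1 := by
    rw [← map_mul]; norm_num
  simp only [smul_eq_C_mul, map_sub, map_add, map_mul, map_natCast, map_one] at hxx1 hxx2 hzz2 ⊢
  have h24 : (C (4 : ℂ) : Symb n) = C 2 * C 2 := by rw [← map_mul]; norm_num
  have h2 : (C (2 : ℂ) : Symb n) = 2 := map_ofNat C 2
  rw [h24]
  rw [h2] at h12 ⊢
  linear_combination (y ^ j * X (ι k) * z ^ m * (4 - 4 * C (1 / 2))) * hxx2 +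
    (y ^ j * X (κ k) * 2 * z1) * hxx1 + (y ^ j * X (κ k) * x ^ i) * hzz2 -
    (X (ι k) * y ^ j * (n * x1 * z ^ m + 2 * (i - 1) * x1 * z ^ m + 2 * z * z1 * x1)) * h12

open MvPolynomial in
/-- The image of the symbol with coefficients `a` under the `k`-th generator of `𝔫`. -/
theorem nilOp₂_symbol {n N : ℕ} (lam mu : ℂ) (k : Fin n) (a : ℕ → ℕ → ℂ) :
    nilOp₂ lam mu k (symbol n N a) =
      X (Sum.inl k) * (triSum N fun i j => defect n N lam mu a i j •
        (symDot Sum.inl Sum.inl ^ i * symDot Sum.inr Sum.inr ^ j *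
          symDot Sum.inl Sum.inr ^ (N - 1 - i - j))) +
      X (Sum.inr k) * (triSum N fun i j => defect n N mu lam (fun i j => a j i) j i •
        (symDot Sum.inl Sum.inl ^ i * symDot Sum.inr Sum.inr ^ j *
          symDot Sum.inl Sum.inr ^ (N - 1 - i - j))) := by
  have hlr : ∀ k l : Fin n, (Sum.inl k : Fin n ⊕ Fin n) ≠ Sum.inr l := fun _ _ => Sum.inl_ne_inr
  have hrl : ∀ k l : Fin n, (Sum.inr k : Fin n ⊕ Fin n) ≠ Sum.inl l := fun _ _ => Sum.inr_ne_inl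
  set x : Symb n := symDot Sum.inl Sum.inl with hx
  set y : Symb n := symDot Sum.inr Sum.inr with hy
  set z : Symb n := symDot Sum.inl Sum.inr with hz
  have hz' : symDot Sum.inr Sum.inl = z := symDot_comm _ _
  have hl : ∀ i j m : ℕ, nilOp Sum.inl lam k (x ^ i * y ^ j * z ^ m) = _ :=
    fun i j m => nilOp_monomial Sum.inl_injective hlr lam k i j m
  have hr := fun i j m : ℕ => nilOp_monomial Sum.inr_injective hrl mu k j i m
  simp only [hz', ← hx, ← hy] at hr
  have hswap : (triSum N fun i j => defect n N mu lam (fun i j => a j i) j i •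
        (x ^ i * y ^ j * z ^ (N - 1 - i - j))) =
      triSum N fun i j => defect n N mu lam (fun i j => a j i) i j •
        (y ^ i * x ^ j * z ^ (N - 1 - i - j)) := by
    rw [triSum_swap]
    refine triSum_congr fun i j _ => ?_
    rw [mul_comm (x ^ j), Nat.sub_right_comm]
  rw [hswap, ← triSum_defect, ← triSum_defect, triSum_swap _ fun i j => a j i • _, mul_triSum,
    mul_triSum, ← triSum_add]
  have hsum : nilOp₂ lam mu k (symbol n N a) = triSum (N + 1) fun i j => a i j •
      (nilOp Sum.inl lam k (x ^ i * y ^ j * z ^ (N - i - j)) +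
        nilOp Sum.inr mu k (x ^ i * y ^ j * z ^ (N - i - j))) := by
    have h := map_triSum (nilOpLin Sum.inl lam k + nilOpLin Sum.inr mu k) (N + 1)
      fun i j => a i j • (x ^ i * y ^ j * z ^ (N - i - j))
    simp only [map_smul] at h
    rw [symbol]
    simp only [← smul_eq_C_mul]
    exact h
  rw [hsum]
  refine triSum_congr fun i j hij => ?_
  have hr' := hr i j (N - i - j)
  rw [mul_comm (y ^ j) (x ^ i)] at hr'
  rw [hl, hr', ← hx, ← hy, ← hz, Nat.sub_right_comm N j i]
  simp only [smul_eq_C_mul]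
  ring

theorem IsSol.nilOp₂_eq_zero {n N : ℕ} {lam mu : ℂ} {a : ℕ → ℕ → ℂ} (ha : IsSol n N lam mu a)
    (k : Fin n) : nilOp₂ lam mu k (symbol n N a) = 0 := by
  rw [nilOp₂_symbol, triSum_congr fun i j hij => by rw [ha.left i j hij, zero_smul],
    triSum_congr (f := fun i j => defect n N mu lam (fun i j => a j i) j i • _)
      fun i j hij => by rw [ha.right i j hij, zero_smul]]
  simp [triSum]

/-! ### Independence of `|ξ|²`, `|η|²` and `ξ·η` -/

theorem coeff_eq_zero_of_sum_eq_zero {M : ℕ} {c : ℕ → ℂ} (S : Set ℂ) (hS : S.Finite)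
    (h : ∀ t ∉ S, ∑ j ∈ Finset.range M, c j * t ^ j = 0) : ∀ j < M, c j = 0 := by
  set p : Polynomial ℂ := ∑ j ∈ Finset.range M, Polynomial.C (c j) * Polynomial.X ^ j with hp
  have hp0 : p = 0 := by
    refine Polynomial.eq_zero_of_infinite_isRoot p (hS.infinite_compl.mono fun t ht => ?_)
    simpa [hp, Polynomial.IsRoot, Polynomial.eval_finsetSum] using h t ht
  intro j hj
  have := congrArg (fun q => Polynomial.coeff q j) hp0
  simpa [hp, Polynomial.finsetSum_coeff, Polynomial.coeff_C_mul, Polynomial.coeff_X_pow, hj]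
    using this

theorem eq_zero_of_triSum_eq_zero {M : ℕ} {c : ℕ → ℕ → ℂ}
    (h : ∀ s t : ℂ, s ≠ 0 → t ≠ 1 / s → (triSum M fun i j => c i j * (s ^ i * t ^ j)) = 0) :
    ∀ i j, i + j < M → c i j = 0 := by
  have h1 : ∀ s : ℂ, s ≠ 0 → ∀ j < M, ∑ i ∈ Finset.range (M - j), c i j * s ^ i = 0 := by
    intro s hs
    refine coeff_eq_zero_of_sum_eq_zero {1 / s} (Set.finite_singleton _) fun t ht => ?_
    have := h s t hs ht
    rw [triSum_swap] at this
    rw [← this, triSum]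
    refine Finset.sum_congr rfl fun j _ => ?_
    rw [Finset.sum_mul]
    exact Finset.sum_congr rfl fun i _ => by ring
  intro i j hij
  exact coeff_eq_zero_of_sum_eq_zero {0} (Set.finite_singleton _)
    (fun s hs => h1 s hs j (by omega)) i (by omega)

theorem eval_symDot {n : ℕ} (v : Fin n ⊕ Fin n → ℂ) (ι κ : Fin n → Fin n ⊕ Fin n) :
    MvPolynomial.eval v (symDot ι κ) = ∑ k, v (ι k) * v (κ k) := by
  simp [symDot]

/-- Two vectors in `ℂⁿ`, `n ≥ 2`, with prescribed scalar products. -/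
theorem exists_eval_symDot {n : ℕ} (hn : 2 ≤ n) {s t : ℂ} (hs : s ≠ 0) (ht : t ≠ 1 / s) :
    ∃ v : Fin n ⊕ Fin n → ℂ, MvPolynomial.eval v (symDot Sum.inl Sum.inl) = s ∧
      MvPolynomial.eval v (symDot Sum.inr Sum.inr) = t ∧
      MvPolynomial.eval v (symDot Sum.inl Sum.inr) = 1 ∧
      v (Sum.inl ⟨0, by omega⟩) ≠ 0 ∧ v (Sum.inl ⟨1, by omega⟩) = 0 ∧
      v (Sum.inr ⟨1, by omega⟩) ≠ 0 := by
  obtain ⟨m, rfl⟩ : ∃ m, n = m + 2 := ⟨n - 2, by omega⟩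
  obtain ⟨r, hr⟩ := IsAlgClosed.exists_pow_nat_eq s (n := 2) two_pos
  obtain ⟨q, hq⟩ := IsAlgClosed.exists_pow_nat_eq (t - 1 / s) (n := 2) two_pos
  have hr0 : r ≠ 0 := by rintro rfl; exact hs (by rw [← hr]; ring)
  have hq0 : q ≠ 0 := by rintro rfl; exact ht (by linear_combination -hq)
  refine ⟨Sum.elim (Fin.cons r fun _ => 0) (Fin.cons (1 / r) (Fin.cons q fun _ => 0)),
    ?_, ?_, ?_, hr0, rfl, hq0⟩
  · simp only [eval_symDot, Sum.elim_inl, Fin.sum_univ_succ,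
      Fin.cons_zero, Fin.cons_succ, mul_zero, Finset.sum_const_zero]
    linear_combination hr
  · simp only [eval_symDot, Sum.elim_inr, Fin.sum_univ_succ,
      Fin.cons_zero, Fin.cons_succ, mul_zero, Finset.sum_const_zero]
    have : 1 / r * (1 / r) = 1 / s := by rw [← hr]; field_simp
    linear_combination hq + this
  · simp only [eval_symDot, Sum.elim_inl, Sum.elim_inr,
      Fin.sum_univ_succ, Fin.cons_zero, Fin.cons_succ, zero_mul, Finset.sum_const_zero]
    field_simp
    ring

theorem eval_triSum_symDot {n M : ℕ} (v : Fin n ⊕ Fin n → ℂ) (c : ℕ → ℕ → ℂ) (e : ℕ → ℕ → ℕ)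
    {s t : ℂ} (hs : MvPolynomial.eval v (symDot Sum.inl Sum.inl) = s)
    (ht : MvPolynomial.eval v (symDot Sum.inr Sum.inr) = t)
    (hz : MvPolynomial.eval v (symDot Sum.inl Sum.inr) = 1) :
    MvPolynomial.eval v (triSum M fun i j => c i j • (symDot Sum.inl Sum.inl ^ i *
      symDot Sum.inr Sum.inr ^ j * symDot Sum.inl Sum.inr ^ e i j)) =
    triSum M fun i j => c i j * (s ^ i * t ^ j) := by
  rw [map_triSum]
  refine triSum_congr fun i j _ => ?_
  rw [MvPolynomial.smul_eval]
  simp [hs, ht, hz]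

theorem eq_zero_of_symbol_eq_zero {n N : ℕ} (hn : 2 ≤ n) {a : ℕ → ℕ → ℂ}
    (h : symbol n N a = 0) : ∀ i j, i + j ≤ N → a i j = 0 := by
  intro i j hij
  refine eq_zero_of_triSum_eq_zero (M := N + 1) (fun s t hs ht => ?_) i j (by omega)
  obtain ⟨v, h1, h2, h3, -⟩ := exists_eval_symDot hn hs ht
  have := congrArg (MvPolynomial.eval v) h
  simp only [symbol, ← MvPolynomial.smul_eq_C_mul] at this
  rw [eval_triSum_symDot v a _ h1 h2 h3, map_zero] at this
  exact this

/-- The converse of `nilOp₂_symbol`: at a point where `ξ` and `η` are linearly independent the two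
families of relations separate. -/
theorem isSol_of_nilOp₂_eq_zero {n N : ℕ} (hn : 2 ≤ n) {lam mu : ℂ} {a : ℕ → ℕ → ℂ}
    (h : ∀ k, nilOp₂ lam mu k (symbol n N a) = 0) : IsSol n N lam mu a := by
  have key : ∀ s t : ℂ, s ≠ 0 → t ≠ 1 / s →
      (triSum N fun i j => defect n N lam mu a i j * (s ^ i * t ^ j)) = 0 ∧
      (triSum N fun i j => defect n N mu lam (fun i j => a j i) j i * (s ^ i * t ^ j)) = 0 := by
    intro s t hs ht
    obtain ⟨v, h1, h2, h3, h4, h5, h6⟩ := exists_eval_symDot hn hs ht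
    have e : ∀ k, v (Sum.inl k) *
          (triSum N fun i j => defect n N lam mu a i j * (s ^ i * t ^ j)) +
        v (Sum.inr k) * (triSum N fun i j =>
          defect n N mu lam (fun i j => a j i) j i * (s ^ i * t ^ j)) = 0 := by
      intro k
      have := congrArg (MvPolynomial.eval v) (h k)
      rwa [nilOp₂_symbol, map_add, map_mul, map_mul, eval_triSum_symDot v _ _ h1 h2 h3,
        eval_triSum_symDot v (fun i j => defect n N mu lam (fun i j => a j i) j i) _ h1 h2 h3,
        MvPolynomial.eval_X, MvPolynomial.eval_X, map_zero] at this
    have e1 := e ⟨1, by omega⟩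
    rw [h5, zero_mul, zero_add] at e1
    have e2 := (mul_eq_zero.mp e1).resolve_left h6
    have e0 := e ⟨0, by omega⟩
    rw [e2, mul_zero, add_zero] at e0
    exact ⟨(mul_eq_zero.mp e0).resolve_left h4, e2⟩
  exact ⟨eq_zero_of_triSum_eq_zero fun s t hs ht => (key s t hs ht).1,
    eq_zero_of_triSum_eq_zero (c := fun i j => defect n N mu lam (fun i j => a j i) j i)
      fun s t hs ht => (key s t hs ht).2⟩

/-! ### Constant coefficient operators on smooth functions -/

section Smooth

variable {V W : Type*} [NormedAddCommGroup V] [NormedSpace ℝ V] [NormedAddCommGroup W]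
  [NormedSpace ℝ W] {σ : Type*}

/-- The space of smooth complex valued functions on `V`. -/
def Smooth (V : Type*) [NormedAddCommGroup V] [NormedSpace ℝ V] : Submodule ℂ (V → ℂ) where
  carrier := {u | ContDiff ℝ ∞ u}
  zero_mem' := (contDiff_const : ContDiff ℝ ∞ fun _ : V => (0 : ℂ))
  add_mem' := by
    rintro a b (ha : ContDiff ℝ ∞ a) (hb : ContDiff ℝ ∞ b)
    exact (ha.add hb : ContDiff ℝ ∞ (a + b))
  smul_mem' := by
    rintro c a (ha : ContDiff ℝ ∞ a)
    exact (contDiff_const.mul ha : ContDiff ℝ ∞ fun x => c * a x)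

instance : CoeFun (Smooth V) fun _ => V → ℂ := ⟨Subtype.val⟩

theorem contDiff_smooth (u : Smooth V) : ContDiff ℝ ∞ u := u.2

theorem differentiable_smooth (u : Smooth V) : Differentiable ℝ u :=
  (contDiff_smooth u).differentiable (by simp)

@[ext] theorem Smooth.ext {u v : Smooth V} (h : ∀ p, u p = v p) : u = v :=
  Subtype.ext (funext h)

@[simp] theorem Smooth.add_apply (u v : Smooth V) (p : V) : (u + v) p = u p + v p := rfl

@[simp] theorem Smooth.smul_apply (c : ℂ) (u : Smooth V) (p : V) : (c • u) p = c * u p := rfl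

@[simp] theorem Smooth.zero_apply (p : V) : (0 : Smooth V) p = 0 := rfl

@[simp] theorem Smooth.neg_apply (u : Smooth V) (p : V) : (-u) p = -u p := rfl

@[simp] theorem Smooth.sub_apply (u v : Smooth V) (p : V) : (u - v) p = u p - v p := rfl

@[simp] theorem Smooth.sum_apply {ι : Type*} (s : Finset ι) (u : ι → Smooth V) (p : V) :
    (∑ i ∈ s, u i) p = ∑ i ∈ s, u i p := by
  have : ((∑ i ∈ s, u i : Smooth V) : V → ℂ) = ∑ i ∈ s, (u i : V → ℂ) :=
    map_sum (Smooth V).subtype u s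
  exact (congrFun this p).trans (Finset.sum_apply p s _)

/-- The derivative in direction `v`. -/
def pd (v : V) : Module.End ℂ (Smooth V) where
  toFun u := ⟨fun p => fderiv ℝ u p v,
    ((contDiff_smooth u).fderiv_right (m := ∞) (by simp)).clm_apply contDiff_const⟩
  map_add' u w := by
    ext p
    change fderiv ℝ ((u : V → ℂ) + (w : V → ℂ)) p v = _
    rw [fderiv_add (differentiable_smooth u p) (differentiable_smooth w p)]
    rfl
  map_smul' c u := by
    ext p
    change fderiv ℝ (c • (u : V → ℂ)) p v = _
    rw [fderiv_const_smul (differentiable_smooth u p)]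
    rfl

theorem pd_apply (v : V) (u : Smooth V) (p : V) : pd v u p = fderiv ℝ u p v := rfl

theorem pd_comm (v w : V) : pd v * pd w = pd w * pd v := by
  ext u p
  have key : ∀ v w, (pd v * pd w) u p = fderiv ℝ (fderiv ℝ u) p v w := by
    intro v w
    change fderiv ℝ (fun q => fderiv ℝ u q w) p v = _
    have hd : DifferentiableAt ℝ (fderiv ℝ u) p :=
      (((contDiff_smooth u).fderiv_right (m := ∞) (by simp)).differentiable (by simp)) p
    rw [fderiv_clm_apply hd (differentiableAt_const w)]
    simp
  rw [key, key]
  exact ((contDiff_smooth u).contDiffAt.isSymmSndFDerivAt (by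
    simp only [minSmoothness_of_isRCLikeNormedField]; exact WithTop.coe_le_coe.mpr (le_top (a := (2 : ℕ∞))))) v w

theorem pd_smul (c : ℝ) (v : V) : pd (c • v) = (c : ℂ) • pd v := by
  ext u p; simp [pd_apply]

theorem pd_sum {ι : Type*} (s : Finset ι) (v : ι → V) : pd (∑ i ∈ s, v i) = ∑ i ∈ s, pd (v i) := by
  ext u p
  simp [pd_apply, map_sum, LinearMap.sum_apply]

/-- The commutative algebra of operators generated by the derivatives in the directions `e s`. -/
abbrev pdAlg (e : σ → V) : Subalgebra ℂ (Module.End ℂ (Smooth V)) :=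
  Algebra.adjoin ℂ (Set.range fun s => pd (e s))

instance pdAlg.isMulCommutative (e : σ → V) : IsMulCommutative (pdAlg e) :=
  Algebra.isMulCommutative_adjoin ℂ (by
    intro x hx y hy
    obtain ⟨s, rfl⟩ := hx
    obtain ⟨t, rfl⟩ := hy
    exact pd_comm _ _)

open scoped IsMulCommutative in
/-- The differential operator with symbol `p`, where the variable `X s` stands for the derivative
in direction `e s`. -/
def symOp (e : σ → V) : MvPolynomial σ ℂ →ₐ[ℂ] Module.End ℂ (Smooth V) :=
  (pdAlg e).val.comp
    (MvPolynomial.aeval fun s => (⟨pd (e s), Algebra.subset_adjoin ⟨s, rfl⟩⟩ : pdAlg e))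

open scoped IsMulCommutative in
@[simp] theorem symOp_X (e : σ → V) (s : σ) : symOp e (MvPolynomial.X s) = pd (e s) := by
  rw [symOp, AlgHom.comp_apply, MvPolynomial.aeval_X]
  rfl

theorem symOp_C (e : σ → V) (c : ℂ) (u : Smooth V) : symOp e (MvPolynomial.C c) u = c • u := by
  have : symOp e (MvPolynomial.C c) = algebraMap ℂ (Module.End ℂ (Smooth V)) c :=
    (symOp e).commutes c
  rw [this, Module.algebraMap_end_apply]

theorem symOp_mul_X (e : σ → V) (p : MvPolynomial σ ℂ) (s : σ) (u : Smooth V) :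
    symOp e (p * MvPolynomial.X s) u = symOp e p (pd (e s) u) := by
  rw [map_mul, symOp_X]; rfl

theorem symOp_X_mul (e : σ → V) (p : MvPolynomial σ ℂ) (s : σ) (u : Smooth V) :
    symOp e (MvPolynomial.X s * p) u = symOp e p (pd (e s) u) := by
  rw [mul_comm, symOp_mul_X]

theorem pd_symOp (e : σ → V) (v : V) (p : MvPolynomial σ ℂ) (u : Smooth V) :
    pd v (symOp e p u) = symOp e p (pd v u) := by
  induction p using MvPolynomial.induction_on generalizing u with
  | C c => rw [symOp_C, symOp_C, map_smul]
  | add p q hp hq => simp only [map_add, LinearMap.add_apply, hp, hq]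
  | mul_X p s hp =>
    rw [symOp_mul_X, symOp_mul_X, hp]
    congr 1
    exact congrArg (fun T : Module.End ℂ (Smooth V) => T u) (pd_comm v (e s))

/-- Composition with the affine map `p ↦ w + S p`. -/
def pull (w : W) (S : V →L[ℝ] W) : Smooth W →ₗ[ℂ] Smooth V where
  toFun u := ⟨fun p => u (w + S p), (contDiff_smooth u).comp (contDiff_const.add S.contDiff)⟩
  map_add' _ _ := rfl
  map_smul' _ _ := rfl

theorem pull_apply (w : W) (S : V →L[ℝ] W) (u : Smooth W) (p : V) : pull w S u p = u (w + S p) :=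
  rfl

theorem pd_pull (w : W) (S : V →L[ℝ] W) (v : V) (u : Smooth W) :
    pd v (pull w S u) = pull w S (pd (S v) u) := by
  ext p
  have h : HasFDerivAt (fun p => u (w + S p)) ((fderiv ℝ u (w + S p)).comp S) p :=
    (differentiable_smooth u _).hasFDerivAt.comp p (S.hasFDerivAt.const_add w)
  change fderiv ℝ (fun p => u (w + S p)) p v = _
  rw [h.fderiv]
  rfl

theorem symOp_pull (e : σ → V) (w : W) (S : V →L[ℝ] W) (p : MvPolynomial σ ℂ) (u : Smooth W) :
    symOp e p (pull w S u) = pull w S (symOp (fun s => S (e s)) p u) := by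
  induction p using MvPolynomial.induction_on generalizing u with
  | C c => rw [symOp_C, symOp_C, map_smul]
  | add p q hp hq => simp only [map_add, LinearMap.add_apply, hp, hq]
  | mul_X p s hp => rw [symOp_mul_X, symOp_mul_X, pd_pull, hp]

theorem symOp_change [Fintype σ] (e e' : σ → V) (c : σ → σ → ℝ)
    (h : ∀ s, e' s = ∑ t, c s t • e t) (p : MvPolynomial σ ℂ) :
    symOp e' p = symOp e (MvPolynomial.aeval
      (fun s => ∑ t, MvPolynomial.C (c s t : ℂ) * MvPolynomial.X t) p) := by
  have : symOp e' = (symOp e).comp (MvPolynomial.aeval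
      (fun s => ∑ t, MvPolynomial.C (c s t : ℂ) * MvPolynomial.X t)) := by
    refine MvPolynomial.algHom_ext fun s => ?_
    rw [symOp_X, AlgHom.comp_apply, MvPolynomial.aeval_X, map_sum, h, pd_sum]
    refine Finset.sum_congr rfl fun t _ => ?_
    rw [pd_smul, ← MvPolynomial.smul_eq_C_mul, map_smul, symOp_X]
  rw [this]; rfl

/-- Multiplication by a linear function. -/
def mulBy (l : V →L[ℝ] ℝ) : Module.End ℂ (Smooth V) where
  toFun u := ⟨fun p => (l p : ℂ) * u p, (Complex.ofRealCLM.contDiff.comp l.contDiff).mul (contDiff_smooth u)⟩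
  map_add' u w := by ext p; exact mul_add _ _ _
  map_smul' c u := by ext p; exact mul_left_comm _ _ _

@[simp] theorem mulBy_apply (l : V →L[ℝ] ℝ) (u : Smooth V) (p : V) :
    mulBy l u p = (l p : ℂ) * u p := rfl

theorem pd_mulBy (v : V) (l : V →L[ℝ] ℝ) (u : Smooth V) :
    pd v (mulBy l u) = mulBy l (pd v u) + (l v : ℂ) • u := by
  ext p
  have h1 : HasFDerivAt (fun p => (l p : ℂ)) (Complex.ofRealCLM.comp l) p :=
    Complex.ofRealCLM.hasFDerivAt.comp p l.hasFDerivAt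
  have h : HasFDerivAt (fun p => (l p : ℂ) * u p) _ p :=
    h1.mul (differentiable_smooth u p).hasFDerivAt
  change fderiv ℝ (fun p => (l p : ℂ) * u p) p v = _
  rw [h.fderiv]
  simp [pd_apply, mul_comm]

/-- Leibniz rule for multiplication by a linear function. -/
theorem symOp_mulBy [Fintype σ] [DecidableEq σ] (e : σ → V) (l : V →L[ℝ] ℝ)
    (p : MvPolynomial σ ℂ) (u : Smooth V) :
    symOp e p (mulBy l u) =
      mulBy l (symOp e p u) + ∑ s, (l (e s) : ℂ) • symOp e (MvPolynomial.pderiv s p) u := by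
  induction p using MvPolynomial.induction_on generalizing u with
  | C c => simp
  | add p q hp hq =>
    simp only [map_add, LinearMap.add_apply, hp, hq, smul_add, Finset.sum_add_distrib]
    abel
  | mul_X p t hp =>
    have h : ∀ s, symOp e (MvPolynomial.pderiv s (p * MvPolynomial.X t)) u =
        (Pi.single t (1 : ℂ) : σ → ℂ) s • symOp e p u +
          symOp e (MvPolynomial.pderiv s p) (pd (e t) u) := by
      intro s
      rw [Derivation.leibniz, MvPolynomial.pderiv_X, smul_eq_mul, smul_eq_mul,
        mul_comm (MvPolynomial.X t), map_add, LinearMap.add_apply, symOp_mul_X]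
      by_cases hs : s = t
      · subst hs; simp
      · simp [hs]
    simp only [symOp_mul_X, pd_mulBy, map_add, hp, map_smul, h, smul_add, Finset.sum_add_distrib,
      smul_smul]
    have h1 : ∑ s, ((l (e s) : ℂ) * (Pi.single t (1 : ℂ) : σ → ℂ) s) • symOp e p u =
        (l (e t) : ℂ) • symOp e p u := by
      rw [Finset.sum_eq_single t]
      · rw [Pi.single_eq_same, mul_one]
      · intro s _ hs; simp [hs]
      · simp
    rw [h1]
    abel

/-- Exponentials of linear functions. -/
def expS (L : V →L[ℝ] ℂ) : Smooth V := ⟨fun p => Complex.exp (L p),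
  (L.contDiff.cexp : ContDiff ℝ ∞ fun p => Complex.exp (L p))⟩

theorem expS_apply (L : V →L[ℝ] ℂ) (p : V) : expS L p = Complex.exp (L p) := rfl

theorem symOp_expS (e : σ → V) (L : V →L[ℝ] ℂ) (p : MvPolynomial σ ℂ) :
    symOp e p (expS L) = MvPolynomial.eval (fun s => L (e s)) p • expS L := by
  induction p using MvPolynomial.induction_on with
  | C c => simp
  | add p q hp hq => simp only [map_add, LinearMap.add_apply, hp, hq, add_smul]
  | mul_X p s hp =>
    have h : pd (e s) (expS L) = L (e s) • expS L := by
      ext q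
      have h1 : HasFDerivAt (fun q => Complex.exp (L q)) (Complex.exp (L q) • L) q :=
        L.hasFDerivAt.cexp
      change fderiv ℝ (fun q => Complex.exp (L q)) q (e s) = _
      rw [h1.fderiv]
      simp [expS_apply, mul_comm]
    rw [symOp_mul_X, h, map_smul, hp, smul_smul, map_mul, MvPolynomial.eval_X, mul_comm]

theorem symOp_congr_of_eventuallyEq (e : σ → V) (p : MvPolynomial σ ℂ) {u v : Smooth V} {a : V}
    (h : (u : V → ℂ) =ᶠ[nhds a] v) : (symOp e p u : V → ℂ) =ᶠ[nhds a] symOp e p v := by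
  induction p using MvPolynomial.induction_on generalizing u v with
  | C c =>
    rw [symOp_C, symOp_C]
    filter_upwards [h] with q hq
    simp [hq]
  | add p q hp hq =>
    filter_upwards [hp h, hq h] with x h1 h2
    simp only [map_add, LinearMap.add_apply, Smooth.add_apply, h1, h2]
  | mul_X p s hp =>
    rw [symOp_mul_X, symOp_mul_X]
    refine hp ?_
    filter_upwards [h.fderiv (𝕜 := ℝ)] with x hx
    rw [pd_apply, pd_apply, hx]

end Smooth

/-! ### Functions of two variables in `ℝⁿ` -/

section TwoVariables

variable {n : ℕ}

/-- The standard basis of `ℝⁿ × ℝⁿ`. -/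
def stdDir (n : ℕ) : Fin n ⊕ Fin n → EuclideanSpace ℝ (Fin n) × EuclideanSpace ℝ (Fin n) :=
  Sum.elim (fun k => (EuclideanSpace.single k 1, 0)) fun k => (0, EuclideanSpace.single k 1)

/-- The standard coordinates on `ℝⁿ × ℝⁿ`. -/
def coord (n : ℕ) (s : Fin n ⊕ Fin n) :
    EuclideanSpace ℝ (Fin n) × EuclideanSpace ℝ (Fin n) →L[ℝ] ℝ :=
  s.elim (fun k => (EuclideanSpace.proj k).comp (ContinuousLinearMap.fst ℝ _ _))
    fun k => (EuclideanSpace.proj k).comp (ContinuousLinearMap.snd ℝ _ _)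

theorem coord_inl (k : Fin n) (p : EuclideanSpace ℝ (Fin n) × EuclideanSpace ℝ (Fin n)) :
    coord n (Sum.inl k) p = p.1 k := rfl

theorem coord_inr (k : Fin n) (p : EuclideanSpace ℝ (Fin n) × EuclideanSpace ℝ (Fin n)) :
    coord n (Sum.inr k) p = p.2 k := rfl

theorem coord_stdDir (s t : Fin n ⊕ Fin n) : coord n s (stdDir n t) = if t = s then 1 else 0 := by
  rcases s with k | k <;> rcases t with l | l <;>
    simp [coord_inl, coord_inr, stdDir, eq_comm]

/-- A smooth function on `ℝⁿ × ℝⁿ` as a function of two variables. -/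
def toFun2 (u : Smooth (EuclideanSpace ℝ (Fin n) × EuclideanSpace ℝ (Fin n))) : Fun2 n :=
  fun x y => u (x, y)

theorem dx_toFun2 (k : Fin n)
    (u : Smooth (EuclideanSpace ℝ (Fin n) × EuclideanSpace ℝ (Fin n))) :
    dx k (toFun2 u) = toFun2 (pd (stdDir n (Sum.inl k)) u) := by
  funext x y
  have h : HasFDerivAt (fun z => u (z, y)) _ x :=
    ((differentiable_smooth u (x, y)).hasFDerivAt).comp x (hasFDerivAt_prodMk_left x y)
  change fderiv ℝ (fun z => u (z, y)) x _ = fderiv ℝ u (x, y) _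
  rw [h.fderiv]
  rfl

theorem dy_toFun2 (k : Fin n)
    (u : Smooth (EuclideanSpace ℝ (Fin n) × EuclideanSpace ℝ (Fin n))) :
    dy k (toFun2 u) = toFun2 (pd (stdDir n (Sum.inr k)) u) := by
  funext x y
  have h : HasFDerivAt (fun z => u (x, z)) _ y :=
    ((differentiable_smooth u (x, y)).hasFDerivAt).comp y (hasFDerivAt_prodMk_right x y)
  change fderiv ℝ (fun z => u (x, z)) y _ = fderiv ℝ u (x, y) _
  rw [h.fderiv]
  rfl

theorem toFun2_symDot (ι κ : Fin n → Fin n ⊕ Fin n)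
    (u : Smooth (EuclideanSpace ℝ (Fin n) × EuclideanSpace ℝ (Fin n))) :
    toFun2 (symOp (stdDir n) (symDot ι κ) u) =
      ∑ k, toFun2 (pd (stdDir n (ι k)) (pd (stdDir n (κ k)) u)) := by
  funext x y
  rw [Finset.sum_apply, Finset.sum_apply, symDot, map_sum, LinearMap.sum_apply, toFun2,
    Smooth.sum_apply]
  refine Finset.sum_congr rfl fun k _ => ?_
  rw [symOp_mul_X, symOp_X]
  rfl

theorem lapX_toFun2 (u : Smooth (EuclideanSpace ℝ (Fin n) × EuclideanSpace ℝ (Fin n))) :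
    lapX (toFun2 u) = toFun2 (symOp (stdDir n) (symDot Sum.inl Sum.inl) u) := by
  simp only [lapX, dx_toFun2, toFun2_symDot]

theorem lapY_toFun2 (u : Smooth (EuclideanSpace ℝ (Fin n) × EuclideanSpace ℝ (Fin n))) :
    lapY (toFun2 u) = toFun2 (symOp (stdDir n) (symDot Sum.inr Sum.inr) u) := by
  simp only [lapY, dy_toFun2, toFun2_symDot]

theorem mixed_toFun2 (u : Smooth (EuclideanSpace ℝ (Fin n) × EuclideanSpace ℝ (Fin n))) :
    mixed (toFun2 u) = toFun2 (symOp (stdDir n) (symDot Sum.inl Sum.inr) u) := by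
  simp only [mixed, dy_toFun2, dx_toFun2, toFun2_symDot]

theorem iterate_toFun2 {T : Fun2 n → Fun2 n} {q : Symb n}
    (hT : ∀ u, T (toFun2 u) = toFun2 (symOp (stdDir n) q u)) (m : ℕ)
    (u : Smooth (EuclideanSpace ℝ (Fin n) × EuclideanSpace ℝ (Fin n))) :
    T^[m] (toFun2 u) = toFun2 (symOp (stdDir n) (q ^ m) u) := by
  induction m generalizing u with
  | zero => simp
  | succ m ih => rw [Function.iterate_succ_apply, hT, ih, pow_succ, map_mul]; rfl

/-- The operator of the non-compact picture is the one with symbol `symbol n N a`. -/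
theorem sum_iterate_toFun2 (N : ℕ) (a : ℕ → ℕ → ℂ)
    (u : Smooth (EuclideanSpace ℝ (Fin n) × EuclideanSpace ℝ (Fin n)))
    (x y : EuclideanSpace ℝ (Fin n)) :
    ∑ i ∈ Finset.range (N + 1), ∑ j ∈ Finset.range (N + 1 - i),
        a i j * (lapX^[i] (lapY^[j] (mixed^[N - i - j] (toFun2 u)))) x y =
      symOp (stdDir n) (symbol n N a) u (x, y) := by
  rw [symbol, map_triSum, triSum]
  simp only [LinearMap.sum_apply, Smooth.sum_apply]
  refine Finset.sum_congr rfl fun i _ => Finset.sum_congr rfl fun j _ => ?_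
  rw [iterate_toFun2 mixed_toFun2, iterate_toFun2 lapY_toFun2, iterate_toFun2 lapX_toFun2,
    ← MvPolynomial.smul_eq_C_mul, map_smul, map_mul, map_mul]
  rfl

/-- The action of the `k`-th generator of `𝔫` on functions, in the coordinates with indices `ι l`:
the operator `x_k ∑ x_l ∂_l - ½ |x|² ∂_k - λ x_k`. -/
def confOp (ι : Fin n → Fin n ⊕ Fin n) (lam : ℂ) (k : Fin n) :
    Module.End ℂ (Smooth (EuclideanSpace ℝ (Fin n) × EuclideanSpace ℝ (Fin n))) :=
  ∑ l, mulBy (coord n (ι k)) * (mulBy (coord n (ι l)) * pd (stdDir n (ι l))) -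
    (1 / 2 : ℂ) • ∑ l, mulBy (coord n (ι l)) * (mulBy (coord n (ι l)) * pd (stdDir n (ι k))) -
    lam • mulBy (coord n (ι k))

theorem symOp_mulBy_coord (p : Symb n) (s : Fin n ⊕ Fin n)
    (u : Smooth (EuclideanSpace ℝ (Fin n) × EuclideanSpace ℝ (Fin n))) :
    symOp (stdDir n) p (mulBy (coord n s) u) 0 =
      symOp (stdDir n) (MvPolynomial.pderiv s p) u 0 := by
  rw [symOp_mulBy, Smooth.add_apply, mulBy_apply, map_zero, Smooth.sum_apply,
    Finset.sum_eq_single s]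
  · simp [coord_stdDir]
  · intro t _ ht
    simp [coord_stdDir, ht]
  · simp

/-- `nilOp` is the transpose of `confOp`. -/
theorem symOp_confOp (ι : Fin n → Fin n ⊕ Fin n) (lam : ℂ) (k : Fin n) (p : Symb n)
    (u : Smooth (EuclideanSpace ℝ (Fin n) × EuclideanSpace ℝ (Fin n))) :
    symOp (stdDir n) p (confOp ι lam k u) 0 = symOp (stdDir n) (nilOp ι lam k p) u 0 := by
  simp only [confOp, nilOp, LinearMap.sub_apply, LinearMap.sum_apply, LinearMap.smul_apply,
    map_sub, map_sum, map_smul, Smooth.sub_apply, Smooth.sum_apply, Smooth.smul_apply,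
    Module.End.mul_apply, symOp_mulBy_coord, symOp_X_mul, Finset.mul_sum]

/-- The function `(x, y) ↦ φ(x) ψ(y)`. -/
def tensor (φ ψ : Smooth (EuclideanSpace ℝ (Fin n))) :
    Smooth (EuclideanSpace ℝ (Fin n) × EuclideanSpace ℝ (Fin n)) :=
  ⟨fun p => φ p.1 * ψ p.2,
    (((contDiff_smooth φ).comp contDiff_fst).mul ((contDiff_smooth ψ).comp contDiff_snd) :
      ContDiff ℝ ∞ fun p : EuclideanSpace ℝ (Fin n) × EuclideanSpace ℝ (Fin n) => φ p.1 * ψ p.2)⟩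

theorem tensor_apply (φ ψ : Smooth (EuclideanSpace ℝ (Fin n)))
    (p : EuclideanSpace ℝ (Fin n) × EuclideanSpace ℝ (Fin n)) :
    tensor φ ψ p = φ p.1 * ψ p.2 := rfl

end TwoVariables

/-! ### The big cell and smoothness along maps into the group -/

section Group

variable {n : ℕ}

/-- The index of the `k`-th coordinate of `v'`. -/
abbrev iMid (k : Fin n) : Idx n := Sum.inr (Sum.inl k)

theorem idx_ext {α : Type*} {v w : Idx n → α} (h1 : v (iPlus n) = w (iPlus n))
    (h2 : ∀ k, v (iMid k) = w (iMid k)) (h3 : v (iMinus n) = w (iMinus n)) : v = w := by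
  funext i
  rcases i with ⟨⟩ | k | ⟨⟩
  exacts [h1, h2 k, h3]

/-- The vector `g e₊`. -/
def col (g : SOo n) : Idx n → ℝ := mat g *ᵥ ePlus n

theorem col_apply (g : SOo n) (i : Idx n) : col g i = mat g i (iPlus n) := by
  simp [col, ePlus]

theorem col_mul (g h : SOo n) : col (g * h) = mat g *ᵥ col h := by
  rw [col, col, mat_mul, Matrix.mulVec_mulVec]

theorem col_mem (g : SOo n) : col g ∈ futureCone n :=
  (g.2.2 (ePlus n)).mpr ((mem_futureCone_iff n _).mpr
    ⟨by simp [quad, ePlus], by simp [ePlus], by simp [ePlus]⟩)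

theorem col_quad (g : SOo n) : ∑ k, col g (iMid k) ^ 2 = 2 * col g (iPlus n) * col g (iMinus n) :=
  sub_eq_zero.mp (col_mem g).1

theorem col_plus_nonneg (g : SOo n) : 0 ≤ col g (iPlus n) :=
  ((mem_futureCone_iff n _).mp (col_mem g)).2.1

theorem chi_eq (w : ℂ) (g : SOo n) : chi n w g = ((col g (iPlus n) : ℝ) : ℂ) ^ w := by
  rw [chi, col_apply]

theorem ePlus_plus : ePlus n (iPlus n) = 1 := by simp [ePlus]
theorem ePlus_mid (k : Fin n) : ePlus n (iMid k) = 0 := by simp [ePlus]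
theorem ePlus_minus : ePlus n (iMinus n) = 0 := by simp [ePlus]

theorem mat_nbar (x : EuclideanSpace ℝ (Fin n)) : mat (nbar n x) = nbarMat n x := rfl

theorem col_nbar_plus (x : EuclideanSpace ℝ (Fin n)) : col (nbar n x) (iPlus n) = 1 := by
  rw [col, mat_nbar, nbarMat_plus, ePlus_plus]

theorem col_nbar_mid (x : EuclideanSpace ℝ (Fin n)) (k : Fin n) :
    col (nbar n x) (iMid k) = x k := by
  rw [col, mat_nbar, nbarMat_mid, ePlus_plus, ePlus_mid]; ring

theorem col_nbar_minus (x : EuclideanSpace ℝ (Fin n)) :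
    col (nbar n x) (iMinus n) = (∑ k, x k ^ 2) / 2 := by
  rw [col, mat_nbar, nbarMat_minus, ePlus_plus, ePlus_minus]
  simp [ePlus_mid]

theorem SOo_ext {g h : SOo n} (H : ∀ v, mat g *ᵥ v = mat h *ᵥ v) : g = h :=
  Subtype.ext (Subtype.ext (Matrix.mulVec_injective (funext H)))

theorem nbar_add (x y : EuclideanSpace ℝ (Fin n)) : nbar n (x + y) = nbar n x * nbar n y := by
  refine SOo_ext fun v => ?_
  rw [mat_mul, ← Matrix.mulVec_mulVec]
  simp only [mat_nbar]
  refine idx_ext ?_ (fun k => ?_) ?_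
  · simp only [nbarMat_plus]
  · simp only [nbarMat_plus, nbarMat_mid, PiLp.add_apply]; ring
  · have h1 : ∑ k, (x k + y k) ^ 2 = ∑ k, x k ^ 2 + 2 * ∑ k, x k * y k + ∑ k, y k ^ 2 := by
      rw [Finset.mul_sum, ← Finset.sum_add_distrib, ← Finset.sum_add_distrib]
      exact Finset.sum_congr rfl fun k _ => by ring
    have h2 : ∑ k, (x k + y k) * v (iMid k) = ∑ k, x k * v (iMid k) + ∑ k, y k * v (iMid k) := by
      rw [← Finset.sum_add_distrib]
      exact Finset.sum_congr rfl fun k _ => by ring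
    have h3 : ∑ k, x k * (v (iMid k) + y k * v (iPlus n)) =
        ∑ k, x k * v (iMid k) + (∑ k, x k * y k) * v (iPlus n) := by
      rw [Finset.sum_mul, ← Finset.sum_add_distrib]
      exact Finset.sum_congr rfl fun k _ => by ring
    simp only [nbarMat_plus, nbarMat_mid, nbarMat_minus, PiLp.add_apply, h1, h2, h3]
    ring

theorem nbar_zero : nbar n 0 = 1 := by
  have := nbar_add (n := n) 0 0
  rw [add_zero] at this
  exact (mul_eq_left.mp this.symm)

theorem nbar_mul_neg (x : EuclideanSpace ℝ (Fin n)) : nbar n x * nbar n (-x) = 1 := by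
  rw [← nbar_add, add_neg_cancel, nbar_zero]

/-- The coordinate in `N₋` of an element of the big cell `N₋ P`. -/
def cellPt (v : Idx n → ℝ) : EuclideanSpace ℝ (Fin n) :=
  WithLp.toLp 2 fun k => v (iMid k) / v (iPlus n)

theorem cellPt_apply (v : Idx n → ℝ) (k : Fin n) : cellPt v k = v (iMid k) / v (iPlus n) := rfl

/-- Sections on the big cell `{q | 0 < q_{++}} = N₋ P`. -/
theorem section_bigCell {w : ℂ} (f : Sections n w) (g q : SOo n) (hq : 0 < col q (iPlus n)) :
    (f : SOo n → ℂ) (g * q) =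
      (((col q (iPlus n) : ℝ) : ℂ) ^ w)⁻¹ * (f : SOo n → ℂ) (g * nbar n (cellPt (col q))) := by
  set x := cellPt (col q) with hx
  set p := nbar n (-x) * q with hp
  have hqp : q = nbar n x * p := by rw [hp, ← mul_assoc, nbar_mul_neg, one_mul]
  have hmid : ∀ k, col q (iMid k) = x k * col q (iPlus n) := fun k => by
    rw [hx, cellPt_apply]; field_simp
  have hcol : col p = col q (iPlus n) • ePlus n := by
    rw [hp, col_mul, mat_nbar]
    refine idx_ext ?_ (fun k => ?_) ?_
    · rw [nbarMat_plus]; simp [ePlus_plus]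
    · rw [nbarMat_mid, hmid k]; simp [ePlus_mid]
    · have h1 := col_quad q
      have h2 : ∑ k, col q (iMid k) ^ 2 = (∑ k, x k ^ 2) * col q (iPlus n) ^ 2 := by
        rw [Finset.sum_mul]
        exact Finset.sum_congr rfl fun k _ => by rw [hmid]; ring
      have h3 : ∑ k, (-x) k * col q (iMid k) = -(∑ k, x k ^ 2) * col q (iPlus n) := by
        rw [neg_mul, Finset.sum_mul, ← Finset.sum_neg_distrib]
        exact Finset.sum_congr rfl fun k _ => by rw [hmid, PiLp.neg_apply]; ring
      have h4 : ∑ k, (-x) k ^ 2 = ∑ k, x k ^ 2 :=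
        Finset.sum_congr rfl fun k _ => by rw [PiLp.neg_apply]; ring
      rw [nbarMat_minus, h3, h4]
      simp only [Pi.smul_apply, ePlus_minus, smul_zero]
      have h5 : (∑ k, x k ^ 2) * col q (iPlus n) = 2 * col q (iMinus n) :=
        mul_right_cancel₀ hq.ne' (by rw [h2] at h1; linear_combination h1)
      linear_combination -(1 / 2) * h5
  have hpar : p ∈ Par n := ⟨col q (iPlus n), hq, hcol⟩
  conv_lhs => rw [hqp, ← mul_assoc, f.2.1 (g * nbar n x) p hpar, chi_eq, hcol]
  simp [ePlus_plus]

theorem contDiffAt_ofReal_cpow_const (w : ℂ) {r : ℝ} (hr : 0 < r) :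
    ContDiffAt ℝ ∞ (fun r : ℝ => (r : ℂ) ^ w) r := by
  have h : ContDiffAt ℝ ∞ (fun r : ℝ => Complex.exp ((Real.log r : ℂ) * w)) r :=
    ((Complex.ofRealCLM.contDiff.contDiffAt.comp r
      (Real.contDiffAt_log.mpr hr.ne')).mul contDiffAt_const).cexp
  refine h.congr_of_eventuallyEq ?_
  filter_upwards [lt_mem_nhds hr] with s hs
  rw [Complex.cpow_def_of_ne_zero (by exact_mod_cast hs.ne'), Complex.ofReal_log hs.le]

theorem contDiffAt_cellPt {M : Type*} [NormedAddCommGroup M] [NormedSpace ℝ M]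
    {v : M → Idx n → ℝ} {m : M} (hv : ∀ i, ContDiffAt ℝ ∞ (fun m => v m i) m)
    (h : v m (iPlus n) ≠ 0) : ContDiffAt ℝ ∞ (fun m => cellPt (v m)) m :=
  contDiffAt_euclidean.mpr fun k => (hv (iMid k)).div (hv (iPlus n)) h

/-- Sections are smooth along all smooth maps into the group. -/
theorem contDiff_section_comp {w : ℂ} (f : Sections n w) {M : Type*} [NormedAddCommGroup M]
    [NormedSpace ℝ M] (γ : M → SOo n) (hγ : ∀ i, ContDiff ℝ ∞ fun m => col (γ m) i) :
    ContDiff ℝ ∞ fun m => (f : SOo n → ℂ) (γ m) := by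
  rw [contDiff_iff_contDiffAt]
  intro m₀
  set q : M → SOo n := fun m => (γ m₀)⁻¹ * γ m with hq
  have hqs : ∀ i, ContDiff ℝ ∞ fun m => col (q m) i := by
    intro i
    simp only [hq, col_mul, Matrix.mulVec, dotProduct]
    exact ContDiff.sum fun j _ => contDiff_const.mul (hγ j)
  have hq0 : col (q m₀) (iPlus n) = 1 := by
    simp only [hq, inv_mul_cancel]
    rw [col, mat_one, Matrix.one_mulVec, ePlus_plus]
  have hpos : ∀ᶠ m in nhds m₀, 0 < col (q m) (iPlus n) :=
    (hqs (iPlus n)).continuous.continuousAt.eventually (lt_mem_nhds (by simp only [hq0, one_pos]))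
  have h1 : ContDiffAt ℝ ∞ (fun m => (((col (q m) (iPlus n) : ℝ) : ℂ) ^ w)⁻¹ *
      (f : SOo n → ℂ) (γ m₀ * nbar n (cellPt (col (q m))))) m₀ := by
    refine ContDiffAt.mul (ContDiffAt.inv ?_ ?_) ?_
    · exact ContDiffAt.comp m₀ (g := fun r : ℝ => (r : ℂ) ^ w)
        (f := fun m => col (q m) (iPlus n))
        (contDiffAt_ofReal_cpow_const w (by rw [hq0]; exact one_pos)) (hqs _).contDiffAt
    · rw [hq0]; simp
    · exact ContDiffAt.comp m₀ (g := fun x => (f : SOo n → ℂ) (γ m₀ * nbar n x))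
        (f := fun m => cellPt (col (q m))) (f.2.2 (γ m₀)).contDiffAt
        (contDiffAt_cellPt (fun i => (hqs i).contDiffAt) (by rw [hq0]; exact one_ne_zero))
  refine h1.congr_of_eventuallyEq ?_
  filter_upwards [hpos] with m hm
  rw [← section_bigCell f (γ m₀) (q m) hm, hq, mul_inv_cancel_left]

/-! ### The nilradical -/

/-- The permutation of the indices that exchanges `v₊` and `v₋`. -/
def flipIdx (n : ℕ) : Equiv.Perm (Idx n) where
  toFun := Sum.elim (fun _ => iMinus n) (Sum.elim iMid fun _ => iPlus n)
  invFun := Sum.elim (fun _ => iMinus n) (Sum.elim iMid fun _ => iPlus n)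
  left_inv := by rintro (⟨⟩ | k | ⟨⟩) <;> rfl
  right_inv := by rintro (⟨⟩ | k | ⟨⟩) <;> rfl

/-- The matrix of the element `exp b` of `N`, for `b ∈ 𝔫 = ℝⁿ`. -/
def nuMat (b : EuclideanSpace ℝ (Fin n)) : Matrix (Idx n) (Idx n) ℝ :=
  (nbarMat n b).submatrix (flipIdx n) (flipIdx n)

theorem nuMat_mulVec (b : EuclideanSpace ℝ (Fin n)) (v : Idx n → ℝ) :
    nuMat b *ᵥ v = (nbarMat n b *ᵥ (v ∘ flipIdx n)) ∘ flipIdx n := by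
  rw [nuMat, Matrix.submatrix_mulVec_equiv]
  rfl

theorem nuMat_minus (b : EuclideanSpace ℝ (Fin n)) (v : Idx n → ℝ) :
    (nuMat b *ᵥ v) (iMinus n) = v (iMinus n) := by
  rw [nuMat_mulVec]; exact nbarMat_plus n b _

theorem nuMat_mid (b : EuclideanSpace ℝ (Fin n)) (v : Idx n → ℝ) (k : Fin n) :
    (nuMat b *ᵥ v) (iMid k) = v (iMid k) + b k * v (iMinus n) := by
  rw [nuMat_mulVec]; exact nbarMat_mid n b _ k

theorem nuMat_plus (b : EuclideanSpace ℝ (Fin n)) (v : Idx n → ℝ) :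
    (nuMat b *ᵥ v) (iPlus n) = v (iPlus n) +
      ∑ k, b k * v (iMid k) + (∑ k, b k ^ 2) / 2 * v (iMinus n) := by
  rw [nuMat_mulVec]; exact nbarMat_minus n b _

theorem quad_flip (v : Idx n → ℝ) : quad n (v ∘ flipIdx n) = quad n v := by
  change ∑ k : Fin n, v (iMid k) ^ 2 - 2 * v (iMinus n) * v (iPlus n) = _
  rw [quad]; ring

theorem flip_mem_futureCone (v : Idx n → ℝ) : v ∘ flipIdx n ∈ futureCone n ↔ v ∈ futureCone n := by
  change quad n (v ∘ flipIdx n) = 0 ∧ 0 < v (iMinus n) + v (iPlus n) ↔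
    quad n v = 0 ∧ 0 < v (iPlus n) + v (iMinus n)
  rw [quad_flip, add_comm]

/-- The element `exp b` of `N`, for `b ∈ 𝔫 = ℝⁿ`. -/
def nu (b : EuclideanSpace ℝ (Fin n)) : SOo n :=
  ⟨⟨nuMat b, by rw [nuMat, Matrix.det_submatrix_equiv_self, nbarMat_det]⟩,
    fun v => by
      change quad n (nuMat b *ᵥ v) = _
      rw [nuMat_mulVec, quad_flip, quad_nbarMat, quad_flip],
    fun v => by
      change nuMat b *ᵥ v ∈ _ ↔ _
      rw [nuMat_mulVec, flip_mem_futureCone, nbarMat_cone, flip_mem_futureCone]⟩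

theorem mat_nu (b : EuclideanSpace ℝ (Fin n)) : mat (nu b) = nuMat b := rfl

theorem nu_add (x y : EuclideanSpace ℝ (Fin n)) : nu (x + y) = nu x * nu y := by
  refine SOo_ext fun v => ?_
  rw [mat_mul, ← Matrix.mulVec_mulVec]
  simp only [mat_nu, nuMat_mulVec]
  have h := congrArg (fun g : SOo n => mat g *ᵥ (v ∘ flipIdx n)) (nbar_add x y)
  simp only [mat_mul, ← Matrix.mulVec_mulVec, mat_nbar] at h
  rw [h]
  congr 2
  funext i
  simp only [Function.comp_apply]
  congr 1
  rcases i with ⟨⟩ | k | ⟨⟩ <;> rfl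

theorem nu_zero : nu (0 : EuclideanSpace ℝ (Fin n)) = 1 := by
  have := nu_add (n := n) 0 0
  rw [add_zero] at this
  exact (mul_eq_left.mp this.symm)

end Group

/-! ### The structure of the parabolic subgroup -/

section Levi

variable {n : ℕ}

/-- The bilinear form of signature `(n+1,1)`. -/
def bilin (v w : Idx n → ℝ) : ℝ :=
  ∑ k : Fin n, v (iMid k) * w (iMid k) - v (iPlus n) * w (iMinus n) - v (iMinus n) * w (iPlus n)

theorem quad_add (v w : Idx n → ℝ) : quad n (v + w) = quad n v + quad n w + 2 * bilin v w := by
  have h : ∑ k : Fin n, (v (iMid k) + w (iMid k)) ^ 2 = ∑ k : Fin n, v (iMid k) ^ 2 +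
      ∑ k : Fin n, w (iMid k) ^ 2 + 2 * ∑ k : Fin n, v (iMid k) * w (iMid k) := by
    rw [Finset.mul_sum, ← Finset.sum_add_distrib, ← Finset.sum_add_distrib]
    exact Finset.sum_congr rfl fun k _ => by ring
  simp only [quad, bilin, Pi.add_apply, h]
  ring

theorem bilin_mulVec (g : SOo n) (v w : Idx n → ℝ) :
    bilin (mat g *ᵥ v) (mat g *ᵥ w) = bilin v w := by
  have h1 : quad n (mat g *ᵥ (v + w)) = quad n (v + w) := g.2.1 _
  have h2 : quad n (mat g *ᵥ v) = quad n v := g.2.1 _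
  have h3 : quad n (mat g *ᵥ w) = quad n w := g.2.1 _
  rw [Matrix.mulVec_add, quad_add, quad_add, h2, h3] at h1
  linarith

/-- The null vector `e₋`. -/
def eMinus (n : ℕ) : Idx n → ℝ := Pi.single (iMinus n) 1

theorem eMinus_plus : eMinus n (iPlus n) = 0 := by simp [eMinus]
theorem eMinus_mid (k : Fin n) : eMinus n (iMid k) = 0 := by simp [eMinus]
theorem eMinus_minus : eMinus n (iMinus n) = 1 := by simp [eMinus]

theorem bilin_ePlus (v : Idx n → ℝ) : bilin v (ePlus n) = -v (iMinus n) := by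
  simp [bilin, ePlus_plus, ePlus_mid, ePlus_minus]

theorem bilin_eMinus (v : Idx n → ℝ) : bilin v (eMinus n) = -v (iPlus n) := by
  simp [bilin, eMinus_plus, eMinus_mid, eMinus_minus]

theorem bilin_smul_right (c : ℝ) (v w : Idx n → ℝ) : bilin v (c • w) = c * bilin v w := by
  simp only [bilin, Pi.smul_apply, smul_eq_mul, mul_sub, Finset.mul_sum]
  congr 1
  · congr 1
    · exact Finset.sum_congr rfl fun k _ => by ring
    · ring
  · ring

/-- The vector of `ℝ × ℝⁿ × ℝ` with `v' = y`, `v₊ = v₋ = 0`. -/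
def midVec (y : Fin n → ℝ) : Idx n → ℝ := Sum.elim 0 (Sum.elim y 0)

theorem midVec_plus (y : Fin n → ℝ) : midVec y (iPlus n) = 0 := rfl
theorem midVec_mid (y : Fin n → ℝ) (k : Fin n) : midVec y (iMid k) = y k := rfl
theorem midVec_minus (y : Fin n → ℝ) : midVec y (iMinus n) = 0 := rfl

/-- An element of the Levi subgroup `MA`: it scales `e₊` by `a`, scales `e₋` by `a⁻¹`, and acts by
the matrix `R` on `ℝⁿ`. -/
structure IsLevi (q : SOo n) (a : ℝ) (R : Matrix (Fin n) (Fin n) ℝ) : Prop where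
  pos : 0 < a
  orth : R * Rᵀ = 1
  plus : mat q *ᵥ ePlus n = a • ePlus n
  minus : mat q *ᵥ eMinus n = a⁻¹ • eMinus n
  mid : ∀ y, mat q *ᵥ midVec y = midVec (R *ᵥ y)

/-- The Levi decomposition `P = N (M A)`. -/
theorem par_decomp {p : SOo n} (hp : p ∈ Par n) :
    ∃ (b : EuclideanSpace ℝ (Fin n)) (q : SOo n) (a : ℝ) (R : Matrix (Fin n) (Fin n) ℝ),
      p = nu b * q ∧ IsLevi q a R ∧ col p (iPlus n) = a := by
  obtain ⟨a, ha, hpa⟩ := hp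
  set v := mat p *ᵥ eMinus n with hv
  have hvm : v (iMinus n) = a⁻¹ := by
    have h := bilin_mulVec p (eMinus n) (ePlus n)
    rw [hpa, bilin_smul_right, bilin_ePlus, bilin_ePlus, eMinus_minus, ← hv] at h
    field_simp
    linarith
  have hvq : ∑ k, v (iMid k) ^ 2 = 2 * v (iPlus n) * v (iMinus n) := by
    have h : quad n v = quad n (eMinus n) := p.2.1 _
    have h0 : quad n (eMinus n) = 0 := by simp [quad, eMinus]
    rw [h0] at h
    exact sub_eq_zero.mp h
  set b : EuclideanSpace ℝ (Fin n) := WithLp.toLp 2 fun k => a * v (iMid k) with hb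
  have hbk : ∀ k, b k = a * v (iMid k) := fun _ => rfl
  set q := nu (-b) * p with hq
  have hpq : p = nu b * q := by
    rw [hq, ← mul_assoc, ← nu_add, add_neg_cancel, nu_zero, one_mul]
  have hplus : mat q *ᵥ ePlus n = a • ePlus n := by
    rw [hq, mat_mul, ← Matrix.mulVec_mulVec, hpa, mat_nu]
    refine idx_ext ?_ (fun k => ?_) ?_
    · rw [nuMat_plus]; simp [ePlus_plus, ePlus_mid, ePlus_minus]
    · rw [nuMat_mid]; simp [ePlus_mid, ePlus_minus]
    · rw [nuMat_minus]
  have hminus : mat q *ᵥ eMinus n = a⁻¹ • eMinus n := by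
    rw [hq, mat_mul, ← Matrix.mulVec_mulVec, ← hv, mat_nu]
    refine idx_ext ?_ (fun k => ?_) ?_
    · have h1 : ∑ k, (-b) k * v (iMid k) = -a * ∑ k, v (iMid k) ^ 2 := by
        rw [Finset.mul_sum]
        exact Finset.sum_congr rfl fun k _ => by rw [PiLp.neg_apply, hbk]; ring
      have h2 : ∑ k, (-b) k ^ 2 = a ^ 2 * ∑ k, v (iMid k) ^ 2 := by
        rw [Finset.mul_sum]
        exact Finset.sum_congr rfl fun k _ => by rw [PiLp.neg_apply, hbk]; ring
      rw [nuMat_plus, h1, h2, hvq, hvm]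
      simp only [Pi.smul_apply, eMinus_plus, smul_zero]
      field_simp
      ring
    · rw [nuMat_mid, hvm, PiLp.neg_apply, hbk]
      simp only [Pi.smul_apply, eMinus_mid, smul_zero]
      field_simp
      ring
    · rw [nuMat_minus, hvm]; simp [eMinus_minus]
  have hmp : ∀ y, (mat q *ᵥ midVec y) (iPlus n) = 0 := fun y => by
    have h := bilin_mulVec q (midVec y) (eMinus n)
    rw [hminus, bilin_smul_right, bilin_eMinus, bilin_eMinus, midVec_plus, neg_zero] at h
    simpa [ha.ne'] using h
  have hmm : ∀ y, (mat q *ᵥ midVec y) (iMinus n) = 0 := fun y => by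
    have h := bilin_mulVec q (midVec y) (ePlus n)
    rw [hplus, bilin_smul_right, bilin_ePlus, bilin_ePlus, midVec_minus, neg_zero] at h
    simpa [ha.ne'] using h
  set R : Matrix (Fin n) (Fin n) ℝ := Matrix.of fun k l => mat q (iMid k) (iMid l) with hR
  have hmid : ∀ y, mat q *ᵥ midVec y = midVec (R *ᵥ y) := fun y => by
    refine idx_ext (hmp y) (fun k => ?_) (hmm y)
    rw [midVec_mid]
    simp [Matrix.mulVec, dotProduct, hR, midVec, Fintype.sum_sum_type]
  have horth : Rᵀ * R = 1 := by
    ext k l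
    have h := bilin_mulVec q (midVec (Pi.single k 1)) (midVec (Pi.single l 1))
    rw [hmid, hmid] at h
    simp only [bilin, midVec_plus, midVec_minus, midVec_mid, mul_zero, sub_zero,
      Matrix.mulVec_single_one, Matrix.col_apply] at h
    rw [Matrix.mul_apply, Matrix.one_apply]
    simp only [Matrix.transpose_apply]
    rw [h]
    simp [Pi.single_apply, eq_comm]
  refine ⟨b, q, a, R, hpq, ⟨ha, mul_eq_one_comm.mp horth, hplus, hminus, hmid⟩, ?_⟩
  rw [col, hpa]; simp [ePlus_plus]

theorem IsLevi.col_mul_nbar {q : SOo n} {a : ℝ} {R : Matrix (Fin n) (Fin n) ℝ} (h : IsLevi q a R)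
    (x : EuclideanSpace ℝ (Fin n)) :
    col (q * nbar n x) =
      a • ePlus n + midVec (R *ᵥ fun k => x k) + ((∑ k, x k ^ 2) / 2 * a⁻¹) • eMinus n := by
  have hx : col (nbar n x) = ePlus n + midVec (fun k => x k) + ((∑ k, x k ^ 2) / 2) • eMinus n := by
    refine idx_ext ?_ (fun k => ?_) ?_
    · rw [col_nbar_plus]; simp [ePlus_plus, midVec_plus, eMinus_plus]
    · rw [col_nbar_mid]; simp [ePlus_mid, midVec_mid, eMinus_mid]
    · rw [col_nbar_minus]; simp [ePlus_minus, midVec_minus, eMinus_minus]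
  rw [col_mul, hx, Matrix.mulVec_add, Matrix.mulVec_add, Matrix.mulVec_smul, h.plus, h.minus, h.mid,
    smul_smul]

/-- The linear map `x ↦ a⁻¹ R x` by which an element of the Levi subgroup acts on `𝔫₋`. -/
def leviMap (a : ℝ) (R : Matrix (Fin n) (Fin n) ℝ) :
    EuclideanSpace ℝ (Fin n) →L[ℝ] EuclideanSpace ℝ (Fin n) :=
  a⁻¹ • LinearMap.toContinuousLinearMap (Matrix.toEuclideanLin R)

theorem leviMap_apply (a : ℝ) (R : Matrix (Fin n) (Fin n) ℝ) (x : EuclideanSpace ℝ (Fin n))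
    (k : Fin n) : leviMap a R x k = a⁻¹ * (R *ᵥ fun k => x k) k := rfl

/-- The action of the Levi subgroup on sections in the non-compact picture. -/
theorem section_levi {w : ℂ} (f : Sections n w) (g : SOo n) {q : SOo n} {a : ℝ}
    {R : Matrix (Fin n) (Fin n) ℝ} (h : IsLevi q a R) (x : EuclideanSpace ℝ (Fin n)) :
    (f : SOo n → ℂ) (g * q * nbar n x) =
      ((a : ℂ) ^ w)⁻¹ * (f : SOo n → ℂ) (g * nbar n (leviMap a R x)) := by
  have hp : col (q * nbar n x) (iPlus n) = a := by
    rw [h.col_mul_nbar]; simp [ePlus_plus, midVec_plus, eMinus_plus]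
  have hc : cellPt (col (q * nbar n x)) = leviMap a R x := by
    ext k
    rw [cellPt_apply, leviMap_apply, hp, h.col_mul_nbar]
    simp [ePlus_mid, midVec_mid, eMinus_mid]
    ring
  rw [mul_assoc, section_bigCell f g _ (by rw [hp]; exact h.pos), hp, hc]

end Levi

/-! ### The action of `𝔫` on sections in the non-compact picture -/

section Nilradical

variable {n : ℕ}

/-- A section in the chart of `G / P` centered at `g`. -/
def secFun {w : ℂ} (f : Sections n w) (g : SOo n) : Smooth (EuclideanSpace ℝ (Fin n)) :=
  ⟨fun x => (f : SOo n → ℂ) (g * nbar n x), f.2.2 g⟩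

theorem secFun_apply {w : ℂ} (f : Sections n w) (g : SOo n) (x : EuclideanSpace ℝ (Fin n)) :
    secFun f g x = (f : SOo n → ℂ) (g * nbar n x) := rfl

/-- The function `(x, y) ↦ f(x) h(y)` in the chart centered at `g`. -/
def secPair {w₁ w₂ : ℂ} (f : Sections n w₁) (h : Sections n w₂) (g : SOo n) :
    Smooth (EuclideanSpace ℝ (Fin n) × EuclideanSpace ℝ (Fin n)) :=
  tensor (secFun f g) (secFun h g)

theorem secPair_apply {w₁ w₂ : ℂ} (f : Sections n w₁) (h : Sections n w₂) (g : SOo n)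
    (p : EuclideanSpace ℝ (Fin n) × EuclideanSpace ℝ (Fin n)) :
    secPair f h g p = (f : SOo n → ℂ) (g * nbar n p.1) * (h : SOo n → ℂ) (g * nbar n p.2) := rfl

theorem col_nu_nbar (b x : EuclideanSpace ℝ (Fin n)) :
    col (nu b * nbar n x) (iPlus n) =
      1 + ∑ k, b k * x k + (∑ k, b k ^ 2) / 2 * ((∑ k, x k ^ 2) / 2) ∧
    ∀ k, col (nu b * nbar n x) (iMid k) = x k + b k * ((∑ k, x k ^ 2) / 2) := by
  constructor
  · rw [col_mul, mat_nu, nuMat_plus, col_nbar_plus, col_nbar_minus]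
    simp only [col_nbar_mid]
  · intro k
    rw [col_mul, mat_nu, nuMat_mid, col_nbar_mid, col_nbar_minus]

/-- The infinitesimal action of `𝔫` on sections in the non-compact picture. -/
theorem hasDerivAt_section_nu {lam : ℂ} (f : Sections n (-lam)) (g : SOo n)
    (b x : EuclideanSpace ℝ (Fin n)) :
    HasDerivAt (fun t : ℝ => (f : SOo n → ℂ) (g * nu (t • b) * nbar n x))
      (lam * (∑ k, b k * x k : ℝ) * secFun f g x +
        fderiv ℝ (secFun f g) x (((∑ k, x k ^ 2) / 2) • b - (∑ k, b k * x k) • x)) 0 := by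
  set β : ℝ := ∑ k, b k * x k with hβ
  set ρ : ℝ := (∑ k, x k ^ 2) / 2 with hρ
  set τ : ℝ := (∑ k, b k ^ 2) / 2 with hτ
  set c : ℝ → Idx n → ℝ := fun t => col (nu (t • b) * nbar n x) with hc
  have hcp : ∀ t, c t (iPlus n) = 1 + t * β + t ^ 2 * τ * ρ := by
    intro t
    have h1 : ∑ k, (t • b) k * x k = t * β := by
      rw [hβ, Finset.mul_sum]
      exact Finset.sum_congr rfl fun k _ => by rw [PiLp.smul_apply, smul_eq_mul]; ring
    have h2 : ∑ k, (t • b) k ^ 2 = t ^ 2 * ∑ k, b k ^ 2 := by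
      rw [Finset.mul_sum]
      exact Finset.sum_congr rfl fun k _ => by rw [PiLp.smul_apply, smul_eq_mul]; ring
    simp only [hc, (col_nu_nbar _ _).1, h1, h2]
    ring
  have hcm : ∀ t k, c t (iMid k) = x k + t * b k * ρ := by
    intro t k
    simp only [hc, (col_nu_nbar _ _).2, PiLp.smul_apply, smul_eq_mul, ← hρ]
  have dp : HasDerivAt (fun t => c t (iPlus n)) β 0 := by
    simp only [hcp]
    have : HasDerivAt (fun t : ℝ => 1 + t * β + t ^ 2 * τ * ρ) _ 0 :=
      (((hasDerivAt_id (0 : ℝ)).mul_const β).const_add 1).add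
        ((((hasDerivAt_id (0 : ℝ)).pow 2).mul_const τ).mul_const ρ)
    refine this.congr_deriv ?_
    simp
  have hc0 : c 0 (iPlus n) = 1 := by rw [hcp]; ring
  have hx0 : cellPt (c 0) = x := by
    ext k; rw [cellPt_apply, hcm, hc0]; ring
  have dx : HasDerivAt (fun t => cellPt (c t)) (ρ • b - β • x) 0 := by
    have h1 : HasDerivAt (fun t k => c t (iMid k) / c t (iPlus n))
        (fun k => b k * ρ - β * x k) 0 := by
      refine hasDerivAt_pi.mpr fun k => ?_
      have d1 : HasDerivAt (fun t => c t (iMid k)) (b k * ρ) 0 := by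
        simp only [hcm]
        have : HasDerivAt (fun t : ℝ => x k + t * (b k * ρ)) _ 0 :=
          ((hasDerivAt_id (0 : ℝ)).mul_const (b k * ρ)).const_add (x k)
        simpa [mul_assoc] using this
      have := d1.div dp (by rw [hc0]; exact one_ne_zero)
      refine this.congr_deriv ?_
      rw [hc0, hcm]
      ring
    have h2 := (PiLp.hasFDerivAt_toLp (𝕜 := ℝ) 2
      (fun k => c 0 (iMid k) / c 0 (iPlus n))).comp_hasDerivAt 0 h1
    refine h2.congr_deriv ?_
    ext k
    change b k * ρ - β * x k = ρ * b k - β * x k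
    ring
  have dw : HasDerivAt (fun t : ℝ => (((c t (iPlus n) : ℝ) : ℂ) ^ (-lam))⁻¹) (lam * β) 0 := by
    have h1 : HasDerivAt (fun t : ℝ => ((c t (iPlus n) : ℝ) : ℂ)) (β : ℂ) 0 := dp.ofReal_comp
    have h2 : HasDerivAt (fun z : ℂ => z ^ lam) (lam * ((c 0 (iPlus n) : ℝ) : ℂ) ^ (lam - 1))
        ((c 0 (iPlus n) : ℝ) : ℂ) :=
      (Complex.hasStrictDerivAt_cpow_const (by rw [hc0]; simp)).hasDerivAt
    have h3 := HasDerivAt.scomp (h := fun t : ℝ => ((c t (iPlus n) : ℝ) : ℂ)) (0 : ℝ) h2 h1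
    rw [hc0] at h3
    simp only [Complex.ofReal_one, Complex.one_cpow, mul_one, smul_eq_mul] at h3
    rw [mul_comm] at h3
    refine h3.congr_of_eventuallyEq (Filter.Eventually.of_forall fun t => ?_)
    simp only [Function.comp_apply]
    rw [Complex.cpow_neg, inv_inv]
  have hpos : ∀ᶠ t in nhds (0 : ℝ), 0 < c t (iPlus n) :=
    dp.continuousAt.eventually (lt_mem_nhds (by simp only [hc0, one_pos]))
  have dφ : HasDerivAt (fun t => secFun f g (cellPt (c t)))
      (fderiv ℝ (secFun f g) x (ρ • b - β • x)) 0 := by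
    have := (differentiable_smooth (secFun f g) (cellPt (c 0))).hasFDerivAt.comp_hasDerivAt 0 dx
    rwa [hx0] at this
  have key := dw.mul dφ
  rw [hx0, hc0] at key
  simp only [Complex.ofReal_one, Complex.one_cpow, inv_one, one_mul] at key
  refine key.congr_of_eventuallyEq ?_
  filter_upwards [hpos] with t ht
  rw [mul_assoc, section_bigCell f g _ ht]
  rfl

theorem fderiv_eq_sum {u : EuclideanSpace ℝ (Fin n) → ℂ} {x : EuclideanSpace ℝ (Fin n)}
    (v : EuclideanSpace ℝ (Fin n)) :
    fderiv ℝ u x v = ∑ k, (v k : ℂ) * fderiv ℝ u x (EuclideanSpace.single k 1) := by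
  have h : v = ∑ k, v k • EuclideanSpace.single k (1 : ℝ) := by
    ext j
    simp [Finset.sum_apply, Pi.single_apply]
  conv_lhs => rw [h, map_sum]
  refine Finset.sum_congr rfl fun k _ => ?_
  rw [map_smul, Complex.real_smul]

theorem pd_tensor_inl (φ ψ : Smooth (EuclideanSpace ℝ (Fin n))) (k : Fin n)
    (x y : EuclideanSpace ℝ (Fin n)) :
    pd (stdDir n (Sum.inl k)) (tensor φ ψ) (x, y) =
      fderiv ℝ φ x (EuclideanSpace.single k 1) * ψ y := by
  have h := congrFun (congrFun (dx_toFun2 k (tensor φ ψ)) x) y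
  change pd _ _ _ = _
  have h2 : HasFDerivAt (fun z => φ z * ψ y) (ψ y • fderiv ℝ φ x) x :=
    (differentiable_smooth φ x).hasFDerivAt.mul_const _
  rw [show pd (stdDir n (Sum.inl k)) (tensor φ ψ) (x, y) = _ from h.symm]
  change fderiv ℝ (fun z => φ z * ψ y) x _ = _
  rw [h2.fderiv]
  simp [mul_comm]

theorem pd_tensor_inr (φ ψ : Smooth (EuclideanSpace ℝ (Fin n))) (k : Fin n)
    (x y : EuclideanSpace ℝ (Fin n)) :
    pd (stdDir n (Sum.inr k)) (tensor φ ψ) (x, y) =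
      φ x * fderiv ℝ ψ y (EuclideanSpace.single k 1) := by
  have h := congrFun (congrFun (dy_toFun2 k (tensor φ ψ)) x) y
  have h2 : HasFDerivAt (fun z => φ x * ψ z) (φ x • fderiv ℝ ψ y) y :=
    (differentiable_smooth ψ y).hasFDerivAt.const_mul _
  rw [show pd (stdDir n (Sum.inr k)) (tensor φ ψ) (x, y) = _ from h.symm]
  change fderiv ℝ (fun z => φ x * ψ z) y _ = _
  rw [h2.fderiv]
  simp

theorem confOp_apply (ι : Fin n → Fin n ⊕ Fin n) (lam : ℂ) (k : Fin n)
    (u : Smooth (EuclideanSpace ℝ (Fin n) × EuclideanSpace ℝ (Fin n)))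
    (p : EuclideanSpace ℝ (Fin n) × EuclideanSpace ℝ (Fin n)) :
    confOp ι lam k u p =
      (coord n (ι k) p : ℂ) * ∑ l, (coord n (ι l) p : ℂ) * pd (stdDir n (ι l)) u p -
      1 / 2 * (∑ l, (coord n (ι l) p : ℂ) ^ 2) * pd (stdDir n (ι k)) u p -
      lam * ((coord n (ι k) p : ℂ) * u p) := by
  simp only [confOp, LinearMap.sub_apply, LinearMap.sum_apply, LinearMap.smul_apply,
    Smooth.sub_apply, Smooth.sum_apply, Smooth.smul_apply, Module.End.mul_apply, mulBy_apply,
    Finset.mul_sum, Finset.sum_mul]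
  congr 1
  congr 1
  exact Finset.sum_congr rfl fun l _ => by ring

theorem contDiff_col_nbar (i : Idx n) :
    ContDiff ℝ ∞ fun x : EuclideanSpace ℝ (Fin n) => col (nbar n x) i := by
  have h2 : ∀ k, ContDiff ℝ ∞ fun x : EuclideanSpace ℝ (Fin n) => x k := fun k =>
    contDiff_euclidean.mp contDiff_id k
  rcases i with ⟨⟩ | k | ⟨⟩
  · change ContDiff ℝ ∞ fun x : EuclideanSpace ℝ (Fin n) => col (nbar n x) (iPlus n)
    simp only [col_nbar_plus]
    exact contDiff_const
  · simp only [col_nbar_mid]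
    exact h2 k
  · change ContDiff ℝ ∞ fun x : EuclideanSpace ℝ (Fin n) => col (nbar n x) (iMinus n)
    simp only [col_nbar_minus]
    exact (ContDiff.sum fun k _ => (h2 k).pow 2).div_const 2

theorem contDiff_col_nu_nbar (g : SOo n) (b : EuclideanSpace ℝ (Fin n)) (i : Idx n) :
    ContDiff ℝ ∞ fun p : ℝ × EuclideanSpace ℝ (Fin n) =>
      col (g * nu (p.1 • b) * nbar n p.2) i := by
  have h3 : ∀ i, ContDiff ℝ ∞ fun p : ℝ × EuclideanSpace ℝ (Fin n) => col (nbar n p.2) i :=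
    fun i => (contDiff_col_nbar i).comp contDiff_snd
  have hb : ∀ k, ContDiff ℝ ∞ fun p : ℝ × EuclideanSpace ℝ (Fin n) => p.1 * b k :=
    fun k => contDiff_fst.mul contDiff_const
  have h4 : ∀ i, ContDiff ℝ ∞ fun p : ℝ × EuclideanSpace ℝ (Fin n) =>
      col (nu (p.1 • b) * nbar n p.2) i := by
    simp only [col_mul, mat_nu]
    rintro (⟨⟩ | k | ⟨⟩)
    · change ContDiff ℝ ∞ fun p : ℝ × EuclideanSpace ℝ (Fin n) =>
        (nuMat (p.1 • b) *ᵥ col (nbar n p.2)) (iPlus n)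
      simp only [nuMat_plus, PiLp.smul_apply, smul_eq_mul]
      exact ((h3 _).add (ContDiff.sum fun k _ => (hb k).mul (h3 _))).add
        (((ContDiff.sum fun k _ => (hb k).pow 2).div_const 2).mul (h3 _))
    · simp only [nuMat_mid, PiLp.smul_apply, smul_eq_mul]
      exact (h3 _).add ((hb k).mul (h3 _))
    · change ContDiff ℝ ∞ fun p : ℝ × EuclideanSpace ℝ (Fin n) =>
        (nuMat (p.1 • b) *ᵥ col (nbar n p.2)) (iMinus n)
      simp only [nuMat_minus]
      exact h3 _
  simp only [mul_assoc g, col_mul g, Matrix.mulVec, dotProduct]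
  exact ContDiff.sum fun j _ => contDiff_const.mul (h4 j)

theorem contDiff_section_nu_nbar {w : ℂ} (f : Sections n w) (g : SOo n)
    (b : EuclideanSpace ℝ (Fin n)) :
    ContDiff ℝ ∞ fun p : ℝ × EuclideanSpace ℝ (Fin n) =>
      (f : SOo n → ℂ) (g * nu (p.1 • b) * nbar n p.2) :=
  contDiff_section_comp f (fun p : ℝ × EuclideanSpace ℝ (Fin n) => g * nu (p.1 • b) * nbar n p.2)
    (contDiff_col_nu_nbar g b)

theorem contDiff_nuPair {w₁ w₂ : ℂ} (f : Sections n w₁) (h : Sections n w₂) (g : SOo n)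
    (b : EuclideanSpace ℝ (Fin n)) :
    ContDiff ℝ ∞ fun p : ℝ × (EuclideanSpace ℝ (Fin n) × EuclideanSpace ℝ (Fin n)) =>
      (f : SOo n → ℂ) (g * nu (p.1 • b) * nbar n p.2.1) *
        (h : SOo n → ℂ) (g * nu (p.1 • b) * nbar n p.2.2) := by
  have e1 : ContDiff ℝ ∞
      fun p : ℝ × (EuclideanSpace ℝ (Fin n) × EuclideanSpace ℝ (Fin n)) => (p.1, p.2.1) :=
    contDiff_fst.prodMk (contDiff_fst.comp contDiff_snd)
  have e2 : ContDiff ℝ ∞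
      fun p : ℝ × (EuclideanSpace ℝ (Fin n) × EuclideanSpace ℝ (Fin n)) => (p.1, p.2.2) :=
    contDiff_fst.prodMk (contDiff_snd.comp contDiff_snd)
  have h1 := ContDiff.comp (contDiff_section_nu_nbar f g b) e1
  have h2 := ContDiff.comp (contDiff_section_nu_nbar h g b) e2
  exact ContDiff.mul h1 h2

/-- The two-variable section along the one-parameter group `t ↦ exp (t b)` in `N`. -/
def nuPair {w₁ w₂ : ℂ} (f : Sections n w₁) (h : Sections n w₂) (g : SOo n)
    (b : EuclideanSpace ℝ (Fin n)) :
    Smooth (ℝ × (EuclideanSpace ℝ (Fin n) × EuclideanSpace ℝ (Fin n))) :=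
  ⟨_, contDiff_nuPair f h g b⟩

theorem nuPair_apply {w₁ w₂ : ℂ} (f : Sections n w₁) (h : Sections n w₂) (g : SOo n)
    (b : EuclideanSpace ℝ (Fin n)) (t : ℝ)
    (p : EuclideanSpace ℝ (Fin n) × EuclideanSpace ℝ (Fin n)) :
    nuPair f h g b (t, p) = secPair f h (g * nu (t • b)) p := rfl

/-- The infinitesimal action of `N` on sections is given by `confOp`. -/
theorem pd_nuPair {lam mu : ℂ} (f : Sections n (-lam)) (h : Sections n (-mu)) (g : SOo n)
    (b : EuclideanSpace ℝ (Fin n)) (p : EuclideanSpace ℝ (Fin n) × EuclideanSpace ℝ (Fin n)) :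
    pd (1, 0) (nuPair f h g b) (0, p) =
      (-∑ k, (b k : ℂ) • (confOp Sum.inl lam k (secPair f h g) +
        confOp Sum.inr mu k (secPair f h g))) p := by
  obtain ⟨x, y⟩ := p
  have h1 : HasDerivAt (fun t : ℝ => nuPair f h g b (t, (x, y)))
      (pd (1, 0) (nuPair f h g b) (0, (x, y))) 0 := by
    have h3 : HasDerivAt (fun t : ℝ => (t, (x, y))) (1, 0) 0 :=
      (hasDerivAt_id (0 : ℝ)).prodMk (hasDerivAt_const _ _)
    exact (differentiable_smooth (nuPair f h g b) (0, (x, y))).hasFDerivAt.comp_hasDerivAt 0 h3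
  have h2 : HasDerivAt (fun t : ℝ => nuPair f h g b (t, (x, y))) _ 0 :=
    (hasDerivAt_section_nu f g b x).mul (hasDerivAt_section_nu h g b y)
  rw [h1.unique h2]
  simp only [zero_smul, nu_zero, mul_one, ← secFun_apply, Smooth.neg_apply, Smooth.sum_apply,
    Smooth.smul_apply, Smooth.add_apply, confOp_apply, coord_inl, coord_inr, secPair,
    pd_tensor_inl, pd_tensor_inr, tensor_apply]
  have key : ∀ (φ : Smooth (EuclideanSpace ℝ (Fin n))) (x : EuclideanSpace ℝ (Fin n)),
      fderiv ℝ φ x (((∑ k, x k ^ 2) / 2) • b - (∑ k, b k * x k) • x) =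
      1 / 2 * (∑ l, (x l : ℂ) ^ 2) *
        ∑ k, (b k : ℂ) * fderiv ℝ φ x (EuclideanSpace.single k 1) -
      (∑ k, (b k : ℂ) * (x k : ℂ)) *
        ∑ l, (x l : ℂ) * fderiv ℝ φ x (EuclideanSpace.single l 1) := by
    intro φ x
    rw [map_sub, map_smul, map_smul, fderiv_eq_sum b, fderiv_eq_sum x, Complex.real_smul,
      Complex.real_smul]
    push_cast
    ring
  rw [key, key]
  have e1 : ∀ l, ((x l : ℝ) : ℂ) * (fderiv ℝ (secFun f g) x (EuclideanSpace.single l 1) *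
      secFun h g y) = ((x l : ℝ) : ℂ) * fderiv ℝ (secFun f g) x (EuclideanSpace.single l 1) *
      secFun h g y := fun l => by ring
  have e2 : ∀ l, ((y l : ℝ) : ℂ) * (secFun f g x * fderiv ℝ (secFun h g) y
      (EuclideanSpace.single l 1)) = ((y l : ℝ) : ℂ) * fderiv ℝ (secFun h g) y
      (EuclideanSpace.single l 1) * secFun f g x := fun l => by ring
  simp only [e1, e2, ← Finset.sum_mul]
  generalize ∑ l, ((x l : ℝ) : ℂ) * fderiv ℝ (secFun f g) x (EuclideanSpace.single l 1) = A
  generalize ∑ l, ((y l : ℝ) : ℂ) * fderiv ℝ (secFun h g) y (EuclideanSpace.single l 1) = B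
  generalize ∑ l, ((x l : ℝ) : ℂ) ^ 2 = r
  generalize ∑ l, ((y l : ℝ) : ℂ) ^ 2 = s
  push_cast
  simp only [Finset.mul_sum, Finset.sum_mul, ← Finset.sum_neg_distrib, ← Finset.sum_add_distrib,
    ← Finset.sum_sub_distrib]
  exact Finset.sum_congr rfl fun k _ => by ring

/-- The derivative along a one-parameter subgroup of `N` of a bilinear differential operator with
symbol `P`, evaluated at the base point. -/
theorem hasDerivAt_symOp_nu {lam mu : ℂ} (f : Sections n (-lam)) (h : Sections n (-mu))
    (g : SOo n) (b : EuclideanSpace ℝ (Fin n)) (P : Symb n) :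
    HasDerivAt (fun t : ℝ => symOp (stdDir n) P (secPair f h (g * nu (t • b))) 0)
      (-∑ k, (b k : ℂ) * symOp (stdDir n) (nilOp₂ lam mu k P) (secPair f h g) 0) 0 := by
  set S := ContinuousLinearMap.inr ℝ ℝ (EuclideanSpace ℝ (Fin n) × EuclideanSpace ℝ (Fin n))
  have h1 : ∀ t : ℝ, pull (t, 0) S (nuPair f h g b) = secPair f h (g * nu (t • b)) := fun t => by
    ext p
    rw [← nuPair_apply, pull_apply]
    simp [S]
  have h2 : ∀ t : ℝ, symOp (stdDir n) P (secPair f h (g * nu (t • b))) 0 =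
      symOp (fun s => S (stdDir n s)) P (nuPair f h g b) (t, 0) := fun t => by
    rw [← h1, symOp_pull, pull_apply, map_zero, add_zero]
  have h3 : HasDerivAt (fun t : ℝ => symOp (fun s => S (stdDir n s)) P (nuPair f h g b) (t, 0))
      (pd (1, 0) (symOp (fun s => S (stdDir n s)) P (nuPair f h g b)) (0, 0)) 0 := by
    have h3 : HasDerivAt (fun t : ℝ =>
        (t, (0 : EuclideanSpace ℝ (Fin n) × EuclideanSpace ℝ (Fin n)))) (1, 0) 0 :=
      (hasDerivAt_id (0 : ℝ)).prodMk (hasDerivAt_const _ _)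
    exact (differentiable_smooth (symOp (fun s => S (stdDir n s)) P (nuPair f h g b))
      ((0 : ℝ), (0 : EuclideanSpace ℝ (Fin n) × EuclideanSpace ℝ (Fin n)))).hasFDerivAt.comp_hasDerivAt
      (0 : ℝ) h3
  simp only [h2]
  refine h3.congr_deriv ?_
  have h4 : pull (0, 0) S (pd (1, 0) (nuPair f h g b)) =
      -∑ k, (b k : ℂ) • (confOp Sum.inl lam k (secPair f h g) +
        confOp Sum.inr mu k (secPair f h g)) := by
    ext p
    rw [← pd_nuPair, pull_apply]
    simp [S]
  have h5 : symOp (fun s => S (stdDir n s)) P (pd (1, 0) (nuPair f h g b)) (0, 0) =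
      symOp (stdDir n) P (pull (0, 0) S (pd (1, 0) (nuPair f h g b))) 0 := by
    rw [symOp_pull, pull_apply, map_zero, add_zero]
  rw [pd_symOp, h5, h4, map_neg, map_sum, Smooth.neg_apply, Smooth.sum_apply]
  congr 1
  refine Finset.sum_congr rfl fun k _ => ?_
  rw [map_smul, Smooth.smul_apply, map_add, Smooth.add_apply, symOp_confOp, symOp_confOp, nilOp₂,
    map_add]
  rfl

/-- An operator whose symbol is annihilated by `𝔫` is invariant under `N`. -/
theorem symOp_nu {lam mu : ℂ} {P : Symb n} (hP : ∀ k, nilOp₂ lam mu k P = 0)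
    (f : Sections n (-lam)) (h : Sections n (-mu)) (g : SOo n) (b : EuclideanSpace ℝ (Fin n)) :
    symOp (stdDir n) P (secPair f h (g * nu b)) 0 = symOp (stdDir n) P (secPair f h g) 0 := by
  have hd : ∀ t : ℝ, HasDerivAt
      (fun t : ℝ => symOp (stdDir n) P (secPair f h (g * nu (t • b))) 0) 0 t := by
    intro t
    have h1 := hasDerivAt_symOp_nu f h (g * nu (t • b)) b P
    simp only [hP, map_zero, LinearMap.zero_apply, Smooth.zero_apply, mul_zero,
      Finset.sum_const_zero, neg_zero] at h1
    have h2 : HasDerivAt (fun s : ℝ => s - t) 1 t := (hasDerivAt_id t).sub_const t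
    have h3 := HasDerivAt.scomp (h := fun s : ℝ => s - t) t (by rwa [sub_self]) h2
    rw [one_smul] at h3
    refine h3.congr_of_eventuallyEq (Filter.Eventually.of_forall fun s => ?_)
    simp only [Function.comp_apply, mul_assoc, ← nu_add, ← add_smul, add_sub_cancel]
  have := is_const_of_deriv_eq_zero (fun t => (hd t).differentiableAt) (fun t => (hd t).deriv) 1 0
  simpa [nu_zero] using this

end Nilradical

/-! ### Extension of functions on the big cell to sections -/

section Extension

variable {n : ℕ}

/-- The function on the group given by a function `φ` on the big cell, extended by zero. -/
def extFun (w : ℂ) (φ : EuclideanSpace ℝ (Fin n) → ℂ) (g : SOo n) : ℂ :=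
  if 0 < col g (iPlus n) then ((col g (iPlus n) : ℂ) ^ w)⁻¹ * φ (cellPt (col g)) else 0

theorem extFun_nbar (w : ℂ) (φ : EuclideanSpace ℝ (Fin n) → ℂ) (x : EuclideanSpace ℝ (Fin n)) :
    extFun w φ (nbar n x) = φ x := by
  have h : cellPt (col (nbar n x)) = x := by
    ext k
    rw [cellPt_apply, col_nbar_plus, col_nbar_mid, div_one]
  rw [extFun, h, col_nbar_plus]
  simp

theorem extFun_mul_par (w : ℂ) (φ : EuclideanSpace ℝ (Fin n) → ℂ) (g : SOo n) {p : SOo n}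
    (hp : p ∈ Par n) : extFun w φ (g * p) = (chi n w p)⁻¹ * extFun w φ g := by
  obtain ⟨a, ha, hpa⟩ := hp
  have hp1 : col p (iPlus n) = a := by
    rw [col, hpa, Pi.smul_apply, ePlus_plus, smul_eq_mul, mul_one]
  have h1 : col (g * p) = a • col g := by
    rw [col_mul, col, hpa, Matrix.mulVec_smul, col]
  have h2 : cellPt (a • col g) = cellPt (col g) := by
    ext k
    rw [cellPt_apply, cellPt_apply, Pi.smul_apply, Pi.smul_apply, smul_eq_mul, smul_eq_mul,
      mul_div_mul_left _ _ ha.ne']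
  rw [extFun, extFun, h1, h2, chi_eq, hp1, Pi.smul_apply, smul_eq_mul]
  simp only [mul_pos_iff_of_pos_left ha]
  split_ifs with h
  · rw [Complex.ofReal_mul, Complex.mul_cpow_ofReal_nonneg ha.le h.le, mul_inv, mul_assoc]
  · rw [mul_zero]

theorem contDiff_col_mul_nbar (g : SOo n) (i : Idx n) :
    ContDiff ℝ ∞ fun x : EuclideanSpace ℝ (Fin n) => col (g * nbar n x) i := by
  simp only [col_mul g, Matrix.mulVec, dotProduct]
  exact ContDiff.sum fun j _ => contDiff_const.mul (contDiff_col_nbar j)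

/-- The extension by zero of a smooth function with bounded support is smooth: at a point
outside the big cell, `v₊ = 0 < v₋`, whereas `2 v₋ / v₊ = |x|²` is bounded on the support. -/
theorem contDiff_extFun (w : ℂ) {φ : EuclideanSpace ℝ (Fin n) → ℂ} (hφ : ContDiff ℝ ∞ φ) {r : ℝ}
    (hr : ∀ x : EuclideanSpace ℝ (Fin n), φ x ≠ 0 → ∑ k, x k ^ 2 ≤ r) (g : SOo n) :
    ContDiff ℝ ∞ fun x => extFun w φ (g * nbar n x) := by
  rw [contDiff_iff_contDiffAt]
  intro x₀
  set v : EuclideanSpace ℝ (Fin n) → Idx n → ℝ := fun x => col (g * nbar n x) with hv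
  have hvs : ∀ i, ContDiff ℝ ∞ fun x => v x i := fun i => contDiff_col_mul_nbar g i
  rcases (col_plus_nonneg (g * nbar n x₀)).eq_or_lt with h0 | h0
  · have h0' : v x₀ (iPlus n) = 0 := h0.symm
    have hm : 0 < v x₀ (iMinus n) :=
      ((mem_futureCone_iff n _).mp (col_mem (g * nbar n x₀))).2.2 h0.symm
    have hc : ContinuousAt (fun x => 2 * v x (iMinus n) - r * v x (iPlus n)) x₀ :=
      ((continuous_const.mul (hvs _).continuous).sub
        (continuous_const.mul (hvs _).continuous)).continuousAt
    have he : ∀ᶠ x in nhds x₀, 0 < 2 * v x (iMinus n) - r * v x (iPlus n) :=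
      hc.eventually (lt_mem_nhds (by simp only [h0']; linarith))
    refine (contDiffAt_const (c := (0 : ℂ))).congr_of_eventuallyEq ?_
    filter_upwards [he] with x hx
    rw [extFun]
    split_ifs with hp
    · rw [mul_eq_zero]
      right
      by_contra hne
      have h1 := hr _ hne
      have h2 : ∑ k, cellPt (v x) k ^ 2 = 2 * v x (iMinus n) / v x (iPlus n) := by
        simp only [cellPt_apply, div_pow, ← Finset.sum_div]
        rw [hv, col_quad]
        field_simp
      have h3 : ∑ k, cellPt (v x) k ^ 2 ≤ r := h1
      rw [h2, div_le_iff₀ hp] at h3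
      linarith
    · rfl
  · have he : ∀ᶠ x in nhds x₀, 0 < v x (iPlus n) :=
      (hvs (iPlus n)).continuous.continuousAt.eventually (lt_mem_nhds h0)
    have h1 : ContDiffAt ℝ ∞ (fun x => ((v x (iPlus n) : ℂ) ^ (-w)) * φ (cellPt (v x))) x₀ := by
      have h2 := (contDiffAt_ofReal_cpow_const (-w) h0).comp x₀ (hvs (iPlus n)).contDiffAt
      have h3 := hφ.contDiffAt.comp x₀
        (contDiffAt_cellPt (fun i => (hvs i).contDiffAt) h0.ne')
      exact h2.mul h3
    refine h1.congr_of_eventuallyEq ?_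
    filter_upwards [he] with x hx
    rw [extFun, if_pos hx, Complex.cpow_neg]

/-- Every germ at the base point is the germ of a section. -/
theorem exists_section_eventuallyEq (w : ℂ) (φ : Smooth (EuclideanSpace ℝ (Fin n))) :
    ∃ f : Sections n w, (secFun f 1 : EuclideanSpace ℝ (Fin n) → ℂ) =ᶠ[nhds 0] φ := by
  let β : ContDiffBump (0 : EuclideanSpace ℝ (Fin n)) := ⟨1, 2, one_pos, one_lt_two⟩
  have hs : ContDiff ℝ ∞ fun x => (β x : ℂ) * φ x :=
    (Complex.ofRealCLM.contDiff.comp β.contDiff).mul (contDiff_smooth φ)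
  have hr : ∀ x : EuclideanSpace ℝ (Fin n), (β x : ℂ) * φ x ≠ 0 → ∑ k, x k ^ 2 ≤ 4 := by
    intro x hx
    have h1 : x ∈ Function.support β := fun h => hx (by rw [h]; simp)
    rw [β.support_eq, mem_ball_zero_iff] at h1
    have h2 : ‖x‖ ^ 2 = ∑ k, x k ^ 2 := by simp [EuclideanSpace.norm_sq_eq]
    have h3 : ‖x‖ < 2 := h1
    nlinarith [norm_nonneg x]
  refine ⟨⟨extFun w fun x => (β x : ℂ) * φ x, fun g p hp => extFun_mul_par w _ g hp,
    contDiff_extFun w hs hr⟩, ?_⟩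
  filter_upwards [β.eventuallyEq_one] with x hx
  rw [secFun_apply, one_mul]
  change extFun w (fun x => (β x : ℂ) * φ x) (nbar n x) = _
  rw [extFun_nbar, hx]
  simp

/-- A differential operator is determined by its values on products of sections: test it on
exponentials. -/
theorem symbol_eq_zero_of_forall_sections {w₁ w₂ : ℂ} {Q : Symb n}
    (hQ : ∀ (f : Sections n w₁) (h : Sections n w₂),
      symOp (stdDir n) Q (secPair f h 1) 0 = 0) : Q = 0 := by
  refine MvPolynomial.funext fun c => ?_
  let L : (Fin n → ℂ) → EuclideanSpace ℝ (Fin n) →L[ℝ] ℂ := fun c =>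
    ∑ k, (EuclideanSpace.proj k : EuclideanSpace ℝ (Fin n) →L[ℝ] ℝ).smulRight (c k)
  have hL : ∀ c k, L c (EuclideanSpace.single k 1) = c k := by
    intro c k
    simp [L, ite_smul]
  obtain ⟨f, hf⟩ := exists_section_eventuallyEq w₁ (expS (L fun k => c (Sum.inl k)))
  obtain ⟨h, hh⟩ := exists_section_eventuallyEq w₂ (expS (L fun k => c (Sum.inr k)))
  set M : EuclideanSpace ℝ (Fin n) × EuclideanSpace ℝ (Fin n) →L[ℝ] ℂ :=
    (L fun k => c (Sum.inl k)).coprod (L fun k => c (Sum.inr k)) with hM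
  have key : (secPair f h 1 : EuclideanSpace ℝ (Fin n) × EuclideanSpace ℝ (Fin n) → ℂ)
      =ᶠ[nhds 0] expS M := by
    have h1 := (continuous_fst (X := EuclideanSpace ℝ (Fin n))
      (Y := EuclideanSpace ℝ (Fin n))).continuousAt (x := 0) |>.eventually hf
    have h2 := (continuous_snd (X := EuclideanSpace ℝ (Fin n))
      (Y := EuclideanSpace ℝ (Fin n))).continuousAt (x := 0) |>.eventually hh
    filter_upwards [h1, h2] with p h1 h2
    rw [secPair, tensor_apply, h1, h2, expS_apply, expS_apply, expS_apply, ← Complex.exp_add]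
    rfl
  have h0 := (symOp_congr_of_eventuallyEq (stdDir n) Q key).eq_of_nhds
  rw [hQ, symOp_expS, Smooth.smul_apply, expS_apply, map_zero, Complex.exp_zero, mul_one] at h0
  rw [map_zero, h0]
  congr 2
  funext s
  rcases s with k | k
  · simp [hM, stdDir, hL]
  · simp [hM, stdDir, hL]

end Extension

/-! ### Invariant operators from invariant symbols -/

section Existence

variable {n : ℕ}

/-- The substitution `ξ ↦ a⁻¹ Rᵀ ξ`, `η ↦ a⁻¹ Rᵀ η` on symbols. -/
def leviSubst (a : ℝ) (R : Matrix (Fin n) (Fin n) ℝ) : Symb n →ₐ[ℂ] Symb n :=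
  MvPolynomial.aeval (Sum.elim
    (fun k => ∑ l, MvPolynomial.C ((a⁻¹ * R l k : ℝ) : ℂ) * MvPolynomial.X (Sum.inl l))
    fun k => ∑ l, MvPolynomial.C ((a⁻¹ * R l k : ℝ) : ℂ) * MvPolynomial.X (Sum.inr l))

theorem leviMap_single (a : ℝ) (R : Matrix (Fin n) (Fin n) ℝ) (k : Fin n) :
    leviMap a R (EuclideanSpace.single k 1) =
      ∑ l, (a⁻¹ * R l k) • EuclideanSpace.single l (1 : ℝ) := by
  ext j
  rw [leviMap_apply]
  simp [Matrix.mulVec, dotProduct, Pi.single_apply]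

theorem symOp_leviMap (a : ℝ) (R : Matrix (Fin n) (Fin n) ℝ) (P : Symb n)
    (u : Smooth (EuclideanSpace ℝ (Fin n) × EuclideanSpace ℝ (Fin n))) :
    symOp (stdDir n) P (pull 0 ((leviMap a R).prodMap (leviMap a R)) u) 0 =
      symOp (stdDir n) (leviSubst a R P) u 0 := by
  let c : Fin n ⊕ Fin n → Fin n ⊕ Fin n → ℝ :=
    Sum.elim (fun k => Sum.elim (fun l => a⁻¹ * R l k) fun _ => 0)
      fun k => Sum.elim (fun _ => 0) fun l => a⁻¹ * R l k
  have h1 : ∀ s, (leviMap a R).prodMap (leviMap a R) (stdDir n s) = ∑ t, c s t • stdDir n t := by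
    rintro (k | k) <;>
      simp [c, Fintype.sum_sum_type, stdDir, leviMap_single, Prod.ext_iff, Prod.fst_sum,
        Prod.snd_sum]
  have h2 : MvPolynomial.aeval (fun s => ∑ t, MvPolynomial.C (c s t : ℂ) * MvPolynomial.X t) =
      leviSubst a R := by
    refine MvPolynomial.algHom_ext fun s => ?_
    rw [leviSubst, MvPolynomial.aeval_X, MvPolynomial.aeval_X]
    rcases s with k | k <;> simp [c, Fintype.sum_sum_type]
  rw [symOp_pull, pull_apply, map_zero, add_zero, symOp_change (stdDir n) _ c h1, h2]

theorem secPair_levi {w₁ w₂ : ℂ} (f : Sections n w₁) (h : Sections n w₂) (g : SOo n) {q : SOo n}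
    {a : ℝ} {R : Matrix (Fin n) (Fin n) ℝ} (hq : IsLevi q a R) :
    secPair f h (g * q) = (((a : ℂ) ^ w₁)⁻¹ * ((a : ℂ) ^ w₂)⁻¹) •
      pull 0 ((leviMap a R).prodMap (leviMap a R)) (secPair f h g) := by
  ext p
  rw [Smooth.smul_apply, pull_apply, secPair_apply, secPair_apply, section_levi f g hq,
    section_levi h g hq, zero_add]
  change _ = _ * ((f : SOo n → ℂ) (g * nbar n (leviMap a R p.1)) *
    (h : SOo n → ℂ) (g * nbar n (leviMap a R p.2)))
  ring

theorem symOp_levi {w₁ w₂ : ℂ} (P : Symb n) (f : Sections n w₁) (h : Sections n w₂) (g : SOo n)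
    {q : SOo n} {a : ℝ} {R : Matrix (Fin n) (Fin n) ℝ} (hq : IsLevi q a R) :
    symOp (stdDir n) P (secPair f h (g * q)) 0 = ((a : ℂ) ^ w₁)⁻¹ * ((a : ℂ) ^ w₂)⁻¹ *
      symOp (stdDir n) (leviSubst a R P) (secPair f h g) 0 := by
  rw [secPair_levi f h g hq, map_smul, Smooth.smul_apply, symOp_leviMap]

theorem leviSubst_symDot (a : ℝ) {R : Matrix (Fin n) (Fin n) ℝ} (hR : R * Rᵀ = 1)
    {ι κ : Fin n → Fin n ⊕ Fin n} (hι : ι = Sum.inl ∨ ι = Sum.inr) (hκ : κ = Sum.inl ∨ κ = Sum.inr) :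
    leviSubst a R (symDot ι κ) = MvPolynomial.C ((a : ℂ)⁻¹ ^ 2) * symDot ι κ := by
  have h : ∀ {ι : Fin n → Fin n ⊕ Fin n}, (ι = Sum.inl ∨ ι = Sum.inr) → ∀ k,
      leviSubst a R (MvPolynomial.X (ι k)) =
        ∑ l, MvPolynomial.C ((a⁻¹ * R l k : ℝ) : ℂ) * MvPolynomial.X (ι l) := by
    rintro _ (rfl | rfl) k <;> simp [leviSubst]
  have hR' : ∀ l m, ∑ k, R l k * R m k = if l = m then 1 else 0 := fun l m => by
    have := congrFun (congrFun hR l) m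
    simpa [Matrix.mul_apply, Matrix.one_apply] using this
  simp only [symDot, map_sum, map_mul, h hι, h hκ, Finset.sum_mul_sum]
  rw [Finset.sum_comm, Finset.mul_sum]
  refine Finset.sum_congr rfl fun l _ => ?_
  rw [Finset.sum_comm]
  have h2 : ∀ m, ∑ k, MvPolynomial.C (σ := Fin n ⊕ Fin n) ((a⁻¹ * R l k : ℝ) : ℂ) *
      MvPolynomial.X (ι l) * (MvPolynomial.C ((a⁻¹ * R m k : ℝ) : ℂ) * MvPolynomial.X (κ m)) =
      if l = m then MvPolynomial.C ((a : ℂ)⁻¹ ^ 2) * (MvPolynomial.X (ι l) * MvPolynomial.X (κ l))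
        else 0 := by
    intro m
    have e : ∀ k, MvPolynomial.C (σ := Fin n ⊕ Fin n) ((a⁻¹ * R l k : ℝ) : ℂ) *
        MvPolynomial.X (ι l) * (MvPolynomial.C ((a⁻¹ * R m k : ℝ) : ℂ) * MvPolynomial.X (κ m)) =
        MvPolynomial.C (((a⁻¹ ^ 2 * (R l k * R m k) : ℝ)) : ℂ) *
          (MvPolynomial.X (ι l) * MvPolynomial.X (κ m)) := by
      intro k
      rw [show a⁻¹ ^ 2 * (R l k * R m k) = (a⁻¹ * R l k) * (a⁻¹ * R m k) by ring,
        Complex.ofReal_mul (a⁻¹ * R l k), map_mul]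
      ring
    simp only [e]
    rw [← Finset.sum_mul, ← map_sum, ← Complex.ofReal_sum, ← Finset.mul_sum, hR']
    split_ifs with hlm
    · rw [hlm]; simp
    · simp
  simp only [h2]
  simp

theorem leviSubst_symbol (N : ℕ) (c : ℕ → ℕ → ℂ) (a : ℝ) {R : Matrix (Fin n) (Fin n) ℝ}
    (hR : R * Rᵀ = 1) :
    leviSubst a R (symbol n N c) = MvPolynomial.C ((a : ℂ)⁻¹ ^ (2 * N)) * symbol n N c := by
  have hC : ∀ z, leviSubst a R (MvPolynomial.C z) = MvPolynomial.C z :=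
    (leviSubst a R).commutes
  rw [symbol, map_triSum, mul_triSum]
  refine triSum_congr fun i j hij => ?_
  obtain ⟨m, rfl⟩ : ∃ m, N = i + j + m := ⟨N - i - j, by omega⟩
  rw [show i + j + m - i - j = m by omega]
  simp only [map_mul, map_pow, leviSubst_symDot a hR (Or.inl rfl) (Or.inl rfl),
    leviSubst_symDot a hR (Or.inr rfl) (Or.inr rfl),
    leviSubst_symDot a hR (Or.inl rfl) (Or.inr rfl), hC]
  ring

theorem secPair_mul_nbar {w₁ w₂ : ℂ} (f : Sections n w₁) (h : Sections n w₂) (g : SOo n)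
    (x : EuclideanSpace ℝ (Fin n)) :
    secPair f h (g * nbar n x) = pull (x, x) (ContinuousLinearMap.id ℝ _) (secPair f h g) := by
  ext p
  rw [pull_apply, secPair_apply, secPair_apply]
  simp only [ContinuousLinearMap.id_apply, Prod.fst_add, Prod.snd_add, nbar_add, mul_assoc]

theorem symOp_mul_nbar {w₁ w₂ : ℂ} (P : Symb n) (f : Sections n w₁) (h : Sections n w₂) (g : SOo n)
    (x : EuclideanSpace ℝ (Fin n)) :
    symOp (stdDir n) P (secPair f h (g * nbar n x)) 0 =
      symOp (stdDir n) P (secPair f h g) (x, x) := by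
  rw [secPair_mul_nbar, symOp_pull, pull_apply, map_zero, add_zero]
  rfl

theorem secPair_act {w₁ w₂ : ℂ} (f : Sections n w₁) (h : Sections n w₂) (g x : SOo n) :
    secPair (act g f) (act g h) x = secPair f h (g⁻¹ * x) := by
  ext p
  rw [secPair_apply, secPair_apply, mul_assoc, mul_assoc]
  rfl

/-- The `k`-jet of a smooth function at the origin vanishes. -/
def JetZero (k : ℕ) (φ : Smooth (EuclideanSpace ℝ (Fin n))) : Prop :=
  ∀ m ≤ k, iteratedFDeriv ℝ m φ 0 = 0

theorem JetZero.mono {k l : ℕ} (hkl : k ≤ l) {φ : Smooth (EuclideanSpace ℝ (Fin n))}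
    (h : JetZero l φ) : JetZero k φ := fun m hm => h m (hm.trans hkl)

theorem JetZero.apply_zero {k : ℕ} {φ : Smooth (EuclideanSpace ℝ (Fin n))} (h : JetZero k φ) :
    φ 0 = 0 := by
  have := congrArg (fun T => T 0) (h 0 (Nat.zero_le k))
  simpa using this

theorem JetZero.pd {k : ℕ} {φ : Smooth (EuclideanSpace ℝ (Fin n))} (h : JetZero (k + 1) φ)
    (v : EuclideanSpace ℝ (Fin n)) : JetZero k (pd v φ) := by
  intro m hm
  ext t
  have h1 := congrArg (fun T => T (Fin.snoc t v)) (h (m + 1) (by omega))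
  simp only [iteratedFDeriv_succ_apply_right, Fin.init_snoc, Fin.snoc_last] at h1
  have h2 : ContDiff ℝ ∞ (fderiv ℝ φ) := (contDiff_smooth φ).fderiv_right (by simp)
  have h3 : iteratedFDeriv ℝ m (ConformalBilinear.pd v φ) 0 t =
      iteratedFDeriv ℝ m (fderiv ℝ φ) 0 t v := by
    have := ContinuousLinearMap.iteratedFDeriv_comp_left (𝕜 := ℝ)
      (ContinuousLinearMap.apply ℝ ℂ v) (x := (0 : EuclideanSpace ℝ (Fin n)))
      (h2.contDiffAt) (i := m) (by exact_mod_cast le_top)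
    have h4 := congrArg (fun T => T t) this
    exact h4
  rw [h3]
  exact h1

theorem pd_inl_tensor (φ ψ : Smooth (EuclideanSpace ℝ (Fin n))) (k : Fin n) :
    pd (stdDir n (Sum.inl k)) (tensor φ ψ) = tensor (pd (EuclideanSpace.single k 1) φ) ψ := by
  ext ⟨x, y⟩
  rw [pd_tensor_inl]
  rfl

theorem pd_inr_tensor (φ ψ : Smooth (EuclideanSpace ℝ (Fin n))) (k : Fin n) :
    pd (stdDir n (Sum.inr k)) (tensor φ ψ) = tensor φ (pd (EuclideanSpace.single k 1) ψ) := by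
  ext ⟨x, y⟩
  rw [pd_tensor_inr]
  rfl

theorem exists_symOp_tensor_eq_zero (P : Symb n) : ∃ k : ℕ, ∀ φ ψ,
    JetZero k φ ∨ JetZero k ψ → symOp (stdDir n) P (tensor φ ψ) 0 = 0 := by
  induction P using MvPolynomial.induction_on with
  | C c =>
    refine ⟨0, fun φ ψ h => ?_⟩
    rw [symOp_C, Smooth.smul_apply, tensor_apply]
    rcases h with h | h <;> simp [h.apply_zero]
  | add p q hp hq =>
    obtain ⟨k, hk⟩ := hp
    obtain ⟨l, hl⟩ := hq
    refine ⟨max k l, fun φ ψ h => ?_⟩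
    rw [map_add, LinearMap.add_apply, Smooth.add_apply,
      hk φ ψ (h.imp (JetZero.mono (le_max_left _ _)) (JetZero.mono (le_max_left _ _))),
      hl φ ψ (h.imp (JetZero.mono (le_max_right _ _)) (JetZero.mono (le_max_right _ _))), add_zero]
  | mul_X p s hp =>
    obtain ⟨k, hk⟩ := hp
    refine ⟨k + 1, fun φ ψ h => ?_⟩
    rw [symOp_mul_X]
    rcases s with s | s
    · rw [pd_inl_tensor]
      exact hk _ _ (h.imp (fun h => h.pd _) (JetZero.mono (Nat.le_succ k)))
    · rw [pd_inr_tensor]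
      exact hk _ _ (h.imp (JetZero.mono (Nat.le_succ k)) (fun h => h.pd _))

theorem contDiff_diag (u : Smooth (EuclideanSpace ℝ (Fin n) × EuclideanSpace ℝ (Fin n))) :
    ContDiff ℝ ∞ fun x => u (x, x) :=
  (contDiff_smooth u).comp (contDiff_id.prodMk contDiff_id)

theorem secPair_add_left {w₁ w₂ : ℂ} (f f' : Sections n w₁) (h : Sections n w₂) (g : SOo n) :
    secPair (f + f') h g = secPair f h g + secPair f' h g := by
  ext p; exact add_mul _ _ _

theorem secPair_smul_left {w₁ w₂ : ℂ} (c : ℂ) (f : Sections n w₁) (h : Sections n w₂) (g : SOo n) :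
    secPair (c • f) h g = c • secPair f h g := by
  ext p; exact mul_assoc _ _ _

theorem secPair_add_right {w₁ w₂ : ℂ} (f : Sections n w₁) (h h' : Sections n w₂) (g : SOo n) :
    secPair f (h + h') g = secPair f h g + secPair f h' g := by
  ext p; exact mul_add _ _ _

theorem secPair_smul_right {w₁ w₂ : ℂ} (c : ℂ) (f : Sections n w₁) (h : Sections n w₂) (g : SOo n) :
    secPair f (c • h) g = c • secPair f h g := by
  ext p; exact mul_left_comm _ _ _

/-- A symbol annihilated by `𝔫` and of weight `-2N` under the Levi subgroup defines sections. -/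
theorem symOp_section {lam mu : ℂ} {N : ℕ} {P : Symb n} (hP : ∀ k, nilOp₂ lam mu k P = 0)
    (hP' : ∀ (a : ℝ) (R : Matrix (Fin n) (Fin n) ℝ), R * Rᵀ = 1 →
      leviSubst a R P = MvPolynomial.C ((a : ℂ)⁻¹ ^ (2 * N)) * P)
    (f : Sections n (-lam)) (h : Sections n (-mu)) :
    (fun g => symOp (stdDir n) P (secPair f h g) 0) ∈ Sections n (-lam - mu + 2 * N) := by
  refine ⟨fun g p hp => ?_, fun g => ?_⟩
  · obtain ⟨b, q, a, R, rfl, hq, ha⟩ := par_decomp hp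
    have ha0 : (a : ℂ) ≠ 0 := Complex.ofReal_ne_zero.mpr hq.pos.ne'
    simp only
    rw [← mul_assoc, symOp_levi P f h _ hq, hP' a R hq.orth, ← MvPolynomial.smul_eq_C_mul, map_smul,
      LinearMap.smul_apply, Smooth.smul_apply, symOp_nu hP, chi_eq, ha, Complex.cpow_add _ _ ha0,
      Complex.cpow_sub _ _ ha0, Complex.cpow_neg, Complex.cpow_neg,
      show (2 * N : ℂ) = ((2 * N : ℕ) : ℂ) by push_cast; rfl, Complex.cpow_natCast]
    have h1 : (a : ℂ) ^ lam ≠ 0 := by simp [Complex.cpow_eq_zero_iff, ha0]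
    have h2 : (a : ℂ) ^ mu ≠ 0 := by simp [Complex.cpow_eq_zero_iff, ha0]
    rw [inv_pow]
    field_simp
  · simp only [symOp_mul_nbar]
    exact contDiff_diag _

/-- The bilinear operator with a given symbol. -/
def bilinOp {lam mu : ℂ} {N : ℕ} {P : Symb n} (hP : ∀ k, nilOp₂ lam mu k P = 0)
    (hP' : ∀ (a : ℝ) (R : Matrix (Fin n) (Fin n) ℝ), R * Rᵀ = 1 →
      leviSubst a R P = MvPolynomial.C ((a : ℂ)⁻¹ ^ (2 * N)) * P) :
    BilinMap n (-lam) (-mu) (-lam - mu + 2 * N) :=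
  LinearMap.mk₂ ℂ (fun f h => ⟨_, symOp_section hP hP' f h⟩)
    (fun f f' h => Subtype.ext <| funext fun g => by
      simp only [secPair_add_left, map_add]; rfl)
    (fun c f h => Subtype.ext <| funext fun g => by
      simp only [secPair_smul_left, map_smul]; rfl)
    (fun f h h' => Subtype.ext <| funext fun g => by
      simp only [secPair_add_right, map_add]; rfl)
    (fun c f h => Subtype.ext <| funext fun g => by
      simp only [secPair_smul_right, map_smul]; rfl)

theorem bilinOp_apply {lam mu : ℂ} {N : ℕ} {P : Symb n} (hP : ∀ k, nilOp₂ lam mu k P = 0)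
    (hP' : ∀ (a : ℝ) (R : Matrix (Fin n) (Fin n) ℝ), R * Rᵀ = 1 →
      leviSubst a R P = MvPolynomial.C ((a : ℂ)⁻¹ ^ (2 * N)) * P)
    (f : Sections n (-lam)) (h : Sections n (-mu)) (g : SOo n) :
    (bilinOp hP hP' f h : SOo n → ℂ) g = symOp (stdDir n) P (secPair f h g) 0 := rfl

theorem isConformallyInvariant_bilinOp {lam mu : ℂ} {N : ℕ} {P : Symb n}
    (hP : ∀ k, nilOp₂ lam mu k P = 0)
    (hP' : ∀ (a : ℝ) (R : Matrix (Fin n) (Fin n) ℝ), R * Rᵀ = 1 →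
      leviSubst a R P = MvPolynomial.C ((a : ℂ)⁻¹ ^ (2 * N)) * P) :
    IsConformallyInvariant (bilinOp hP hP') where
  differential := by
    obtain ⟨k, hk⟩ := exists_symOp_tensor_eq_zero P
    exact ⟨k, fun g f h hfh => hk (secFun f g) (secFun h g) hfh⟩
  equivariant g f h := by
    refine Subtype.ext (funext fun x => ?_)
    rw [bilinOp_apply, secPair_act]
    rfl

variable {N : ℕ} {lam mu : ℂ} {a : ℕ → ℕ → ℂ}

/-- The invariant operator given by the coefficients `a`, for a solution `a` of the invariance
equations. -/
def IsSol.op (ha : IsSol n N lam mu a) : BilinMap n (-lam) (-mu) (-lam - mu + 2 * N) :=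
  bilinOp (P := symbol n N a) ha.nilOp₂_eq_zero fun b _ hR => leviSubst_symbol N a b hR

theorem IsSol.isConformallyInvariant (ha : IsSol n N lam mu a) : IsConformallyInvariant ha.op :=
  isConformallyInvariant_bilinOp _ _

theorem IsSol.op_apply (ha : IsSol n N lam mu a) (f : Sections n (-lam)) (h : Sections n (-mu))
    (g : SOo n) :
    (ha.op f h : SOo n → ℂ) g = symOp (stdDir n) (symbol n N a) (secPair f h g) 0 := rfl

theorem IsSol.hasForm (ha : IsSol n N lam mu a) : HasForm N a ha.op := by
  intro f h x
  have h1 := sum_iterate_toFun2 N a (secPair f h 1) x x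
  rw [ha.op_apply, ← one_mul (nbar n x), symOp_mul_nbar, ← h1]
  have h2 : toFun2 (secPair f h 1) =
      fun y z => (f : SOo n → ℂ) (nbar n y) * (h : SOo n → ℂ) (nbar n z) := by
    funext y z
    rw [toFun2, secPair_apply, one_mul, one_mul]
  rw [h2]

theorem IsSol.eq_zero_of_op_eq_zero (hn : 2 ≤ n) (ha : IsSol n N lam mu a) (h0 : ha.op = 0) :
    ∀ i j, i + j ≤ N → a i j = 0 := by
  refine eq_zero_of_symbol_eq_zero hn ?_
  refine symbol_eq_zero_of_forall_sections (w₁ := -lam) (w₂ := -mu) fun f h => ?_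
  rw [← ha.op_apply, h0]
  rfl

end Existence

/-! ### Failure of uniqueness for exceptional parameters -/

section Exceptional

variable {n : ℕ}

theorem symbol_add_mul (n N : ℕ) (a b : ℕ → ℕ → ℂ) (c : ℂ) :
    symbol n N (fun i j => a i j + c * b i j) =
      symbol n N a + MvPolynomial.C c * symbol n N b := by
  rw [symbol, symbol, symbol, mul_triSum, ← triSum_add]
  refine triSum_congr fun i j _ => ?_
  rw [map_add, map_mul]
  ring

theorem symbol_congr {N : ℕ} {a b : ℕ → ℕ → ℂ} (h : ∀ i j, i + j ≤ N → a i j = b i j) :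
    symbol n N a = symbol n N b :=
  triSum_congr fun i j hij => by rw [h i j (by omega)]

theorem IsSol.op_add_mul {N : ℕ} {lam mu : ℂ} {a b : ℕ → ℕ → ℂ} (ha : IsSol n N lam mu a)
    (hb : IsSol n N lam mu b) (c : ℂ) : (ha.add_mul hb c).op = ha.op + c • hb.op := by
  refine LinearMap.ext₂ fun f h => Subtype.ext (funext fun g => ?_)
  change _ = (ha.op f h : SOo n → ℂ) g + c * (hb.op f h : SOo n → ℂ) g
  rw [IsSol.op_apply, symbol_add_mul, map_add, LinearMap.add_apply, Smooth.add_apply,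
    ← MvPolynomial.smul_eq_C_mul, map_smul]
  rfl

theorem linearIndependent_pair {M : Type*} [AddCommMonoid M] [Module ℂ M] {x y : M}
    (h : ∀ s t : ℂ, s • x + t • y = 0 → s = 0 ∧ t = 0) : LinearIndependent ℂ ![x, y] := by
  let := Module.addCommMonoidToAddCommGroup ℂ (M := M)
  exact LinearIndependent.pair_iff.mpr h

theorem IsSol.linearIndependent_op (hn : 2 ≤ n) {N : ℕ} {lam mu : ℂ} {a b : ℕ → ℕ → ℂ}
    (ha : IsSol n N lam mu a) (hb : IsSol n N lam mu b) {i j k l : ℕ} (hij : i + j ≤ N)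
    (hkl : k + l ≤ N) (h1 : a i j = 1) (h3 : b i j = 0) (h4 : b k l = 1) :
    LinearIndependent ℂ ![ha.op, hb.op] := by
  refine linearIndependent_pair ?_
  have hb0 : hb.op ≠ 0 := fun h => by
    have := hb.eq_zero_of_op_eq_zero hn h k l hkl
    rw [h4] at this
    exact one_ne_zero this
  intro s t hst
  have hs : s = 0 := by
    by_contra hs
    have h : (ha.add_mul hb (t / s)).op = 0 := by
      have h5 : s⁻¹ • (s • ha.op + t • hb.op) = 0 := by rw [hst, smul_zero]
      rwa [smul_add, smul_smul, smul_smul, inv_mul_cancel₀ hs, one_smul, inv_mul_eq_div,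
        ← IsSol.op_add_mul] at h5
    have := IsSol.eq_zero_of_op_eq_zero hn _ h i j hij
    rw [h1, h3] at this
    simp at this
  refine ⟨hs, ?_⟩
  rw [hs, zero_smul, zero_add, smul_eq_zero] at hst
  exact hst.resolve_right hb0

/-- For `λ = μ = 1 - n/2` both `Δ_x` and `Δ_y` are invariant. -/
theorem exists_linearIndependent (hn : 2 ≤ n) :
    ∃ B B' : BilinMap n (-(1 - (n : ℂ) / 2)) (-(1 - (n : ℂ) / 2))
        (-(1 - (n : ℂ) / 2) - (1 - (n : ℂ) / 2) + 2 * (1 : ℕ)),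
      IsConformallyInvariant B ∧ IsConformallyInvariant B' ∧ LinearIndependent ℂ ![B, B'] := by
  have key : ∀ i j : ℕ, (i = 1 ∧ j = 0) ∨ (i = 0 ∧ j = 1) →
      IsSol n 1 (1 - (n : ℂ) / 2) (1 - (n : ℂ) / 2)
        fun k l => if k = i ∧ l = j then 1 else 0 := by
    rintro i j (⟨rfl, rfl⟩ | ⟨rfl, rfl⟩)
    all_goals
      constructor
      all_goals
        intro k l hkl
        obtain ⟨rfl, rfl⟩ : k = 0 ∧ l = 0 := by omega
        simp [defect, shiftSeq]
        try ring
  have h1 := key 1 0 (Or.inl ⟨rfl, rfl⟩)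
  have h2 := key 0 1 (Or.inr ⟨rfl, rfl⟩)
  exact ⟨h1.op, h2.op, h1.isConformallyInvariant, h2.isConformallyInvariant,
    h1.linearIndependent_op hn h2 (i := 1) (j := 0) (k := 0) (l := 1) le_rfl le_rfl
      (by simp) (by simp) (by simp)⟩

end Exceptional

/-! ### The symbol of an invariant bilinear differential operator -/

section Uniqueness

variable {n : ℕ}

/-- The standard basis of `ℝⁿ`. -/
def stdVec (n : ℕ) (k : Fin n) : EuclideanSpace ℝ (Fin n) := EuclideanSpace.single k 1

theorem symOp_prod_X (m : ℕ) (t : Fin m → Fin n) (u : Smooth (EuclideanSpace ℝ (Fin n)))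
    (x : EuclideanSpace ℝ (Fin n)) :
    symOp (stdVec n) (∏ i, MvPolynomial.X (t i)) u x =
      iteratedFDeriv ℝ m u x fun i => stdVec n (t i) := by
  induction m generalizing x with
  | zero => simp
  | succ m ih =>
    have hd : DifferentiableAt ℝ (iteratedFDeriv ℝ m u) x :=
      (contDiff_smooth u).differentiable_iteratedFDeriv
        (by exact_mod_cast ENat.natCast_lt_top m) x
    rw [Fin.prod_univ_succ, map_mul, symOp_X, Module.End.mul_apply, pd_apply,
      iteratedFDeriv_succ_apply_left]
    have h1 : (symOp (stdVec n) (∏ i : Fin m, MvPolynomial.X (t i.succ)) u : _ → ℂ) =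
        fun y => iteratedFDeriv ℝ m u y fun i => stdVec n (t i.succ) :=
      funext fun y => ih (fun i => t i.succ) y
    rw [h1]
    have h2 := ((ContinuousMultilinearMap.apply ℝ (fun _ : Fin m => EuclideanSpace ℝ (Fin n)) ℂ
      (fun i => stdVec n (t i.succ))).hasFDerivAt.comp x hd.hasFDerivAt).fderiv
    change fderiv ℝ (fun y => iteratedFDeriv ℝ m u y fun i => stdVec n (t i.succ)) x = _ at h2
    rw [h2]
    rfl

theorem symOp_rename_inl (p : MvPolynomial (Fin n) ℂ) (φ ψ : Smooth (EuclideanSpace ℝ (Fin n))) :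
    symOp (stdDir n) (MvPolynomial.rename Sum.inl p) (tensor φ ψ) =
      tensor (symOp (stdVec n) p φ) ψ := by
  induction p using MvPolynomial.induction_on generalizing φ with
  | C c => rw [MvPolynomial.rename_C, symOp_C, symOp_C]; ext p; exact (mul_assoc _ _ _).symm
  | add p q hp hq =>
    rw [map_add, map_add, map_add, LinearMap.add_apply, LinearMap.add_apply, hp, hq]
    ext x; exact (add_mul _ _ _).symm
  | mul_X p s hp => rw [map_mul, MvPolynomial.rename_X, symOp_mul_X, symOp_mul_X, pd_inl_tensor, hp]; rfl

theorem symOp_rename_inr (p : MvPolynomial (Fin n) ℂ) (φ ψ : Smooth (EuclideanSpace ℝ (Fin n))) :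
    symOp (stdDir n) (MvPolynomial.rename Sum.inr p) (tensor φ ψ) =
      tensor φ (symOp (stdVec n) p ψ) := by
  induction p using MvPolynomial.induction_on generalizing ψ with
  | C c => rw [MvPolynomial.rename_C, symOp_C, symOp_C]; ext p; exact mul_left_comm _ _ _
  | add p q hp hq =>
    rw [map_add, map_add, map_add, LinearMap.add_apply, LinearMap.add_apply, hp, hq]
    ext x; exact (mul_add _ _ _).symm
  | mul_X p s hp => rw [map_mul, MvPolynomial.rename_X, symOp_mul_X, symOp_mul_X, pd_inr_tensor, hp]; rfl

/-- The indices of the partial derivatives of order at most `k`. -/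
abbrev JetIdx (n k : ℕ) : Type := Σ m : Fin (k + 1), Fin m → Fin n

/-- The symbol of a partial derivative. -/
def jetMon {k : ℕ} (j : JetIdx n k) : MvPolynomial (Fin n) ℂ := ∏ i, MvPolynomial.X (j.2 i)

/-- The partial derivatives of order at most `k` of a section at the base point. -/
def jetMap (n k : ℕ) (w : ℂ) : Sections n w →ₗ[ℂ] JetIdx n k → ℂ where
  toFun f j := symOp (stdVec n) (jetMon j) (secFun f 1) 0
  map_add' f h := by
    funext j
    rw [show secFun (f + h) 1 = secFun f 1 + secFun h 1 from rfl, map_add]; rfl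
  map_smul' c f := by
    funext j
    rw [show secFun (c • f) 1 = c • secFun f 1 from rfl, map_smul]; rfl

theorem jetMap_apply {k : ℕ} {w : ℂ} (f : Sections n w) (j : JetIdx n k) :
    jetMap n k w f j = symOp (stdVec n) (jetMon j) (secFun f 1) 0 := rfl

theorem jetVanishes_of_jetMap {k : ℕ} {w : ℂ} {f : Sections n w} (h : jetMap n k w f = 0) :
    JetVanishes k 1 f := by
  intro m hm
  have h1 : (iteratedFDeriv ℝ m (secFun f 1) 0).toMultilinearMap = 0 := by
    refine Module.Basis.ext_multilinear
      (fun _ => (EuclideanSpace.basisFun (Fin n) ℝ).toBasis) fun t => ?_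
    have h2 := congrFun h (⟨⟨m, by omega⟩, t⟩ : JetIdx n k)
    rw [jetMap_apply, jetMon, symOp_prod_X] at h2
    simpa [stdVec] using h2
  ext t
  exact congrArg (fun T => T t) h1

/-- Every linear map between vector spaces has a generalized inverse. -/
theorem exists_generalizedInverse {V W : Type*} [AddCommGroup V] [Module ℂ V] [AddCommGroup W]
    [Module ℂ W] (T : V →ₗ[ℂ] W) : ∃ S : W →ₗ[ℂ] V, ∀ v, T (S (T v)) = T v := by
  obtain ⟨g, hg⟩ := T.rangeRestrict.exists_rightInverse_of_surjective T.range_rangeRestrict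
  obtain ⟨S, hS⟩ := g.exists_extend
  refine ⟨S, fun v => ?_⟩
  have h1 : S (T v) = g (T.rangeRestrict v) := LinearMap.congr_fun hS (T.rangeRestrict v)
  have h2 : T.rangeRestrict (g (T.rangeRestrict v)) = T.rangeRestrict v :=
    LinearMap.congr_fun hg _
  rw [h1]
  exact congrArg Subtype.val h2

/-- An invariant bilinear differential operator has a symbol with constant coefficients. -/
theorem exists_symbol_of_isConformallyInvariant {w₁ w₂ w₃ : ℂ} {B : BilinMap n w₁ w₂ w₃}
    (hB : IsConformallyInvariant B) : ∃ P : Symb n, ∀ f h g,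
      (B f h : SOo n → ℂ) g = symOp (stdDir n) P (secPair f h g) 0 := by
  obtain ⟨k, hk⟩ := hB.differential
  obtain ⟨S₁, hS₁⟩ := exists_generalizedInverse (jetMap n k w₁)
  obtain ⟨S₂, hS₂⟩ := exists_generalizedInverse (jetMap n k w₂)
  let b : JetIdx n k → JetIdx n k → ℂ := fun i j =>
    (B (S₁ (Pi.single i 1)) (S₂ (Pi.single j 1)) : SOo n → ℂ) 1
  let ev : Sections n w₃ →ₗ[ℂ] ℂ := (LinearMap.proj 1).comp (Sections n w₃).subtype
  refine ⟨∑ i, ∑ j, MvPolynomial.C (b i j) *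
    (MvPolynomial.rename Sum.inl (jetMon i) * MvPolynomial.rename Sum.inr (jetMon j)), ?_⟩
  have base : ∀ f h, (B f h : SOo n → ℂ) 1 = ∑ i, ∑ j, b i j *
      (jetMap n k w₁ f i * jetMap n k w₂ h j) := by
    intro f h
    have h1 : ev (B f h) = ev (B (S₁ (jetMap n k w₁ f)) h) := by
      have : ev (B (f - S₁ (jetMap n k w₁ f)) h) = 0 :=
        hk 1 _ _ (Or.inl (jetVanishes_of_jetMap (by rw [map_sub, hS₁, sub_self])))
      rwa [map_sub, LinearMap.sub_apply, map_sub, sub_eq_zero] at this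
    have h2 : ev (B (S₁ (jetMap n k w₁ f)) h) =
        ev (B (S₁ (jetMap n k w₁ f)) (S₂ (jetMap n k w₂ h))) := by
      have : ev (B (S₁ (jetMap n k w₁ f)) (h - S₂ (jetMap n k w₂ h))) = 0 :=
        hk 1 _ _ (Or.inr (jetVanishes_of_jetMap (by rw [map_sub, hS₂, sub_self])))
      rwa [map_sub, map_sub, sub_eq_zero] at this
    have e : ∀ v : JetIdx n k → ℂ, v = ∑ i, v i • (Pi.single i 1 : JetIdx n k → ℂ) := fun v => by
      classical
      exact pi_eq_sum_univ' v
    change ev (B f h) = _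
    rw [h1, h2]
    conv_lhs => rw [e (jetMap n k w₁ f), e (jetMap n k w₂ h)]
    simp only [map_sum, map_smul, LinearMap.sum_apply, LinearMap.smul_apply, smul_eq_mul,
      Finset.mul_sum]
    rw [Finset.sum_comm]
    refine Finset.sum_congr rfl fun i _ => Finset.sum_congr rfl fun j _ => ?_
    change _ * (_ * b i j) = _
    ring
  have base' : ∀ f h, (B f h : SOo n → ℂ) 1 = symOp (stdDir n) (∑ i, ∑ j, MvPolynomial.C (b i j) *
      (MvPolynomial.rename Sum.inl (jetMon i) * MvPolynomial.rename Sum.inr (jetMon j)))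
      (secPair f h 1) 0 := by
    intro f h
    rw [base]
    simp only [map_sum, LinearMap.sum_apply, Smooth.sum_apply]
    refine Finset.sum_congr rfl fun i _ => Finset.sum_congr rfl fun j _ => ?_
    rw [← MvPolynomial.smul_eq_C_mul, map_smul, map_mul, LinearMap.smul_apply, Smooth.smul_apply,
      Module.End.mul_apply, secPair, symOp_rename_inr, symOp_rename_inl]
    rfl
  intro f h g
  have h1 : (B (act g⁻¹ f) (act g⁻¹ h) : SOo n → ℂ) 1 = (act g⁻¹ (B f h) : SOo n → ℂ) 1 := by
    rw [hB.equivariant]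
  have h2 : (act g⁻¹ (B f h) : SOo n → ℂ) 1 = (B f h : SOo n → ℂ) g := by
    change (B f h : SOo n → ℂ) (g⁻¹⁻¹ * 1) = _
    rw [inv_inv, mul_one]
  rw [← h2, ← h1]
  rw [base', secPair_act, inv_inv, mul_one]

end Uniqueness

/-! ### Invariance of the symbol -/

section InvariantSymbol

variable {n : ℕ}

/-- The matrix of the element of `MA` given by `a > 0` and a rotation `R`. -/
def leviMat (a : ℝ) (R : Matrix (Fin n) (Fin n) ℝ) : Matrix (Idx n) (Idx n) ℝ :=
  Matrix.fromBlocks (Matrix.of fun _ _ => a) 0 0 (Matrix.fromBlocks R 0 0 (Matrix.of fun _ _ => a⁻¹))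

theorem leviMat_plus (a : ℝ) (R : Matrix (Fin n) (Fin n) ℝ) (v : Idx n → ℝ) :
    (leviMat a R *ᵥ v) (iPlus n) = a * v (iPlus n) := by
  simp [leviMat, Matrix.mulVec, dotProduct, Fintype.sum_sum_type]

theorem leviMat_mid (a : ℝ) (R : Matrix (Fin n) (Fin n) ℝ) (v : Idx n → ℝ) (k : Fin n) :
    (leviMat a R *ᵥ v) (iMid k) = (R *ᵥ fun l => v (iMid l)) k := by
  simp [leviMat, Matrix.mulVec, dotProduct, Fintype.sum_sum_type]

theorem leviMat_minus (a : ℝ) (R : Matrix (Fin n) (Fin n) ℝ) (v : Idx n → ℝ) :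
    (leviMat a R *ᵥ v) (iMinus n) = a⁻¹ * v (iMinus n) := by
  simp [leviMat, Matrix.mulVec, dotProduct, Fintype.sum_sum_type]

theorem sum_sq_mulVec {R : Matrix (Fin n) (Fin n) ℝ} (hR : R * Rᵀ = 1) (y : Fin n → ℝ) :
    ∑ k, (R *ᵥ y) k ^ 2 = ∑ k, y k ^ 2 := by
  have h : (R *ᵥ y) ⬝ᵥ (R *ᵥ y) = y ⬝ᵥ y := by
    rw [Matrix.dotProduct_mulVec, Matrix.vecMul_mulVec, mul_eq_one_comm.mp hR, Matrix.vecMul_one]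
  simpa [dotProduct, pow_two] using h

/-- The element of `MA` given by `a > 0` and a rotation `R`. -/
def levi {a : ℝ} (ha : 0 < a) {R : Matrix (Fin n) (Fin n) ℝ} (hR : R * Rᵀ = 1) (hd : R.det = 1) :
    SOo n := by
  have hq : ∀ v, quad n (leviMat a R *ᵥ v) = quad n v := fun v => by
    change ∑ k, (leviMat a R *ᵥ v) (iMid k) ^ 2 - 2 * (leviMat a R *ᵥ v) (iPlus n) *
      (leviMat a R *ᵥ v) (iMinus n) = _
    simp only [leviMat_plus, leviMat_mid, leviMat_minus, sum_sq_mulVec hR, quad]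
    field_simp
  refine ⟨⟨leviMat a R, ?_⟩, hq, fun v => ?_⟩
  · rw [leviMat, Matrix.det_fromBlocks_zero₁₂, Matrix.det_fromBlocks_zero₁₂, hd]
    simp [ha.ne']
  · change leviMat a R *ᵥ v ∈ _ ↔ _
    rw [mem_futureCone_iff, mem_futureCone_iff, hq, leviMat_plus, leviMat_minus,
      mul_nonneg_iff_of_pos_left ha, mul_pos_iff_of_pos_left (inv_pos.mpr ha), mul_eq_zero,
      or_iff_right ha.ne']

theorem isLevi_levi {a : ℝ} (ha : 0 < a) {R : Matrix (Fin n) (Fin n) ℝ} (hR : R * Rᵀ = 1)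
    (hd : R.det = 1) : IsLevi (levi ha hR hd) a R where
  pos := ha
  orth := hR
  plus := by
    change leviMat a R *ᵥ _ = _
    refine idx_ext ?_ (fun k => ?_) ?_
    · rw [leviMat_plus]; rfl
    · rw [leviMat_mid]
      simp [ePlus_mid, Matrix.mulVec, dotProduct]
    · rw [leviMat_minus]; simp [ePlus_minus]
  minus := by
    change leviMat a R *ᵥ _ = _
    refine idx_ext ?_ (fun k => ?_) ?_
    · rw [leviMat_plus]; simp [eMinus_plus]
    · rw [leviMat_mid]
      simp [eMinus_mid, Matrix.mulVec, dotProduct]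
    · rw [leviMat_minus]; rfl
  mid y := by
    change leviMat a R *ᵥ _ = _
    refine idx_ext ?_ (fun k => ?_) ?_
    · rw [leviMat_plus]; simp [midVec_plus]
    · rw [leviMat_mid]; rfl
    · rw [leviMat_minus]; simp [midVec_minus]

/-- Symbols of weight `-2N` that are invariant under rotations and annihilated by `𝔫`. -/
structure IsInvariantSymbol (N : ℕ) (lam mu : ℂ) (P : Symb n) : Prop where
  nil : ∀ k, nilOp₂ lam mu k P = 0
  levi : ∀ (a : ℝ) (R : Matrix (Fin n) (Fin n) ℝ), 0 < a → R * Rᵀ = 1 → R.det = 1 →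
    leviSubst a R P = MvPolynomial.C ((a : ℂ)⁻¹ ^ (2 * N)) * P

theorem IsSol.isInvariantSymbol {N : ℕ} {lam mu : ℂ} {a : ℕ → ℕ → ℂ} (ha : IsSol n N lam mu a) :
    IsInvariantSymbol N lam mu (symbol n N a) :=
  ⟨ha.nilOp₂_eq_zero, fun b _ _ hR _ => leviSubst_symbol N a b hR⟩

theorem nilOp₂_sub_C_mul (lam mu : ℂ) (k : Fin n) (c : ℂ) (p q : Symb n) :
    nilOp₂ lam mu k (p - MvPolynomial.C c * q) =
      nilOp₂ lam mu k p - MvPolynomial.C c * nilOp₂ lam mu k q := by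
  have h : ∀ p, nilOp₂ lam mu k p = (nilOpLin Sum.inl lam k + nilOpLin Sum.inr mu k) p :=
    fun _ => rfl
  simp only [h, ← MvPolynomial.smul_eq_C_mul, map_sub, map_smul]

theorem IsInvariantSymbol.sub_C_mul {N : ℕ} {lam mu : ℂ} {P Q : Symb n}
    (hP : IsInvariantSymbol N lam mu P) (hQ : IsInvariantSymbol N lam mu Q) (c : ℂ) :
    IsInvariantSymbol N lam mu (P - MvPolynomial.C c * Q) := by
  refine ⟨fun k => ?_, fun a R ha hR hd => ?_⟩
  · rw [nilOp₂_sub_C_mul, hP.nil, hQ.nil, mul_zero, sub_zero]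
  · have hC : leviSubst a R (MvPolynomial.C c) = MvPolynomial.C c := (leviSubst a R).commutes c
    rw [map_sub, map_mul, hC, hP.levi a R ha hR hd, hQ.levi a R ha hR hd]
    ring

/-- The symbol of an invariant operator is invariant. -/
theorem isInvariantSymbol_of_isConformallyInvariant {N : ℕ} {lam mu : ℂ}
    {B : BilinMap n (-lam) (-mu) (-lam - mu + 2 * N)} {P : Symb n}
    (hP : ∀ f h g, (B f h : SOo n → ℂ) g = symOp (stdDir n) P (secPair f h g) 0) :
    IsInvariantSymbol N lam mu P where
  nil k := by
    refine symbol_eq_zero_of_forall_sections (w₁ := -lam) (w₂ := -mu) fun f h => ?_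
    have h1 := hasDerivAt_symOp_nu f h 1 (EuclideanSpace.single k 1) P
    have h2 : ∀ t : ℝ, symOp (stdDir n) P
        (secPair f h (1 * nu (t • EuclideanSpace.single k (1 : ℝ)))) 0 = (B f h : SOo n → ℂ) 1 := by
      intro t
      have h3 : mat (nu (t • EuclideanSpace.single k (1 : ℝ))) *ᵥ ePlus n = (1 : ℝ) • ePlus n := by
        rw [mat_nu]
        refine idx_ext ?_ (fun k => ?_) ?_
        · rw [nuMat_plus]; simp [ePlus_mid, ePlus_minus]
        · rw [nuMat_mid]; simp [ePlus_mid, ePlus_minus]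
        · rw [nuMat_minus]; simp [ePlus_minus]
      have h4 := (B f h).2.1 1 (nu (t • EuclideanSpace.single k (1 : ℝ))) ⟨1, one_pos, h3⟩
      rw [← hP]
      rw [h4, chi_eq, col, h3]
      simp [ePlus_plus]
    simp only [h2] at h1
    have h5 := h1.unique (hasDerivAt_const _ _)
    rw [neg_eq_zero, Finset.sum_eq_single k (fun l _ hl => by simp [hl]) (by simp)] at h5
    simpa using h5
  levi a R ha hR hd := by
    rw [← sub_eq_zero]
    refine symbol_eq_zero_of_forall_sections (w₁ := -lam) (w₂ := -mu) fun f h => ?_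
    have hq := isLevi_levi ha hR hd
    have h1 := symOp_levi P f h 1 hq
    have ha0 : (a : ℂ) ≠ 0 := Complex.ofReal_ne_zero.mpr ha.ne'
    have h4 := (B f h).2.1 1 (levi ha hR hd) ⟨a, ha, hq.plus⟩
    rw [← hP, h4, chi_eq, col, hq.plus, Pi.smul_apply, ePlus_plus, smul_eq_mul, mul_one, hP,
      Complex.cpow_add _ _ ha0,
      Complex.cpow_sub _ _ ha0, Complex.cpow_neg, Complex.cpow_neg,
      show (2 * N : ℂ) = ((2 * N : ℕ) : ℂ) by push_cast; rfl, Complex.cpow_natCast] at h1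
    have e1 : (a : ℂ) ^ lam ≠ 0 := by simp [Complex.cpow_eq_zero_iff, ha0]
    have e2 : (a : ℂ) ^ mu ≠ 0 := by simp [Complex.cpow_eq_zero_iff, ha0]
    rw [map_sub, LinearMap.sub_apply, Smooth.sub_apply, ← MvPolynomial.smul_eq_C_mul, map_smul,
      LinearMap.smul_apply, Smooth.smul_apply, sub_eq_zero]
    rw [inv_inv, inv_inv] at h1
    refine mul_left_cancel₀ (mul_ne_zero e1 e2) (h1.symm.trans ?_)
    rw [inv_pow]
    field_simp

/-- Rescaling the variables multiplies the coefficients. -/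
theorem coeff_aeval_C_mul_X {σ : Type*} [Fintype σ] (ε : σ → ℂ) (p : MvPolynomial σ ℂ) (m : σ →₀ ℕ) :
    MvPolynomial.coeff m (MvPolynomial.aeval
      (fun s => MvPolynomial.C (ε s) * MvPolynomial.X s : σ → MvPolynomial σ ℂ) p) =
      (∏ s, ε s ^ m s) * MvPolynomial.coeff m p := by
  classical
  induction p using MvPolynomial.induction_on' with
  | monomial u c =>
    have h : MvPolynomial.aeval (fun s => MvPolynomial.C (ε s) * MvPolynomial.X s :
        σ → MvPolynomial σ ℂ) (MvPolynomial.monomial u c) =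
        MvPolynomial.C (∏ s, ε s ^ u s) * MvPolynomial.monomial u c := by
      rw [MvPolynomial.aeval_monomial, MvPolynomial.algebraMap_eq,
        Finsupp.prod_fintype _ _ (fun s => pow_zero _), MvPolynomial.monomial_eq,
        Finsupp.prod_fintype _ _ (fun s => pow_zero _)]
      simp only [mul_pow, Finset.prod_mul_distrib, map_prod, map_pow]
      ring
    rw [h, MvPolynomial.coeff_C_mul, MvPolynomial.coeff_monomial]
    split_ifs with hu
    · rw [hu]
    · simp
  | add p q hp hq => rw [map_add, MvPolynomial.coeff_add, hp, hq, MvPolynomial.coeff_add, mul_add]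

theorem leviSubst_diagonal (a : ℝ) (ε : Fin n → ℝ) :
    leviSubst a (Matrix.diagonal ε) = MvPolynomial.aeval fun s =>
      MvPolynomial.C (((a⁻¹ * s.elim ε ε : ℝ)) : ℂ) * MvPolynomial.X s := by
  refine MvPolynomial.algHom_ext fun s => ?_
  rw [leviSubst, MvPolynomial.aeval_X, MvPolynomial.aeval_X]
  rcases s with k | k
  all_goals
    simp only [Sum.elim_inl, Sum.elim_inr]
    rw [Finset.sum_eq_single k (fun l _ hl => by simp [Matrix.diagonal_apply_ne _ hl])
      (by simp), Matrix.diagonal_apply_eq]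

/-- The symbol of an invariant operator is homogeneous of degree `2N`. -/
theorem IsInvariantSymbol.degree {N : ℕ} {lam mu : ℂ} {P : Symb n}
    (hP : IsInvariantSymbol N lam mu P) {m : Fin n ⊕ Fin n →₀ ℕ}
    (hm : MvPolynomial.coeff m P ≠ 0) : ∑ s, m s = 2 * N := by
  have h := congrArg (MvPolynomial.coeff m) (hP.levi 2 1 two_pos (by simp) (by simp))
  rw [← Matrix.diagonal_one, leviSubst_diagonal, coeff_aeval_C_mul_X, MvPolynomial.coeff_C_mul] at h
  have h1 := mul_right_cancel₀ hm h
  have h2 : ∀ s : Fin n ⊕ Fin n, (((2 : ℝ)⁻¹ * s.elim (fun _ => (1 : ℝ)) fun _ => 1 : ℝ) : ℂ) =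
      (2 : ℂ)⁻¹ := by
    rintro (k | k) <;> simp
  simp only [h2, Finset.prod_pow_eq_pow_sum, Complex.ofReal_ofNat] at h1
  rw [inv_pow, inv_pow, inv_inj] at h1
  exact Nat.pow_right_injective le_rfl (by exact_mod_cast h1)

/-- Rotations by diagonal matrices act by signs on the coefficients. -/
theorem IsInvariantSymbol.sign {N : ℕ} {lam mu : ℂ} {P : Symb n}
    (hP : IsInvariantSymbol N lam mu P) {m : Fin n ⊕ Fin n →₀ ℕ}
    (hm : MvPolynomial.coeff m P ≠ 0) {ε : Fin n → ℝ} (hε : ∀ k, ε k ^ 2 = 1)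
    (hε' : ∏ k, ε k = 1) : ∏ k, (ε k : ℂ) ^ (m (Sum.inl k) + m (Sum.inr k)) = 1 := by
  have h := congrArg (MvPolynomial.coeff m) (hP.levi 1 (Matrix.diagonal ε) one_pos
    (by
      rw [Matrix.diagonal_transpose, Matrix.diagonal_mul_diagonal, ← Matrix.diagonal_one]
      congr 1
      funext k
      rw [← pow_two, hε]) (by rw [Matrix.det_diagonal, hε']))
  rw [leviSubst_diagonal, coeff_aeval_C_mul_X, MvPolynomial.coeff_C_mul] at h
  have h1 := mul_right_cancel₀ hm h
  simpa [Fintype.prod_sum_type, ← Finset.prod_mul_distrib, ← pow_add] using h1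

end InvariantSymbol

/-! ### Rotation invariant symbols for `n ≥ 3` -/

section Rotation

variable {m : ℕ}

/-- The pair of vectors `ξ = (s, 0, …)`, `η = (u, v, 0, …)`. -/
def planePt (m : ℕ) (s u v : ℂ) : Fin (m + 3) ⊕ Fin (m + 3) → ℂ :=
  Sum.elim (Fin.cons s fun _ => 0) (Fin.cons u (Fin.cons v fun _ => 0))

theorem exists_even_monomial {α β γ : ℕ} (h1 : Even γ) (h2 : Even (α + β)) (c : ℂ) :
    ∃ (M : ℕ) (Q : MvPolynomial (Fin 3) ℂ), ∀ s u v : ℂ,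
      (s ^ 2) ^ M * (c * (s ^ α * (u ^ β * v ^ γ))) =
        MvPolynomial.eval ![s ^ 2, u ^ 2 + v ^ 2, s * u] Q := by
  obtain ⟨g, rfl⟩ := h1
  obtain ⟨d, hd⟩ := h2
  refine ⟨β + g, MvPolynomial.C c * (MvPolynomial.X 2 ^ β *
    (MvPolynomial.X 0 * MvPolynomial.X 1 - MvPolynomial.X 2 ^ 2) ^ g * MvPolynomial.X 0 ^ d), ?_⟩
  intro s u v
  simp only [map_mul, map_pow, map_sub, MvPolynomial.eval_X, MvPolynomial.eval_C,
    Matrix.cons_val]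
  have e1 : s ^ 2 * (u ^ 2 + v ^ 2) - (s * u) ^ 2 = s ^ 2 * v ^ 2 := by ring
  have e2 : (s ^ 2) ^ d = s ^ α * s ^ β := by rw [← pow_mul, ← pow_add, hd]; ring_nf
  rw [e1, e2]
  ring

/-- For a rotation invariant symbol the restriction to the points `planePt` is a polynomial in the
scalar products, up to a power of `|ξ|²`. -/
theorem IsInvariantSymbol.exists_eval_planePt {N : ℕ} {lam mu : ℂ} {P : Symb (m + 3)}
    (hP : IsInvariantSymbol N lam mu P) :
    ∃ (M : ℕ) (Q : MvPolynomial (Fin 3) ℂ), ∀ s u v : ℂ,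
      (s ^ 2) ^ M * MvPolynomial.eval (planePt m s u v) P =
        MvPolynomial.eval ![s ^ 2, u ^ 2 + v ^ 2, s * u] Q := by
  have hsum := P.as_sum
  suffices H : ∃ (M : ℕ) (Q : MvPolynomial (Fin 3) ℂ), ∀ s u v : ℂ,
      (s ^ 2) ^ M * MvPolynomial.eval (planePt m s u v)
        (∑ d ∈ P.support, MvPolynomial.monomial d (MvPolynomial.coeff d P)) =
        MvPolynomial.eval ![s ^ 2, u ^ 2 + v ^ 2, s * u] Q by rwa [← hsum] at H
  refine Finset.sum_induction (M := Symb (m + 3)) _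
    (fun p => ∃ (M : ℕ) (Q : MvPolynomial (Fin 3) ℂ), ∀ s u v : ℂ,
      (s ^ 2) ^ M * MvPolynomial.eval (planePt m s u v) p =
        MvPolynomial.eval ![s ^ 2, u ^ 2 + v ^ 2, s * u] Q) ?_ ⟨0, 0, by simp⟩ ?_
  · rintro p q ⟨M, Q, h⟩ ⟨M', Q', h'⟩
    refine ⟨M + M', MvPolynomial.X 0 ^ M' * Q + MvPolynomial.X 0 ^ M * Q', fun s u v => ?_⟩
    rw [map_add, map_add, map_mul, map_mul, ← h, ← h', map_pow, map_pow, MvPolynomial.eval_X,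
      Matrix.cons_val_zero]
    ring
  · intro d hd
    have hc := MvPolynomial.mem_support_iff.mp hd
    set c := MvPolynomial.coeff d P
    have hev : ∀ s u v : ℂ, MvPolynomial.eval (planePt m s u v) (MvPolynomial.monomial d c) =
        c * ((s ^ d (Sum.inl 0) * ∏ k : Fin (m + 2), 0 ^ d (Sum.inl k.succ)) *
          (u ^ d (Sum.inr 0) * (v ^ d (Sum.inr 1) *
            ∏ k : Fin (m + 1), 0 ^ d (Sum.inr k.succ.succ)))) := by
      intro s u v
      rw [MvPolynomial.eval_monomial, Finsupp.prod_fintype _ _ (fun s => pow_zero _),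
        Fintype.prod_sum_type]
      congr 2
      · exact Fin.prod_univ_succ _
      · rw [Fin.prod_univ_succ, Fin.prod_univ_succ]
        rfl
    by_cases h1 : ∃ k : Fin (m + 2), d (Sum.inl k.succ) ≠ 0
    · obtain ⟨k, hk⟩ := h1
      refine ⟨0, 0, fun s u v => ?_⟩
      rw [hev, Finset.prod_eq_zero (Finset.mem_univ k) (zero_pow hk)]
      simp
    by_cases h2 : ∃ k : Fin (m + 1), d (Sum.inr k.succ.succ) ≠ 0
    · obtain ⟨k, hk⟩ := h2
      refine ⟨0, 0, fun s u v => ?_⟩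
      rw [hev, Finset.prod_eq_zero (Finset.mem_univ k) (zero_pow hk)]
      simp
    push Not at h1 h2
    have hl1 : d (Sum.inl 1) = 0 := h1 0
    have hl2 : d (Sum.inl 2) = 0 := h1 1
    have hr2 : d (Sum.inr 2) = 0 := h2 0
    have hsign : ∀ x y z : ℝ, x ^ 2 = 1 → y ^ 2 = 1 → z ^ 2 = 1 → x * y * z = 1 →
        (x : ℂ) ^ (d (Sum.inl 0) + d (Sum.inr 0)) * (y : ℂ) ^ d (Sum.inr 1) = 1 := by
      intro x y z hx hy hz hxyz
      have h := hP.sign hc (ε := Fin.cons x (Fin.cons y (Fin.cons z fun _ => 1)))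
        (by
          refine Fin.cases hx (Fin.cases hy (Fin.cases hz fun i => ?_))
          exact one_pow 2)
        (by simp [Fin.prod_univ_succ, ← mul_assoc, hxyz])
      rw [Fin.prod_univ_succ, Fin.prod_univ_succ, Fin.prod_univ_succ] at h
      simp only [h1, h2, Fin.cons_succ, Fin.cons_zero, add_zero, pow_zero, Complex.ofReal_one,
        Finset.prod_const_one, mul_one, zero_add] at h
      exact h
    have hg : Even (d (Sum.inr 1)) := by
      have := hsign 1 (-1) (-1) (by norm_num) (by norm_num) (by norm_num) (by norm_num)
      push_cast at this
      rw [one_pow, one_mul] at this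
      exact (neg_one_pow_eq_one_iff_even (by norm_num)).mp this
    have hab : Even (d (Sum.inl 0) + d (Sum.inr 0)) := by
      have := hsign (-1) 1 (-1) (by norm_num) (by norm_num) (by norm_num) (by norm_num)
      push_cast at this
      rw [one_pow, mul_one] at this
      exact (neg_one_pow_eq_one_iff_even (by norm_num)).mp this
    obtain ⟨M, Q, hQ⟩ := exists_even_monomial hg hab c
    refine ⟨M, Q, fun s u v => ?_⟩
    rw [hev, ← hQ]
    simp only [h1, h2, pow_zero, Finset.prod_const_one, mul_one]

/-- Two vectors can be rotated into the standard position. -/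
theorem exists_rotation (ξ η : EuclideanSpace ℝ (Fin (m + 3))) :
    ∃ R : Matrix (Fin (m + 3)) (Fin (m + 3)) ℝ, R * Rᵀ = 1 ∧ R.det = 1 ∧
      (∀ k : Fin (m + 2), (R *ᵥ fun l => ξ l) k.succ = 0) ∧
      ∀ k : Fin (m + 1), (R *ᵥ fun l => η l) k.succ.succ = 0 := by
  let f : Fin (m + 3) → EuclideanSpace ℝ (Fin (m + 3)) := Fin.cons ξ (Fin.cons η fun _ => 0)
  let b := InnerProductSpace.gramSchmidtOrthonormalBasis (𝕜 := ℝ) (by simp) f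
  let R : Matrix (Fin (m + 3)) (Fin (m + 3)) ℝ := Matrix.of fun k l => b k l
  have hmul : ∀ (v : EuclideanSpace ℝ (Fin (m + 3))) k, (R *ᵥ fun l => v l) k = inner ℝ (b k) v := by
    intro v k
    simp [R, Matrix.mulVec, dotProduct, PiLp.inner_apply, mul_comm]
  have hR : R * Rᵀ = 1 := by
    ext k l
    have h := orthonormal_iff_ite.mp b.orthonormal k l
    rw [Matrix.one_apply, ← h]
    simp [R, Matrix.mul_apply, PiLp.inner_apply, mul_comm]
  have hξ : ∀ k : Fin (m + 2), (R *ᵥ fun l => ξ l) k.succ = 0 := fun k => by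
    rw [hmul]
    exact InnerProductSpace.gramSchmidtOrthonormalBasis_inv_triangular _ f
      (i := 0) (j := k.succ) (Fin.succ_pos k)
  have hη : ∀ k : Fin (m + 1), (R *ᵥ fun l => η l) k.succ.succ = 0 := fun k => by
    rw [hmul]
    exact InnerProductSpace.gramSchmidtOrthonormalBasis_inv_triangular _ f
      (i := Fin.succ 0) (j := k.succ.succ) (Fin.succ_lt_succ_iff.mpr (Fin.succ_pos k))
  have hd : R.det * R.det = 1 := by
    have := congrArg Matrix.det hR
    rwa [Matrix.det_mul, Matrix.det_transpose, Matrix.det_one] at this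
  -- The sign of the determinant is corrected in a direction orthogonal to both vectors.
  let ε : Fin (m + 3) → ℝ := Fin.cons 1 (Fin.cons 1 (Fin.cons R.det fun _ => 1))
  have hε : ∀ k, ε k * ε k = 1 := by
    refine Fin.cases (mul_one 1) (Fin.cases (mul_one 1) (Fin.cases hd fun i => ?_))
    exact mul_one 1
  have hmulε : ∀ (v : Fin (m + 3) → ℝ) k, ((Matrix.diagonal ε * R) *ᵥ v) k = ε k * (R *ᵥ v) k := by
    intro v k
    rw [← Matrix.mulVec_mulVec, Matrix.mulVec_diagonal]
  refine ⟨Matrix.diagonal ε * R, ?_, ?_, fun k => by rw [hmulε, hξ, mul_zero],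
    fun k => by rw [hmulε, hη, mul_zero]⟩
  · rw [Matrix.transpose_mul, Matrix.diagonal_transpose, Matrix.mul_assoc, ← Matrix.mul_assoc R,
      hR, Matrix.one_mul, Matrix.diagonal_mul_diagonal, ← Matrix.diagonal_one]
    exact congrArg _ (funext hε)
  · rw [Matrix.det_mul, Matrix.det_diagonal]
    simp [ε, Fin.prod_univ_succ, hd]

theorem eval_leviSubst {n : ℕ} (R : Matrix (Fin n) (Fin n) ℝ) (c : Fin n ⊕ Fin n → ℂ) (P : Symb n) :
    MvPolynomial.eval c (leviSubst 1 R P) =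
      MvPolynomial.eval (Sum.elim (fun k => ∑ l, (R l k : ℂ) * c (Sum.inl l))
        fun k => ∑ l, (R l k : ℂ) * c (Sum.inr l)) P := by
  have h : (MvPolynomial.aeval c).comp (leviSubst 1 R) =
      MvPolynomial.aeval (R := ℂ) (Sum.elim (fun k => ∑ l, (R l k : ℂ) * c (Sum.inl l))
        fun k => ∑ l, (R l k : ℂ) * c (Sum.inr l)) := by
    refine MvPolynomial.algHom_ext fun s => ?_
    rw [AlgHom.comp_apply, leviSubst, MvPolynomial.aeval_X, MvPolynomial.aeval_X]
    rcases s with k | k <;> simp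
  exact congrArg (fun φ => φ P) h

/-- The scalar products `|ξ|²`, `|η|²`, `⟨ξ, η⟩`. -/
def scalarProducts (n : ℕ) : Fin 3 → Symb n :=
  ![symDot Sum.inl Sum.inl, symDot Sum.inr Sum.inr, symDot Sum.inl Sum.inr]

theorem eval_aeval_scalarProducts {n : ℕ} (c : Fin n ⊕ Fin n → ℂ) (Q : MvPolynomial (Fin 3) ℂ) :
    MvPolynomial.eval c (MvPolynomial.aeval (scalarProducts n) Q) =
      MvPolynomial.eval ![∑ k, c (Sum.inl k) * c (Sum.inl k), ∑ k, c (Sum.inr k) * c (Sum.inr k),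
        ∑ k, c (Sum.inl k) * c (Sum.inr k)] Q := by
  have h : (MvPolynomial.aeval (R := ℂ) c).comp (MvPolynomial.aeval (scalarProducts n)) =
      MvPolynomial.aeval (R := ℂ) ![∑ k, c (Sum.inl k) * c (Sum.inl k),
        ∑ k, c (Sum.inr k) * c (Sum.inr k), ∑ k, c (Sum.inl k) * c (Sum.inr k)] := by
    refine MvPolynomial.algHom_ext fun s => ?_
    rw [AlgHom.comp_apply, MvPolynomial.aeval_X, MvPolynomial.aeval_X]
    fin_cases s
    · exact eval_symDot c _ _
    · exact eval_symDot c _ _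
    · exact eval_symDot c _ _
  exact congrArg (fun φ => φ Q) h

/-- Up to a power of `|ξ|²`, an invariant symbol is a polynomial in the scalar products: rotate `ξ`
and `η` into a coordinate plane, which introduces powers of `|ξ|` as denominators. -/
theorem IsInvariantSymbol.exists_pow_mul_eq {N : ℕ} {lam mu : ℂ} {P : Symb (m + 3)}
    (hP : IsInvariantSymbol N lam mu P) : ∃ (M : ℕ) (Q : MvPolynomial (Fin 3) ℂ),
      symDot Sum.inl Sum.inl ^ M * P = MvPolynomial.aeval (scalarProducts (m + 3)) Q := by
  obtain ⟨M, Q, hQ⟩ := hP.exists_eval_planePt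
  refine ⟨M, Q, MvPolynomial.funext_set (fun _ => Set.range ((↑) : ℝ → ℂ))
    (fun _ => Set.infinite_range_of_injective Complex.ofReal_injective) fun c hc => ?_⟩
  choose r hr using fun s => hc s (Set.mem_univ s)
  obtain rfl : c = fun s => (r s : ℂ) := funext fun s => (hr s).symm
  obtain ⟨R, hR, hd, hξ, hη⟩ := exists_rotation (WithLp.toLp 2 fun k => r (Sum.inl k))
    (WithLp.toLp 2 fun k => r (Sum.inr k))
  set y : Fin (m + 3) → ℝ := fun k => r (Sum.inl k)
  set z : Fin (m + 3) → ℝ := fun k => r (Sum.inr k)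
  have hdot : ∀ v w : Fin (m + 3) → ℝ, ∑ k, v k * w k = ∑ k, (R *ᵥ v) k * (R *ᵥ w) k := by
    intro v w
    have h : (R *ᵥ v) ⬝ᵥ (R *ᵥ w) = v ⬝ᵥ w := by
      rw [Matrix.dotProduct_mulVec, Matrix.vecMul_mulVec, mul_eq_one_comm.mp hR, Matrix.vecMul_one]
    exact h.symm
  set s := (R *ᵥ y) 0
  set u := (R *ᵥ z) 0
  set v := (R *ᵥ z) 1
  have hy : R *ᵥ y = Fin.cons s fun _ => 0 := by
    funext k
    exact Fin.cases rfl hξ k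
  have hz : R *ᵥ z = Fin.cons u (Fin.cons v fun _ => 0) := by
    funext k
    exact Fin.cases rfl (Fin.cases rfl hη) k
  have hpt : (Sum.elim (fun k => ∑ l, (Rᵀ l k : ℂ) * (r (Sum.inl l) : ℂ))
      fun k => ∑ l, (Rᵀ l k : ℂ) * (r (Sum.inr l) : ℂ)) = planePt m s u v := by
    have e1 : ∀ k, ∑ l, (Rᵀ l k : ℂ) * (r (Sum.inl l) : ℂ) = ((R *ᵥ y) k : ℝ) := fun k => by
      simp [Matrix.mulVec, dotProduct, y]
    have e2 : ∀ k, ∑ l, (Rᵀ l k : ℂ) * (r (Sum.inr l) : ℂ) = ((R *ᵥ z) k : ℝ) := fun k => by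
      simp [Matrix.mulVec, dotProduct, z]
    funext k
    rcases k with k | k
    · rw [Sum.elim_inl, e1, hy]
      exact Fin.cases rfl (fun _ => Complex.ofReal_zero) k
    · rw [Sum.elim_inr, e2, hz]
      exact Fin.cases rfl (Fin.cases rfl fun _ => Complex.ofReal_zero) k
  have hxx : ∑ k, (r (Sum.inl k) : ℂ) * (r (Sum.inl k) : ℂ) = (s : ℂ) ^ 2 := by
    have : ∑ k, y k * y k = s ^ 2 := by
      rw [hdot, hy]; simp [Fin.sum_univ_succ, pow_two]
    exact_mod_cast this
  have hyy : ∑ k, (r (Sum.inr k) : ℂ) * (r (Sum.inr k) : ℂ) = (u : ℂ) ^ 2 + (v : ℂ) ^ 2 := by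
    have : ∑ k, z k * z k = u ^ 2 + v ^ 2 := by
      rw [hdot, hz]; simp [Fin.sum_univ_succ, pow_two]
    exact_mod_cast this
  have hxy : ∑ k, (r (Sum.inl k) : ℂ) * (r (Sum.inr k) : ℂ) = (s : ℂ) * (u : ℂ) := by
    have : ∑ k, y k * z k = s * u := by
      rw [hdot, hy, hz]; simp [Fin.sum_univ_succ]
    exact_mod_cast this
  have hinv := hP.levi 1 Rᵀ one_pos (by rw [Matrix.transpose_transpose, mul_eq_one_comm.mp hR])
    (by rw [Matrix.det_transpose, hd])
  have h1 := congrArg (MvPolynomial.eval fun s => (r s : ℂ)) hinv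
  rw [eval_leviSubst, hpt] at h1
  simp only [Complex.ofReal_one, inv_one, one_pow, map_one, one_mul] at h1
  rw [eval_aeval_scalarProducts, map_mul, map_pow, eval_symDot, hxx, hyy, hxy, ← h1, hQ]

theorem exists_eq_X_mul_add (Q : MvPolynomial (Fin 3) ℂ) : ∃ Q' : MvPolynomial (Fin 3) ℂ,
    Q = MvPolynomial.X 0 * Q' +
      MvPolynomial.aeval ![0, MvPolynomial.X 1, MvPolynomial.X 2] Q := by
  induction Q using MvPolynomial.induction_on with
  | C c => exact ⟨0, by simp⟩
  | add p q hp hq =>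
    obtain ⟨p', hp⟩ := hp
    obtain ⟨q', hq⟩ := hq
    refine ⟨p' + q', ?_⟩
    rw [map_add]
    nth_rewrite 1 [hp, hq]
    ring
  | mul_X p i hp =>
    obtain ⟨p', hp⟩ := hp
    by_cases hi : i = 0
    · subst hi
      exact ⟨p, by simp [mul_comm]⟩
    · refine ⟨p' * MvPolynomial.X i, ?_⟩
      have h : MvPolynomial.aeval (R := ℂ) (![0, MvPolynomial.X 1, MvPolynomial.X 2] :
          Fin 3 → MvPolynomial (Fin 3) ℂ) (MvPolynomial.X i) = MvPolynomial.X i := by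
        rw [MvPolynomial.aeval_X]
        fin_cases i
        · exact absurd rfl hi
        · rfl
        · rfl
      rw [map_mul, h]
      nth_rewrite 1 [hp]
      ring

theorem symDot_inl_ne_zero : (symDot Sum.inl Sum.inl : Symb (m + 3)) ≠ 0 := by
  intro h
  have := congrArg (MvPolynomial.eval (planePt m 1 0 0)) h
  rw [eval_symDot] at this
  simp [planePt, Fin.sum_univ_succ] at this

/-- Powers of `|ξ|²` can be cancelled, since the other two scalar products are independent on null
vectors `ξ`. -/
theorem exists_aeval_of_pow_mul_eq {P : Symb (m + 3)} (M : ℕ) (Q : MvPolynomial (Fin 3) ℂ)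
    (h : symDot Sum.inl Sum.inl ^ M * P = MvPolynomial.aeval (scalarProducts (m + 3)) Q) :
    ∃ Q : MvPolynomial (Fin 3) ℂ, P = MvPolynomial.aeval (scalarProducts (m + 3)) Q := by
  induction M generalizing Q with
  | zero => exact ⟨Q, by simpa using h⟩
  | succ M ih =>
    obtain ⟨Q', hQ'⟩ := exists_eq_X_mul_add Q
    have h0 : MvPolynomial.aeval (R := ℂ) (![0, MvPolynomial.X 1, MvPolynomial.X 2] :
          Fin 3 → MvPolynomial (Fin 3) ℂ) Q = 0 := by
      refine MvPolynomial.funext fun w => ?_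
      obtain ⟨q, hq⟩ := IsAlgClosed.exists_pow_nat_eq (w 1 - w 2 ^ 2) (n := 2) two_pos
      let c : Fin (m + 3) ⊕ Fin (m + 3) → ℂ :=
        Sum.elim (Fin.cons 1 (Fin.cons Complex.I fun _ => 0))
          (Fin.cons (w 2) (Fin.cons 0 (Fin.cons q fun _ => 0)))
      have h1 := congrArg (MvPolynomial.eval c) h
      have e1 : ∑ k, c (Sum.inl k) * c (Sum.inl k) = 0 := by
        simp [c, Fin.sum_univ_succ]
      have e2 : ∑ k, c (Sum.inr k) * c (Sum.inr k) = w 1 := by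
        simp only [c, Fin.sum_univ_succ, Sum.elim_inr, Fin.cons_zero, Fin.cons_succ, mul_zero,
          Finset.sum_const_zero, add_zero, zero_add]
        linear_combination hq
      have e3 : ∑ k, c (Sum.inl k) * c (Sum.inr k) = w 2 := by
        simp [c, Fin.sum_univ_succ]
      rw [eval_aeval_scalarProducts, e1, e2, e3, map_mul, map_pow, eval_symDot, e1] at h1
      have h2 : (MvPolynomial.aeval (R := ℂ) w).comp (MvPolynomial.aeval (R := ℂ)
          (![0, MvPolynomial.X 1, MvPolynomial.X 2] : Fin 3 → MvPolynomial (Fin 3) ℂ)) =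
          MvPolynomial.aeval (R := ℂ) ![0, w 1, w 2] := by
        refine MvPolynomial.algHom_ext fun s => ?_
        rw [AlgHom.comp_apply, MvPolynomial.aeval_X, MvPolynomial.aeval_X]
        fin_cases s
        · exact map_zero _
        · exact MvPolynomial.aeval_X _ _
        · exact MvPolynomial.aeval_X _ _
      have h3 := congrArg (fun φ => φ Q) h2
      change MvPolynomial.eval w (MvPolynomial.aeval (R := ℂ)
        (![0, MvPolynomial.X 1, MvPolynomial.X 2] : Fin 3 → MvPolynomial (Fin 3) ℂ) Q) =
        MvPolynomial.eval ![0, w 1, w 2] Q at h3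
      rw [h3, ← h1, map_zero]
      simp
    rw [h0, add_zero] at hQ'
    refine ih Q' (mul_left_cancel₀ symDot_inl_ne_zero ?_)
    rw [← mul_assoc, ← pow_succ', h, hQ', map_mul, MvPolynomial.aeval_X]
    rfl

theorem symbol_single {n N i j : ℕ} (hij : i + j ≤ N) (c : ℂ) :
    symbol n N (fun k l => if k = i ∧ l = j then c else 0) =
      MvPolynomial.C c * (symDot Sum.inl Sum.inl ^ i * symDot Sum.inr Sum.inr ^ j *
        symDot Sum.inl Sum.inr ^ (N - i - j)) := by
  rw [symbol, triSum, Finset.sum_eq_single i, Finset.sum_eq_single j]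
  · simp
  · intro l _ hl; simp [hl]
  · intro h; exact absurd (Finset.mem_range.mpr (by omega)) h
  · intro k _ hk
    exact Finset.sum_eq_zero fun l _ => by simp [hk]
  · intro h; exact absurd (Finset.mem_range.mpr (by omega)) h

theorem isHomogeneous_symDot {n : ℕ} (ι κ : Fin n → Fin n ⊕ Fin n) :
    (symDot ι κ).IsHomogeneous 2 :=
  MvPolynomial.IsHomogeneous.sum _ _ _ fun _ _ =>
    (MvPolynomial.isHomogeneous_X ℂ _).mul (MvPolynomial.isHomogeneous_X ℂ _)

theorem exists_homogeneousComponent_eq_symbol (n N : ℕ) (Q : MvPolynomial (Fin 3) ℂ) :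
    ∃ a, MvPolynomial.homogeneousComponent (2 * N) (MvPolynomial.aeval (scalarProducts n) Q) =
      symbol n N a := by
  induction Q using MvPolynomial.induction_on' with
  | monomial d c =>
    have h : MvPolynomial.aeval (scalarProducts n) (MvPolynomial.monomial d c) =
        MvPolynomial.C c * (symDot Sum.inl Sum.inl ^ d 0 * symDot Sum.inr Sum.inr ^ d 1 *
          symDot Sum.inl Sum.inr ^ d 2) := by
      rw [MvPolynomial.aeval_monomial, Finsupp.prod_fintype _ _ (fun s => pow_zero _),
        Fin.prod_univ_three]
      rfl
    have hh : (MvPolynomial.aeval (scalarProducts n) (MvPolynomial.monomial d c)).IsHomogeneous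
        (2 * (d 0 + d 1 + d 2)) := by
      rw [h]
      have h1 := (MvPolynomial.isHomogeneous_C (Fin n ⊕ Fin n) c).mul
        ((((isHomogeneous_symDot (n := n) Sum.inl Sum.inl).pow (d 0)).mul
          ((isHomogeneous_symDot (n := n) Sum.inr Sum.inr).pow (d 1))).mul
          ((isHomogeneous_symDot (n := n) Sum.inl Sum.inr).pow (d 2)))
      rwa [show 0 + (2 * d 0 + 2 * d 1 + 2 * d 2) = 2 * (d 0 + d 1 + d 2) by ring] at h1
    rw [MvPolynomial.homogeneousComponent_of_mem hh]
    split_ifs with hN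
    · refine ⟨fun k l => if k = d 0 ∧ l = d 1 then c else 0, ?_⟩
      rw [h, show d 2 = N - d 0 - d 1 by omega]
      exact (symbol_single (by omega) c).symm
    · refine ⟨fun _ _ => 0, ?_⟩
      simp [symbol, triSum]
  | add p q hp hq =>
    obtain ⟨a, ha⟩ := hp
    obtain ⟨b, hb⟩ := hq
    refine ⟨fun i j => a i j + 1 * b i j, ?_⟩
    rw [map_add, map_add, ha, hb, symbol_add_mul, map_one, one_mul]

theorem IsInvariantSymbol.isHomogeneous {n N : ℕ} {lam mu : ℂ} {P : Symb n}
    (hP : IsInvariantSymbol N lam mu P) : P.IsHomogeneous (2 * N) := by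
  intro d hd
  rw [← hP.degree hd, Finsupp.weight_apply, Finsupp.sum_fintype _ _ (by simp)]
  simp

/-- The first fundamental theorem of invariant theory for two vectors in dimension `n ≥ 3`. -/
theorem IsInvariantSymbol.exists_eq_symbol {n N : ℕ} (hn : 3 ≤ n) {lam mu : ℂ} {P : Symb n}
    (hP : IsInvariantSymbol N lam mu P) : ∃ a, P = symbol n N a := by
  obtain ⟨m, rfl⟩ : ∃ m, n = m + 3 := ⟨n - 3, by omega⟩
  obtain ⟨M, Q, h⟩ := hP.exists_pow_mul_eq
  obtain ⟨Q', h'⟩ := exists_aeval_of_pow_mul_eq M Q h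
  obtain ⟨a, ha⟩ := exists_homogeneousComponent_eq_symbol (m + 3) N Q'
  refine ⟨a, ?_⟩
  rw [← ha, ← h', MvPolynomial.homogeneousComponent_of_mem hP.isHomogeneous, if_pos rfl]

end Rotation

/-! ### Invariant symbols for `n = 2` -/

section Plane

open MvPolynomial

/-- The substitution of `ξ₁ ± i ξ₂`, `η₁ ± i η₂` for the variables. -/
def nullSubst : Symb 2 →ₐ[ℂ] Symb 2 :=
  aeval (Sum.elim
    ![X (Sum.inl 0) + C Complex.I * X (Sum.inl 1), X (Sum.inl 0) - C Complex.I * X (Sum.inl 1)]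
    ![X (Sum.inr 0) + C Complex.I * X (Sum.inr 1), X (Sum.inr 0) - C Complex.I * X (Sum.inr 1)])

theorem nullSubst_X_zero {ι : Fin 2 → Fin 2 ⊕ Fin 2} (hι : ι = Sum.inl ∨ ι = Sum.inr) :
    nullSubst (X (ι 0)) = X (ι 0) + C Complex.I * X (ι 1) := by
  rcases hι with rfl | rfl <;> simp [nullSubst]

theorem nullSubst_X_one {ι : Fin 2 → Fin 2 ⊕ Fin 2} (hι : ι = Sum.inl ∨ ι = Sum.inr) :
    nullSubst (X (ι 1)) = X (ι 0) - C Complex.I * X (ι 1) := by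
  rcases hι with rfl | rfl <;> simp [nullSubst]

/-- The inverse of `nullSubst`. -/
def nullSubstInv : Symb 2 →ₐ[ℂ] Symb 2 :=
  aeval (Sum.elim
    ![C (1 / 2) * (X (Sum.inl 0) + X (Sum.inl 1)),
      C (-Complex.I / 2) * (X (Sum.inl 0) - X (Sum.inl 1))]
    ![C (1 / 2) * (X (Sum.inr 0) + X (Sum.inr 1)),
      C (-Complex.I / 2) * (X (Sum.inr 0) - X (Sum.inr 1))])

theorem nullSubstInv_X_zero {ι : Fin 2 → Fin 2 ⊕ Fin 2} (hι : ι = Sum.inl ∨ ι = Sum.inr) :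
    nullSubstInv (X (ι 0)) = C (1 / 2) * (X (ι 0) + X (ι 1)) := by
  rcases hι with rfl | rfl <;> simp [nullSubstInv]

theorem nullSubstInv_X_one {ι : Fin 2 → Fin 2 ⊕ Fin 2} (hι : ι = Sum.inl ∨ ι = Sum.inr) :
    nullSubstInv (X (ι 1)) = C (-Complex.I / 2) * (X (ι 0) - X (ι 1)) := by
  rcases hι with rfl | rfl <;> simp [nullSubstInv]

theorem algHom_ext_plane {φ ψ : Symb 2 →ₐ[ℂ] Symb 2}
    (h : ∀ ι : Fin 2 → Fin 2 ⊕ Fin 2, (ι = Sum.inl ∨ ι = Sum.inr) →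
      φ (X (ι 0)) = ψ (X (ι 0)) ∧ φ (X (ι 1)) = ψ (X (ι 1))) : φ = ψ := by
  refine algHom_ext fun s => ?_
  rcases s with k | k
  · have := h _ (Or.inl rfl)
    fin_cases k
    exacts [this.1, this.2]
  · have := h _ (Or.inr rfl)
    fin_cases k
    exacts [this.1, this.2]

theorem C_one_half_mul_two : (C (1 / 2 : ℂ) * 2 : Symb 2) = 1 := by
  rw [show (2 : Symb 2) = C 2 from (map_ofNat C 2).symm, ← map_mul]; norm_num

theorem C_I_mul_C_I : (C Complex.I * C Complex.I : Symb 2) = -1 := by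
  rw [← map_mul, Complex.I_mul_I, map_neg, map_one]

theorem C_neg_I_half : (C (-Complex.I / 2) : Symb 2) = -(C Complex.I * C (1 / 2)) := by
  rw [← map_mul, ← map_neg]; congr 1; ring

theorem nullSubst_nullSubstInv (p : Symb 2) : nullSubst (nullSubstInv p) = p := by
  have hC : ∀ z, nullSubst (C z) = C z := nullSubst.commutes
  have h : nullSubst.comp nullSubstInv = AlgHom.id ℂ _ := by
    refine algHom_ext_plane fun ι hι => ?_
    simp only [AlgHom.comp_apply, nullSubstInv_X_zero hι, nullSubstInv_X_one hι, map_mul, map_add,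
      map_sub, hC, nullSubst_X_zero hι, nullSubst_X_one hι, AlgHom.id_apply, C_neg_I_half, map_neg]
    constructor
    · linear_combination X (ι 0) * C_one_half_mul_two
    · linear_combination X (ι 1) * C_one_half_mul_two - 2 * C (1 / 2) * X (ι 1) * C_I_mul_C_I
  exact congrArg (fun φ => φ p) h

theorem nullSubstInv_nullSubst (p : Symb 2) : nullSubstInv (nullSubst p) = p := by
  have hC : ∀ z, nullSubstInv (C z) = C z := nullSubstInv.commutes
  have h : nullSubstInv.comp nullSubst = AlgHom.id ℂ _ := by
    refine algHom_ext_plane fun ι hι => ?_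
    simp only [AlgHom.comp_apply, nullSubstInv_X_zero hι, nullSubstInv_X_one hι, map_mul, map_add,
      map_sub, hC, nullSubst_X_zero hι, nullSubst_X_one hι, AlgHom.id_apply, C_neg_I_half]
    constructor
    · linear_combination X (ι 0) * C_one_half_mul_two -
        C (1 / 2) * (X (ι 0) - X (ι 1)) * C_I_mul_C_I
    · linear_combination X (ι 1) * C_one_half_mul_two +
        C (1 / 2) * (X (ι 0) - X (ι 1)) * C_I_mul_C_I
  exact congrArg (fun φ => φ p) h

theorem nullSubst_injective : Function.Injective nullSubst :=
  Function.LeftInverse.injective nullSubstInv_nullSubst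

/-- The chain rule for polynomials. -/
theorem pderiv_aeval {σ τ : Type*} [Fintype σ] (f : σ → MvPolynomial τ ℂ) (i : τ)
    (p : MvPolynomial σ ℂ) :
    pderiv i (aeval f p) = ∑ t, pderiv i (f t) * aeval f (pderiv t p) := by
  classical
  induction p using MvPolynomial.induction_on with
  | C c => simp
  | add p q hp hq => simp only [map_add, hp, hq, mul_add, Finset.sum_add_distrib]
  | mul_X p s hp =>
    have h : ∀ t, aeval f (pderiv t (p * X s)) =
        (Pi.single s (aeval f p) : σ → MvPolynomial τ ℂ) t + f s * aeval f (pderiv t p) := by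
      intro t
      rw [Derivation.leibniz, pderiv_X, smul_eq_mul, smul_eq_mul, map_add, map_mul, map_mul,
        aeval_X]
      by_cases hs : t = s
      · subst hs; simp
      · simp [hs, Ne.symm hs]
    rw [map_mul, Derivation.leibniz, aeval_X, hp, smul_eq_mul, smul_eq_mul, Finset.mul_sum]
    simp only [h, mul_add, Finset.sum_add_distrib]
    congr 1
    · rw [Finset.sum_eq_single s (fun t _ ht => by simp [ht]) (by simp),
        Pi.single_eq_same, mul_comm]
    · exact Finset.sum_congr rfl fun t _ => by ring

theorem pderiv_nullSubst_zero {ι : Fin 2 → Fin 2 ⊕ Fin 2} (hι : ι = Sum.inl ∨ ι = Sum.inr)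
    (p : Symb 2) :
    pderiv (ι 0) (nullSubst p) = nullSubst (pderiv (ι 0) p) + nullSubst (pderiv (ι 1) p) := by
  rw [nullSubst, pderiv_aeval]
  rcases hι with rfl | rfl <;> simp [Fintype.sum_sum_type, pderiv_X]

theorem pderiv_nullSubst_one {ι : Fin 2 → Fin 2 ⊕ Fin 2} (hι : ι = Sum.inl ∨ ι = Sum.inr)
    (p : Symb 2) :
    pderiv (ι 1) (nullSubst p) =
      C Complex.I * (nullSubst (pderiv (ι 0) p) - nullSubst (pderiv (ι 1) p)) := by
  rw [nullSubst, pderiv_aeval]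
  rcases hι with rfl | rfl <;> simp [Fintype.sum_sum_type, pderiv_X] <;> ring

theorem pderiv_pderiv_comm {σ : Type*} (i j : σ) (p : MvPolynomial σ ℂ) :
    pderiv i (pderiv j p) = pderiv j (pderiv i p) := by
  classical
  ext m
  simp only [coeff_pderiv]
  by_cases h : i = j
  · subst h; rfl
  · simp only [Finsupp.add_apply, Finsupp.single_apply, h, Ne.symm h, if_false, add_zero]
    rw [add_right_comm]
    ring

/-- In the coordinates `ξ₁ ± i ξ₂` the action of `𝔫` decouples. -/
theorem nilOp_nullSubst {ι : Fin 2 → Fin 2 ⊕ Fin 2} (hι : ι = Sum.inl ∨ ι = Sum.inr) (lam : ℂ)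
    (p : Symb 2) :
    nilOp ι lam 0 (nullSubst p) - C Complex.I * nilOp ι lam 1 (nullSubst p) =
      2 * nullSubst (X (ι 0) * pderiv (ι 0) (pderiv (ι 0) p) - C lam * pderiv (ι 0) p) ∧
    nilOp ι lam 0 (nullSubst p) + C Complex.I * nilOp ι lam 1 (nullSubst p) =
      2 * nullSubst (X (ι 1) * pderiv (ι 1) (pderiv (ι 1) p) - C lam * pderiv (ι 1) p) := by
  have hC : ∀ z, nullSubst (C z) = C z := nullSubst.commutes
  have hI : ∀ i (q : Symb 2), pderiv i (C Complex.I * q) = C Complex.I * pderiv i q := by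
    intro i q
    rw [pderiv_C_mul]
  simp only [nilOp, Fin.sum_univ_two, smul_eq_C_mul, pderiv_nullSubst_zero hι,
    pderiv_nullSubst_one hι, map_add, map_sub, map_mul, hI, nullSubst_X_zero hι,
    nullSubst_X_one hι, hC, pderiv_pderiv_comm (ι 1) (ι 0)]
  generalize nullSubst (pderiv (ι 0) (pderiv (ι 0) p)) = a
  generalize nullSubst (pderiv (ι 0) (pderiv (ι 1) p)) = b
  generalize nullSubst (pderiv (ι 1) (pderiv (ι 1) p)) = c
  generalize nullSubst (pderiv (ι 0) p) = d
  generalize nullSubst (pderiv (ι 1) p) = e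
  have h1 := C_I_mul_C_I
  have h2 := C_one_half_mul_two
  generalize (C Complex.I : Symb 2) = j at h1 ⊢
  generalize (C (1 / 2) : Symb 2) = h at h2 ⊢
  generalize (X (ι 0) : Symb 2) = x
  generalize (X (ι 1) : Symb 2) = y
  generalize (C lam : Symb 2) = l
  constructor
  · linear_combination (-h * x * (a - 2 * b + c) - x * (a - c) - y * j * (a - 2 * b + c) +
      h * y * j * (a - 2 * b + c) + l * (d - e)) * h1 + (-2 * b * x + 2 * b * j * y) * h2
  · linear_combination (-h * x * (a - 2 * b + c) + x * (a - c) + y * j * (a - 2 * b + c) -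
      h * y * j * (a - 2 * b + c) - l * (d - e)) * h1 + (-2 * b * (x + j * y)) * h2

theorem coeff_euler {σ : Type*} (i : σ) (lam : ℂ) (p : MvPolynomial σ ℂ) (m : σ →₀ ℕ) :
    MvPolynomial.coeff m (X i * pderiv i (pderiv i p) - C lam * pderiv i p) =
      (m i + 1) * (m i - lam) * MvPolynomial.coeff (m + Finsupp.single i 1) p := by
  classical
  rw [coeff_sub, coeff_C_mul, coeff_X_mul', coeff_pderiv, coeff_pderiv, coeff_pderiv]
  split_ifs with h
  · have hm : Finsupp.single i 1 ≤ m := by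
      rw [Finsupp.single_le_iff]
      exact Nat.one_le_iff_ne_zero.mpr (Finsupp.mem_support_iff.mp h)
    rw [tsub_add_cancel_of_le hm]
    have h1 : (((m - Finsupp.single i 1 : σ →₀ ℕ) i : ℕ) : ℂ) + 1 = m i := by
      have h2 : (m - Finsupp.single i 1 : σ →₀ ℕ) i + 1 = m i := by
        have := Finsupp.mem_support_iff.mp h
        rw [Finsupp.tsub_apply, Finsupp.single_eq_same]; omega
      exact_mod_cast h2
    rw [h1]
    ring
  · rw [Finsupp.notMem_support_iff.mp h]
    simp

/-- In the coordinates `ξ₁ ± i ξ₂`, `η₁ ± i η₂` the condition under `𝔫` is a two-term recursion for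
the coefficients of the symbol. -/
theorem IsInvariantSymbol.recursion {N : ℕ} {lam mu : ℂ} {p : Symb 2}
    (hP : IsInvariantSymbol N lam mu (nullSubst p)) (i : Fin 2) (m : Fin 2 ⊕ Fin 2 →₀ ℕ) :
    (m (Sum.inl i) + 1) * (m (Sum.inl i) - lam) * MvPolynomial.coeff (m + Finsupp.single (Sum.inl i) 1) p +
      (m (Sum.inr i) + 1) * (m (Sum.inr i) - mu) * MvPolynomial.coeff (m + Finsupp.single (Sum.inr i) 1) p =
      0 := by
  have h0 := hP.nil 0
  have h1 := hP.nil 1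
  rw [nilOp₂] at h0 h1
  have a1 := nilOp_nullSubst (Or.inl rfl) lam p
  have a2 := nilOp_nullSubst (Or.inr rfl) mu p
  have key : ∀ i : Fin 2, nullSubst ((X (Sum.inl i) * pderiv (Sum.inl i) (pderiv (Sum.inl i) p) -
      C lam * pderiv (Sum.inl i) p) + (X (Sum.inr i) * pderiv (Sum.inr i) (pderiv (Sum.inr i) p) -
      C mu * pderiv (Sum.inr i) p)) = 0 := by
    refine Fin.forall_fin_two.mpr ⟨?_, ?_⟩
    all_goals
      refine (mul_eq_zero.mp (?_ : (2 : Symb 2) * _ = 0)).resolve_left two_ne_zero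
      rw [map_add]
    · linear_combination h0 - C Complex.I * h1 - a1.1 - a2.1
    · linear_combination h0 + C Complex.I * h1 - a1.2 - a2.2
  have h2 := congrArg (MvPolynomial.coeff m) (nullSubst_injective ((key i).trans (map_zero nullSubst).symm))
  rwa [coeff_add, coeff_euler, coeff_euler, coeff_zero] at h2

theorem leviSubst_nullSubst (a θ : ℝ) (p : Symb 2) :
    leviSubst a !![Real.cos θ, -Real.sin θ; Real.sin θ, Real.cos θ] (nullSubst p) =
      nullSubst (aeval (fun s : Fin 2 ⊕ Fin 2 => C ((a : ℂ)⁻¹ * s.elim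
        ![Complex.exp (-θ * Complex.I), Complex.exp (θ * Complex.I)]
        ![Complex.exp (-θ * Complex.I), Complex.exp (θ * Complex.I)]) * X s) p) := by
  set R : Matrix (Fin 2) (Fin 2) ℝ := !![Real.cos θ, -Real.sin θ; Real.sin θ, Real.cos θ] with hR
  have e1 : Complex.exp (-θ * Complex.I) = Complex.cos θ - Complex.sin θ * Complex.I := by
    rw [Complex.exp_mul_I, Complex.cos_neg, Complex.sin_neg]; ring
  have e2 : Complex.exp (θ * Complex.I) = Complex.cos θ + Complex.sin θ * Complex.I :=
    Complex.exp_mul_I _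
  have hC : ∀ z, nullSubst (C z) = C z := nullSubst.commutes
  have hC' : ∀ z, leviSubst a R (C z) = C z := (leviSubst a R).commutes
  set ε : Fin 2 ⊕ Fin 2 → ℂ := fun s => (a : ℂ)⁻¹ * s.elim
        ![Complex.exp (-θ * Complex.I), Complex.exp (θ * Complex.I)]
        ![Complex.exp (-θ * Complex.I), Complex.exp (θ * Complex.I)] with hε
  have h : (leviSubst a R).comp nullSubst = nullSubst.comp (aeval fun s => C (ε s) * X s) := by
    refine algHom_ext_plane fun ι hι => ?_
    have hX : ∀ k, leviSubst a R (X (ι k)) = C ((a⁻¹ * R 0 k : ℝ) : ℂ) * X (ι 0) +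
        C ((a⁻¹ * R 1 k : ℝ) : ℂ) * X (ι 1) := by
      intro k
      rcases hι with rfl | rfl <;> simp [leviSubst, Fin.sum_univ_two]
    have hε0 : C (ε (ι 0)) = (C (a : ℂ)⁻¹ * (C (Complex.cos θ) - C (Complex.sin θ) * C Complex.I) :
        Symb 2) := by
      rcases hι with rfl | rfl <;>
        simp only [hε, Sum.elim_inl, Sum.elim_inr, Matrix.cons_val_zero, e1, map_mul, map_sub]
    have hε1 : C (ε (ι 1)) = (C (a : ℂ)⁻¹ * (C (Complex.cos θ) + C (Complex.sin θ) * C Complex.I) :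
        Symb 2) := by
      rcases hι with rfl | rfl <;>
        simp only [hε, Sum.elim_inl, Sum.elim_inr, Matrix.cons_val_one, Matrix.cons_val_fin_one, e2,
          map_mul, map_add]
    simp only [AlgHom.comp_apply, nullSubst_X_zero hι, nullSubst_X_one hι, map_add, map_sub,
      map_mul, hC', hX, aeval_X, hC, hε0, hε1]
    simp only [hR, Matrix.cons_val', Matrix.cons_val_zero, Matrix.cons_val_one, Matrix.of_apply,
      Matrix.cons_val_fin_one, Complex.ofReal_mul, Complex.ofReal_inv, Complex.ofReal_neg,
      Complex.ofReal_cos, Complex.ofReal_sin, map_mul, map_neg]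
    have h1 := C_I_mul_C_I
    constructor
    · linear_combination C (a : ℂ)⁻¹ * C (Complex.sin θ) * X (ι 1) * h1
    · linear_combination C (a : ℂ)⁻¹ * C (Complex.sin θ) * X (ι 1) * h1
  exact congrArg (fun φ => φ p) h

theorem IsInvariantSymbol.coeff_weight {N : ℕ} {lam mu : ℂ} {p : Symb 2}
    (hP : IsInvariantSymbol N lam mu (nullSubst p)) {m : Fin 2 ⊕ Fin 2 →₀ ℕ} (hm : MvPolynomial.coeff m p ≠ 0)
    {a : ℝ} (ha : 0 < a) (θ : ℝ) :
    ((a : ℂ)⁻¹ * Complex.exp (-θ * Complex.I)) ^ (m (Sum.inl 0) + m (Sum.inr 0)) *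
      ((a : ℂ)⁻¹ * Complex.exp (θ * Complex.I)) ^ (m (Sum.inl 1) + m (Sum.inr 1)) =
      (a : ℂ)⁻¹ ^ (2 * N) := by
  have hcs : Real.cos θ * Real.cos θ + Real.sin θ * Real.sin θ = 1 := by
    have := Real.cos_sq_add_sin_sq θ
    nlinarith
  have h := hP.levi a !![Real.cos θ, -Real.sin θ; Real.sin θ, Real.cos θ] ha
    (by
      ext i j
      fin_cases i <;> fin_cases j <;> simp [Matrix.mul_apply, Fin.sum_univ_two] <;> linarith)
    (by rw [Matrix.det_fin_two_of]; linarith)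
  have hC : ∀ z, nullSubst (C z) = C z := nullSubst.commutes
  rw [leviSubst_nullSubst, ← hC, ← map_mul] at h
  have h1 := congrArg (MvPolynomial.coeff m) (nullSubst_injective h)
  rw [coeff_aeval_C_mul_X, coeff_C_mul] at h1
  have h2 := mul_right_cancel₀ hm h1
  rw [← h2, Fintype.prod_sum_type, Fin.prod_univ_two, Fin.prod_univ_two]
  simp only [Sum.elim_inl, Sum.elim_inr, Matrix.cons_val_zero, Matrix.cons_val_one]
  ring

theorem IsInvariantSymbol.coeff_index {N : ℕ} {lam mu : ℂ} {p : Symb 2}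
    (hP : IsInvariantSymbol N lam mu (nullSubst p)) {m : Fin 2 ⊕ Fin 2 →₀ ℕ} (hm : MvPolynomial.coeff m p ≠ 0) :
    m (Sum.inl 0) + m (Sum.inr 0) = N ∧ m (Sum.inl 1) + m (Sum.inr 1) = N := by
  have h1 := hP.coeff_weight hm two_pos 0
  have h2 : m (Sum.inl 0) + m (Sum.inr 0) + (m (Sum.inl 1) + m (Sum.inr 1)) = 2 * N := by
    simp only [Complex.ofReal_zero, neg_zero, zero_mul, Complex.exp_zero, mul_one, ← pow_add] at h1
    rw [inv_pow, inv_pow, inv_inj] at h1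
    exact Nat.pow_right_injective le_rfl (by exact_mod_cast h1)
  have h3 : m (Sum.inl 0) + m (Sum.inr 0) = m (Sum.inl 1) + m (Sum.inr 1) := by
    have h6 := hP.coeff_weight hm one_pos
    generalize m (Sum.inl 0) + m (Sum.inr 0) = A at *
    generalize m (Sum.inl 1) + m (Sum.inr 1) = B at *
    by_contra hAB
    have hne : (B : ℂ) - A ≠ 0 := sub_ne_zero.mpr fun h => hAB (by exact_mod_cast h.symm)
    -- The angle is chosen such that the two sides differ by a sign.
    have h4 := h6 (Real.pi / ((B : ℝ) - A))
    have h5 : (A : ℂ) * (-((Real.pi / ((B : ℝ) - A) : ℝ) : ℂ) * Complex.I) +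
        B * (((Real.pi / ((B : ℝ) - A) : ℝ) : ℂ) * Complex.I) = Real.pi * Complex.I := by
      push_cast
      field_simp
      ring
    rw [Complex.ofReal_one, inv_one, one_mul, one_mul, one_pow, ← Complex.exp_nat_mul,
      ← Complex.exp_nat_mul, ← Complex.exp_add, h5, Complex.exp_pi_mul_I] at h4
    norm_num at h4
  omega

/-- In dimension two an invariant symbol is determined by one of its coefficients. -/
theorem IsInvariantSymbol.eq_zero_of_coeff {N : ℕ} {lam mu : ℂ} (hlam : ∀ k : ℕ, lam ≠ k)
    {p : Symb 2} (hP : IsInvariantSymbol N lam mu (nullSubst p))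
    (h0 : MvPolynomial.coeff (Finsupp.single (Sum.inr 0) N + Finsupp.single (Sum.inr 1) N) p = 0) : p = 0 := by
  have key : ∀ (d : ℕ) (m : Fin 2 ⊕ Fin 2 →₀ ℕ), m (Sum.inl 0) + m (Sum.inl 1) = d →
      MvPolynomial.coeff m p = 0 := by
    intro d
    induction d with
    | zero =>
      intro m hm
      by_contra hc
      have h1 := hP.coeff_index hc
      refine hc ?_
      rw [← h0]
      congr 1
      ext s
      rcases s with k | k <;> fin_cases k <;> simp <;> omega
    | succ d ih =>
      intro m hm
      obtain ⟨i, hi⟩ : ∃ i, m (Sum.inl i) ≠ 0 := by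
        by_contra! hc
        have := hc 0
        have := hc 1
        omega
      set m' := m - Finsupp.single (Sum.inl i) 1 with hm'
      have hmm : m' + Finsupp.single (Sum.inl i) 1 = m :=
        tsub_add_cancel_of_le (by rw [Finsupp.single_le_iff]; omega)
      have h1 := hP.recursion i m'
      have h2 : MvPolynomial.coeff (m' + Finsupp.single (Sum.inr i) 1) p = 0 := by
        refine ih _ ?_
        have h3 : m' (Sum.inl 0) + m' (Sum.inl 1) + 1 = d + 1 := by
          rw [← hm, ← hmm]
          fin_cases i <;> simp <;> omega
        simp only [Finsupp.add_apply, Finsupp.single_apply, reduceCtorEq, if_false, add_zero]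
        omega
      rw [h2, mul_zero, add_zero, hmm] at h1
      refine (mul_eq_zero.mp h1).resolve_left (mul_ne_zero (Nat.cast_add_one_ne_zero _) ?_)
      exact sub_ne_zero.mpr (hlam _).symm
  ext m
  rw [key _ m rfl, coeff_zero]

end Plane

/-! ### Uniqueness for non-exceptional parameters -/

section Conclusion

variable {n : ℕ}

theorem symbol_coeff_ne_zero (hn : 2 ≤ n) (N : ℕ) (lam mu : ℂ) :
    symbol n N (coeff n N lam mu) ≠ 0 := fun h => by
  have := eq_zero_of_symbol_eq_zero hn h 0 0 (Nat.zero_le N)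
  rw [coeff_zero_zero] at this
  exact one_ne_zero this

/-- For non-exceptional parameters the invariant symbols form a line. -/
theorem IsInvariantSymbol.exists_eq_C_mul (hn : 2 ≤ n) {N : ℕ} {lam mu : ℂ}
    (hl : lam ∉ exceptional n) (hm : mu ∉ exceptional n) {P : Symb n}
    (hP : IsInvariantSymbol N lam mu P) :
    ∃ c : ℂ, P = MvPolynomial.C c * symbol n N (coeff n N lam mu) := by
  have hD := commonDenom_ne_zero (N := N) hl hm
  have hQ := (coeff_isSol hD).isInvariantSymbol
  rcases hn.eq_or_lt with rfl | hn3
  · have hlam : ∀ k : ℕ, lam ≠ k := fun k hk => hl ⟨k + 1, by rw [hk]; push_cast; ring⟩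
    set Q := symbol 2 N (coeff 2 N lam mu)
    have hq : nullSubst (nullSubstInv Q) = Q := nullSubst_nullSubstInv Q
    have hp : nullSubst (nullSubstInv P) = P := nullSubst_nullSubstInv P
    set q := nullSubstInv Q
    set p := nullSubstInv P
    set m : Fin 2 ⊕ Fin 2 →₀ ℕ := Finsupp.single (Sum.inr 0) N + Finsupp.single (Sum.inr 1) N
    have hq0 : MvPolynomial.coeff m q ≠ 0 := fun h => by
      rw [← hq] at hQ
      have := hQ.eq_zero_of_coeff hlam h
      rw [this, map_zero] at hq
      exact symbol_coeff_ne_zero le_rfl N lam mu hq.symm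
    refine ⟨MvPolynomial.coeff m p / MvPolynomial.coeff m q, ?_⟩
    set c := MvPolynomial.coeff m p / MvPolynomial.coeff m q
    have hC : nullSubst (MvPolynomial.C c) = MvPolynomial.C c := nullSubst.commutes c
    have h1 : nullSubst (p - MvPolynomial.C c * q) = P - MvPolynomial.C c * Q := by
      rw [map_sub, map_mul, hC, hp, hq]
    have h2 := hP.sub_C_mul hQ c
    rw [← h1] at h2
    have h3 := h2.eq_zero_of_coeff hlam (by
      rw [MvPolynomial.coeff_sub, MvPolynomial.coeff_C_mul, div_mul_cancel₀ _ hq0, sub_self])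
    rw [h3, map_zero] at h1
    exact sub_eq_zero.mp h1.symm
  · obtain ⟨a, rfl⟩ := hP.exists_eq_symbol hn3
    have ha : IsSol n N lam mu a := isSol_of_nilOp₂_eq_zero hn hP.nil
    refine ⟨a 0 0, ?_⟩
    have h1 := (ha.add_mul (coeff_isSol hD) (-a 0 0)).eq_zero_of_commonDenom hD
      (by rw [coeff_zero_zero]; ring)
    have h2 : symbol n N (fun i j => a i j + -a 0 0 * coeff n N lam mu i j) = 0 := by
      rw [symbol_congr (b := fun _ _ => 0) h1]
      simp [symbol, triSum]
    rw [symbol_add_mul, map_neg] at h2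
    linear_combination h2

theorem exists_eq_smul_op (hn : 2 ≤ n) {N : ℕ} {lam mu : ℂ} (hl : lam ∉ exceptional n)
    (hm : mu ∉ exceptional n) {B : BilinMap n (-lam) (-mu) (-lam - mu + 2 * N)}
    (hB : IsConformallyInvariant B) :
    ∃ c : ℂ, B = c • (coeff_isSol (commonDenom_ne_zero (N := N) hl hm)).op := by
  obtain ⟨P, hP⟩ := exists_symbol_of_isConformallyInvariant hB
  obtain ⟨c, rfl⟩ :=
    (isInvariantSymbol_of_isConformallyInvariant hP).exists_eq_C_mul hn hl hm
  refine ⟨c, LinearMap.ext₂ fun f h => Subtype.ext (funext fun g => ?_)⟩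
  rw [hP, ← MvPolynomial.smul_eq_C_mul, map_smul]
  rfl

theorem op_coeff_ne_zero (hn : 2 ≤ n) {N : ℕ} {lam mu : ℂ} (h : commonDenom n N lam mu ≠ 0) :
    (coeff_isSol h).op ≠ 0 := fun h0 => by
  have := (coeff_isSol h).eq_zero_of_op_eq_zero hn h0 0 0 (Nat.zero_le N)
  rw [coeff_zero_zero] at this
  exact one_ne_zero this

end Conclusion

end ConformalBilinear

end

theorem mainTheorem4 (n : ℕ) (hn : 2 ≤ n) :
    -- outside the exceptional set: existence, explicit form, uniqueness up to a multiple
    (∀ (N : ℕ) (lam mu : ℂ), lam ∉ ConformalBilinear.exceptional n →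
      mu ∉ ConformalBilinear.exceptional n →
      (∀ i j, i + j ≤ N →
        ConformalBilinear.coeff n N lam mu i j = ConformalBilinear.coeff n N mu lam j i) ∧
      ∃ B : ConformalBilinear.BilinMap n (-lam) (-mu) (-lam - mu + 2 * N),
        ConformalBilinear.IsConformallyInvariant B ∧
        ConformalBilinear.HasForm N (ConformalBilinear.coeff n N lam mu) B ∧
        B ≠ 0 ∧
        ∀ B' : ConformalBilinear.BilinMap n (-lam) (-mu) (-lam - mu + 2 * N),
          ConformalBilinear.IsConformallyInvariant B' → ∃ c : ℂ, B' = c • B) ∧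
    -- all parameters for which the formula has no vanishing denominator
    (∀ (N : ℕ) (lam mu : ℂ), ConformalBilinear.commonDenom n N lam mu ≠ 0 →
      (∀ i j, i + j ≤ N → ConformalBilinear.polyCoeff n N lam mu i j =
        ConformalBilinear.commonDenom n N lam mu * ConformalBilinear.coeff n N lam mu i j) ∧
      ∃ B : ConformalBilinear.BilinMap n (-lam) (-mu) (-lam - mu + 2 * N),
        ConformalBilinear.IsConformallyInvariant B ∧
        ConformalBilinear.HasForm N (ConformalBilinear.coeff n N lam mu) B ∧
        B ≠ 0) ∧
    -- all parameters, after multiplication by the common denominator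
    (∀ (N : ℕ) (lam mu : ℂ),
      ∃ B : ConformalBilinear.BilinMap n (-lam) (-mu) (-lam - mu + 2 * N),
        ConformalBilinear.IsConformallyInvariant B ∧
        ConformalBilinear.HasForm N (ConformalBilinear.polyCoeff n N lam mu) B) ∧
    -- for all parameters there is a nonzero operator of this form
    (∀ (N : ℕ) (lam mu : ℂ),
      ∃ (a : ℕ → ℕ → ℂ) (B : ConformalBilinear.BilinMap n (-lam) (-mu) (-lam - mu + 2 * N)),
        ConformalBilinear.IsConformallyInvariant B ∧
        ConformalBilinear.HasForm N a B ∧ B ≠ 0) ∧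
    -- uniqueness can fail for exceptional parameters
    (∃ (N : ℕ) (lam mu : ℂ), lam ∈ ConformalBilinear.exceptional n ∧
      mu ∈ ConformalBilinear.exceptional n ∧
      ∃ B B' : ConformalBilinear.BilinMap n (-lam) (-mu) (-lam - mu + 2 * N),
        ConformalBilinear.IsConformallyInvariant B ∧
        ConformalBilinear.IsConformallyInvariant B' ∧
        LinearIndependent ℂ ![B, B']) := by
  refine ⟨fun N lam mu hl hm => ?_, fun N lam mu h => ?_, fun N lam mu => ?_, fun N lam mu => ?_, ?_⟩
  · have h := ConformalBilinear.commonDenom_ne_zero (N := N) hl hm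
    exact ⟨ConformalBilinear.coeff_swap h, _,
      (ConformalBilinear.coeff_isSol h).isConformallyInvariant,
      (ConformalBilinear.coeff_isSol h).hasForm, ConformalBilinear.op_coeff_ne_zero hn h,
      fun _ hB => ConformalBilinear.exists_eq_smul_op hn hl hm hB⟩
  · exact ⟨fun i j hij => ConformalBilinear.polyCoeff_eq h hij, _,
      (ConformalBilinear.coeff_isSol h).isConformallyInvariant,
      (ConformalBilinear.coeff_isSol h).hasForm, ConformalBilinear.op_coeff_ne_zero hn h⟩
  · exact ⟨_, (ConformalBilinear.polyCoeff_isSol n N lam mu).isConformallyInvariant,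
      (ConformalBilinear.polyCoeff_isSol n N lam mu).hasForm⟩
  · obtain ⟨a, ha, i, j, hij, h0⟩ := ConformalBilinear.exists_isSol_ne_zero n N lam mu
    exact ⟨a, _, ha.isConformallyInvariant, ha.hasForm,
      fun h => h0 (ha.eq_zero_of_op_eq_zero hn h i j hij)⟩
  · have h1 : 1 - (n : ℂ) / 2 ∈ ConformalBilinear.exceptional n := ⟨1, by push_cast; ring⟩
    exact ⟨1, _, _, h1, h1, ConformalBilinear.exists_linearIndependent hn⟩
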